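/- All spaces are k-spaces (compactly generated spaces); products carry the k-ified product topology. Let $O$ be a doubly reduced topological operad, i.e. a symmetric operad in spaces with $O(0)$ and $O(1)$ one-point spaces, and let $M$ be an infinitesimal bimodule ($O$-Ibimodule) over $O$: a sequence of spaces $M(n)$ with right actions of $\Sigma_n$, infinitesimal left operations $O(n)\times M(m)\to M(n+m-1)$ and right operations $M(n)\times O(m)\to M(n+m-1)$, $1\le i\le n$, satisfying the usual equivariance, unit, associativity and commutativity axioms. Let $k\ge 0$. **Trees.** A pearled tree is a rooted tree with one distinguished vertex $p$ (the pearl) and with $k$ leaves labelled bijectively by $\{1,\dots,k\}$; $|v|$ denotes the number of inputs of a vertex $v$. Let $\Psi_k$ be the poset of (isomorphism classes of) non-planar pearled trees whose vertices other than the pearl have at least two inputs, where $T\le T'$ if $T'$ is obtained from $T$ by contracting inner edges. It has a greatest element, the pearled corolla; $\partial\Psi_k=\Psi_k\setminus\{\text{corolla}\}$, and $T\downarrow\Psi_k=\{T'\in\Psi_k: T\le T'\}$. The functor $\rho_k^M$ from $\Psi_k$ to spaces sends $T$ to the space $M(|p|)\times\prod_{v\ne p}O(|v|)$ of labellings of the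 vertices of $T$, and sends $T\le T'$ to the map which composes labels along the contracted edges, by means of the operad structure of $O$ and the infinitesimal bimodule structure of $M$. For a diagram $F$ over a poset $C$, $\operatorname{hocolim}_C F$ is the quotient of $\coprod_{c\in C}|c\downarrow C|\times F(c)$ by $(x,a)\sim(x,F(c\le c')(a))$ for $c\le c'$, $x\in|c'\downarrow C|\subset|c\downarrow C|$, $a\in F(c)$, where $|c\downarrow C|$ is the geometric realization of the nerve of $\{c'\in C:c\le c'\}$. **The resolution.** A point of $\mathcal{I}b^\Lambda(M)(k)$ is a class $[T;\{a_v\};\{t_v\}]$, where $T$ is a planar pearled tree with $k$ labelled leaves whose vertices other than the pearl have at least one input, $a_p\in M(|p|)$, $a_v\in O(|v|)$ and $t_v\in[0,1]$ for vertices $v\ne p$, $t_p=0$, and $t_v\le t_w$ whenever $v$ and $w$ are adjacent and $v$ is closer to the pearl. The space $\mathcal{I}b^\Lambda(M)(k)$ is the quotient of the disjoint union over $T$ of these spaces of labels by the relations: (a) a vertex with one input labelled by the unit of $O$ is removed; (b) permuting the inputs of a vertex corresponds to acting by the permutation on its label; (c) an inner edge joining two vertices other than the pearl with the same number $t$ is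 contracted, composing the labels in $O$; (d) a vertex with $t_v=0$ adjacent to the pearl is contracted into the pearl by the infinitesimal bimodule structure. The prime component of a point is obtained by removing all vertices with $t_v=1$ (keeping the part containing the pearl, and turning each edge going away from the pearl to a removed vertex lying above into a leaf). The $j$-th filtration term consists of the points whose prime component has at most $j$ geometrical inputs, here (as only the pearl may have no inputs) leaves; $\partial\mathcal{I}b^\Lambda(M)(k)$ is the $(k-1)$-st filtration term of $\mathcal{I}b^\Lambda(M)(k)$ (empty for $k=0$). A point $x$ is labelled by $T_0\in\Psi_k$ if it has a representative $[T;\{a_v\};\{t_v\}]$ such that all vertices of $T$ other than the pearl have at least two inputs and the non-planar tree underlying $T$ is $T_0$. **Theorem.** For every $k\ge0$ there is a homeomorphism $$\delta_k\colon \operatorname{hocolim}_{\Psi_k}\rho_k^M\longrightarrow\mathcal{I}b^\Lambda(M)(k),$$ defined for all doubly reduced $O$ and all $O$-Ibimodules $M$ and natural in $(O,M)$ (in particular natural in $M$ for fixed $O$), such that (i) $\delta_k$ sends $\operatorname{hocolim}_{\partial\Psi_k}\rho_k^M$ homeomorphically onto $\partial\mathcal{I}b^\Lambda(M)(k)$;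 (ii) for every $T\in\Psi_k$, $\delta_k$ sends $\operatorname{hocolim}_{T\downarrow\Psi_k}\rho_k^M$ homeomorphically onto the subspace of those points of $\mathcal{I}b^\Lambda(M)(k)$ which are labelled by some tree of $T\downarrow\Psi_k$. -/

import Mathlib

universe u v

open CategoryTheory

namespace BoardmanVogt

/-! ### Operads and infinitesimal bimodules in compactly generated spaces -/

/-- The planar bookkeeping of a partial composition: when the `i`-th of `n` inputs is replaced by
`m` new inputs, the `n + m - 1` resulting inputs are the old inputs `j ≠ i` together with the `m`
new ones, ordered from left to right. -/
def slot {n m : ℕ} (i : Fin n) : {j : Fin n // j ≠ i} ⊕ Fin m ≃ Fin (n + m - 1) where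
  toFun := Sum.elim
    (fun j => ⟨if j.1 < i then j.1.1 else j.1.1 + m - 1, by
      have h1 := j.1.2; have h2 := i.2
      have h3 : j.1.1 ≠ i.1 := fun h => j.2 (Fin.ext h)
      split_ifs with h <;> simp only [Fin.lt_def] at h <;> omega⟩)
    (fun l => ⟨i.1 + l.1, by have h1 := l.2; have h2 := i.2; omega⟩)
  invFun p :=
    if h : p.1 < i.1 then .inl ⟨⟨p.1, by omega⟩, fun e => by simp [← e] at h⟩
    else if h' : p.1 < i.1 + m then .inr ⟨p.1 - i.1, by omega⟩
    else .inl ⟨⟨p.1 + 1 - m, by have := p.2; omega⟩, fun e => by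
      have := congrArg Fin.val e; simp only at this; omega⟩
  left_inv := by
    rintro (⟨j, hj⟩ | l)
    · have h3 : j.1 ≠ i.1 := fun h => hj (Fin.ext h)
      by_cases h : j.1 < i.1
      · simp [h, Fin.lt_def, -Fin.val_fin_lt]
      · have e1 : ¬ (j.1 + m - 1 < i.1) := by omega
        have e2 : ¬ (j.1 + m - 1 < i.1 + m) := by omega
        simp only [Sum.elim_inl, Fin.lt_def, h, if_false, e1, e2, dite_false]
        congr 2; apply Fin.ext; simp only; omega
    · simp
  right_inv := by
    intro p
    by_cases h : p.1 < i.1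
    · simp [h, Fin.lt_def, -Fin.val_fin_lt]
    · by_cases h' : p.1 < i.1 + m
      · simp only [h, h', dite_false, dite_true, Sum.elim_inr]
        apply Fin.ext; simp only; omega
      · simp only [h, h', dite_false, Sum.elim_inl, Fin.lt_def]
        apply Fin.ext; simp only
        rw [if_neg (by omega)]; omega

/-- The relabelling of the inputs of a partial composition induced by relabellings of the inputs
of its two factors (a block permutation). -/
def blockEquiv {n n' m m' : ℕ} (σ : Fin n' ≃ Fin n) (τ : Fin m' ≃ Fin m) (i : Fin n') :
    Fin (n' + m' - 1) ≃ Fin (n + m - 1) :=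
  (slot i).symm.trans
    ((Equiv.sumCongr (σ.subtypeEquiv fun j => by simp) τ).trans (slot (σ i)))

/-- The product of `k`-spaces: the `k`-ification of the usual product topology. -/
def KProd (X : Type v) (Y : Type u) : Type (max v u) := X × Y

instance KProd.instTop (X : Type v) (Y : Type u) [TopologicalSpace X] [TopologicalSpace Y] :
    TopologicalSpace (KProd X Y) :=
  TopologicalSpace.compactlyGenerated.{u} (X × Y)

/-- A (symmetric) operad in the category of `k`-spaces (compactly generated spaces).

The underlying `Σ`-sequence is a functor on the opposite of the groupoid of the finite sets
`Fin n` and bijections; as a bijection `Fin m ≃ Fin n` exists only if `m = n`, this is the same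
as a right action of the symmetric group on each `obj n`. The input `j` of `act e x` is the
input `e j` of `x`. The operations `comp i` are the partial compositions `x ∘ᵢ y`; they are
continuous on the product of `k`-spaces, i.e. on the `k`-ification of the usual product. -/
structure TopOperad where
  obj : ℕ → Type u
  [top : ∀ n, TopologicalSpace (obj n)]
  [kspace : ∀ n, UCompactlyGeneratedSpace.{u} (obj n)]
  act : ∀ {m n : ℕ}, (Fin m ≃ Fin n) → obj n → obj m
  one : obj 1
  comp : ∀ {n m : ℕ}, Fin n → obj n → obj m → obj (n + m - 1)
  continuous_act : ∀ {m n : ℕ} (e : Fin m ≃ Fin n), Continuous (act e)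
  continuous_comp : ∀ {n m : ℕ} (i : Fin n),
    Continuous fun p : KProd (obj n) (obj m) => comp i p.1 p.2
  act_refl : ∀ {n : ℕ} (x : obj n), act (Equiv.refl (Fin n)) x = x
  act_trans : ∀ {l m n : ℕ} (e : Fin l ≃ Fin m) (f : Fin m ≃ Fin n) (x : obj n),
    act (e.trans f) x = act e (act f x)
  act_comp_act : ∀ {n n' m m' : ℕ} (σ : Fin n' ≃ Fin n) (τ : Fin m' ≃ Fin m) (i : Fin n')
    (x : obj n) (y : obj m),
    comp i (act σ x) (act τ y) = act (blockEquiv σ τ i) (comp (σ i) x y)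
  one_comp : ∀ {n : ℕ} (x : obj n) (h : 1 + n - 1 = n), comp 0 one x = act (finCongr h) x
  comp_one : ∀ {n : ℕ} (i : Fin n) (x : obj n) (h : n + 1 - 1 = n),
    comp i x one = act (finCongr h) x
  assoc : ∀ {n m l : ℕ} (i : Fin n) (j : Fin m) (x : obj n) (y : obj m) (z : obj l)
    (h : n + m - 1 + l - 1 = n + (m + l - 1) - 1),
    comp (slot i (.inr j)) (comp i x y) z = act (finCongr h) (comp i x (comp j y z))
  comm : ∀ {n m l : ℕ} (i j : Fin n) (hij : i ≠ j) (x : obj n) (y : obj m) (z : obj l)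
    (h : n + m - 1 + l - 1 = n + l - 1 + m - 1),
    comp (slot i (.inl ⟨j, hij.symm⟩)) (comp i x y) z =
      act (finCongr h) (comp (slot j (.inl ⟨i, hij⟩)) (comp j x z) y)

attribute [instance] TopOperad.top TopOperad.kspace

/-- A doubly reduced operad: `O(0)` and `O(1)` are one-point spaces. -/
def TopOperad.DoublyReduced (O : TopOperad.{u}) : Prop :=
  (Nonempty (O.obj 0) ∧ Subsingleton (O.obj 0)) ∧ (Nonempty (O.obj 1) ∧ Subsingleton (O.obj 1))

/-- An infinitesimal bimodule over the operad `O`: a `Σ`-sequence of `k`-spaces with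
infinitesimal left operations `left i : O(n) × M(m) → M(n + m - 1)` and right operations
`right i : M(m) × O(n) → M(m + n - 1)`. -/
structure Ibimodule (O : TopOperad.{u}) where
  obj : ℕ → Type u
  [top : ∀ n, TopologicalSpace (obj n)]
  [kspace : ∀ n, UCompactlyGeneratedSpace.{u} (obj n)]
  act : ∀ {m n : ℕ}, (Fin m ≃ Fin n) → obj n → obj m
  left : ∀ {n m : ℕ}, Fin n → O.obj n → obj m → obj (n + m - 1)
  right : ∀ {n m : ℕ}, Fin n → obj n → O.obj m → obj (n + m - 1)
  continuous_act : ∀ {m n : ℕ} (e : Fin m ≃ Fin n), Continuous (act e)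
  continuous_left : ∀ {n m : ℕ} (i : Fin n),
    Continuous fun p : KProd (O.obj n) (obj m) => left i p.1 p.2
  continuous_right : ∀ {n m : ℕ} (i : Fin n),
    Continuous fun p : KProd (obj n) (O.obj m) => right i p.1 p.2
  act_refl : ∀ {n : ℕ} (x : obj n), act (Equiv.refl (Fin n)) x = x
  act_trans : ∀ {l m n : ℕ} (e : Fin l ≃ Fin m) (f : Fin m ≃ Fin n) (x : obj n),
    act (e.trans f) x = act e (act f x)
  act_left_act : ∀ {n n' m m' : ℕ} (σ : Fin n' ≃ Fin n) (τ : Fin m' ≃ Fin m) (i : Fin n')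
    (a : O.obj n) (x : obj m),
    left i (O.act σ a) (act τ x) = act (blockEquiv σ τ i) (left (σ i) a x)
  act_right_act : ∀ {n n' m m' : ℕ} (σ : Fin n' ≃ Fin n) (τ : Fin m' ≃ Fin m) (i : Fin n')
    (x : obj n) (a : O.obj m),
    right i (act σ x) (O.act τ a) = act (blockEquiv σ τ i) (right (σ i) x a)
  one_left : ∀ {n : ℕ} (x : obj n) (h : 1 + n - 1 = n), left 0 O.one x = act (finCongr h) x
  right_one : ∀ {n : ℕ} (i : Fin n) (x : obj n) (h : n + 1 - 1 = n),
    right i x O.one = act (finCongr h) x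
  left_left : ∀ {n m l : ℕ} (i : Fin n) (j : Fin m) (a : O.obj n) (b : O.obj m) (x : obj l)
    (h : n + m - 1 + l - 1 = n + (m + l - 1) - 1),
    left (slot i (.inr j)) (O.comp i a b) x = act (finCongr h) (left i a (left j b x))
  left_right : ∀ {n m l : ℕ} (i : Fin n) (j : Fin m) (a : O.obj n) (x : obj m) (b : O.obj l)
    (h : n + m - 1 + l - 1 = n + (m + l - 1) - 1),
    right (slot i (.inr j)) (left i a x) b = act (finCongr h) (left i a (right j x b))
  right_right : ∀ {n m l : ℕ} (i : Fin n) (j : Fin m) (x : obj n) (a : O.obj m) (b : O.obj l)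
    (h : n + m - 1 + l - 1 = n + (m + l - 1) - 1),
    right (slot i (.inr j)) (right i x a) b = act (finCongr h) (right i x (O.comp j a b))
  left_right_comm : ∀ {n m l : ℕ} (i j : Fin n) (hij : i ≠ j) (a : O.obj n) (x : obj m)
    (b : O.obj l) (h : n + m - 1 + l - 1 = n + l - 1 + m - 1),
    right (slot i (.inl ⟨j, hij.symm⟩)) (left i a x) b =
      act (finCongr h) (left (slot j (.inl ⟨i, hij⟩)) (O.comp j a b) x)
  right_right_comm : ∀ {n m l : ℕ} (i j : Fin n) (hij : i ≠ j) (x : obj n) (a : O.obj m)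
    (b : O.obj l) (h : n + m - 1 + l - 1 = n + l - 1 + m - 1),
    right (slot i (.inl ⟨j, hij.symm⟩)) (right i x a) b =
      act (finCongr h) (right (slot j (.inl ⟨i, hij⟩)) (right j x b) a)

attribute [instance] Ibimodule.top Ibimodule.kspace

/-- A morphism of operads. -/
structure OperadHom (O : TopOperad.{u}) (O' : TopOperad.{v}) where
  toFun : ∀ {n : ℕ}, O.obj n → O'.obj n
  continuous_toFun : ∀ {n : ℕ}, Continuous (toFun (n := n))
  map_act : ∀ {m n : ℕ} (e : Fin m ≃ Fin n) (x : O.obj n), toFun (O.act e x) = O'.act e (toFun x)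
  map_one : toFun O.one = O'.one
  map_comp : ∀ {n m : ℕ} (i : Fin n) (x : O.obj n) (y : O.obj m),
    toFun (O.comp i x y) = O'.comp i (toFun x) (toFun y)

/-- A morphism of infinitesimal bimodules over a morphism of operads. (For the identity of `O`
these are the morphisms of infinitesimal bimodules over `O`.) -/
structure IbimoduleHom {O : TopOperad.{u}} {O' : TopOperad.{v}} (φ : OperadHom O O') (M : Ibimodule O)
    (M' : Ibimodule O') where
  toFun : ∀ {n : ℕ}, M.obj n → M'.obj n
  continuous_toFun : ∀ {n : ℕ}, Continuous (toFun (n := n))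
  map_act : ∀ {m n : ℕ} (e : Fin m ≃ Fin n) (x : M.obj n), toFun (M.act e x) = M'.act e (toFun x)
  map_left : ∀ {n m : ℕ} (i : Fin n) (a : O.obj n) (x : M.obj m),
    toFun (M.left i a x) = M'.left i (φ.toFun a) (toFun x)
  map_right : ∀ {n m : ℕ} (i : Fin n) (x : M.obj n) (a : O.obj m),
    toFun (M.right i x a) = M'.right i (toFun x) (φ.toFun a)

/-- The terminal operad: all spaces are points. -/
def pointOperad : TopOperad.{u} where
  obj _ := PUnit
  act _ _ := ⟨⟩
  one := ⟨⟩
  comp _ _ _ := ⟨⟩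
  continuous_act _ := continuous_const
  continuous_comp _ := continuous_const
  act_refl _ := rfl
  act_trans _ _ _ := rfl
  act_comp_act _ _ _ _ _ := rfl
  one_comp _ _ := rfl
  comp_one _ _ _ := rfl
  assoc _ _ _ _ _ _ := rfl
  comm _ _ _ _ _ _ _ := rfl

/-- The terminal infinitesimal bimodule over the terminal operad. -/
def pointIbimodule : Ibimodule pointOperad.{u} where
  obj _ := PUnit
  act _ _ := ⟨⟩
  left _ _ _ := ⟨⟩
  right _ _ _ := ⟨⟩
  continuous_act _ := continuous_const
  continuous_left _ := continuous_const
  continuous_right _ := continuous_const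
  act_refl _ := rfl
  act_trans _ _ _ := rfl
  act_left_act _ _ _ _ _ := rfl
  act_right_act _ _ _ _ _ := rfl
  one_left _ _ := rfl
  right_one _ _ _ := rfl
  left_left _ _ _ _ _ _ := rfl
  left_right _ _ _ _ _ _ := rfl
  right_right _ _ _ _ _ _ := rfl
  left_right_comm _ _ _ _ _ _ _ := rfl
  right_right_comm _ _ _ _ _ _ _ := rfl

/-- The unique morphism to the terminal operad. -/
def OperadHom.toPoint (O : TopOperad.{u}) : OperadHom O pointOperad.{v} where
  toFun _ := ⟨⟩
  continuous_toFun := continuous_const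
  map_act _ _ := rfl
  map_one := rfl
  map_comp _ _ _ := rfl

/-- The unique morphism to the terminal infinitesimal bimodule. -/
def IbimoduleHom.toPoint {O : TopOperad.{u}} (M : Ibimodule O) :
    IbimoduleHom (OperadHom.toPoint O) M pointIbimodule.{v} where
  toFun _ := ⟨⟩
  continuous_toFun := continuous_const
  map_act _ _ := rfl
  map_left _ _ _ := rfl
  map_right _ _ _ := rfl


/-! ### Trees with decorated vertices -/

/-- Planar rooted trees whose leaves are labelled by elements of `Fin k` and whose vertices of
arity `n` are decorated by elements of `A n`. The inputs of a vertex are ordered from left to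
right. -/
inductive Tr (A : ℕ → Type u) (k : ℕ) : Type u
  | leaf (i : Fin k) : Tr A k
  | node (n : ℕ) (a : A n) (ch : Fin n → Tr A k) : Tr A k

namespace Tr

/-- Change of decorations. -/
def map {A : ℕ → Type u} {B : ℕ → Type v} {k : ℕ} (f : ∀ n, A n → B n) : Tr A k → Tr B k
  | leaf i => leaf i
  | node n a ch => node n (f n a) fun i => (ch i).map f

/-- The space of decorations of an undecorated planar tree `T`: the product of the spaces
`A |v|` over all vertices `v` of `T`. -/
def Lab (A : ℕ → Type u) {k : ℕ} : Tr (fun _ => Unit) k → Type u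
  | leaf _ => PUnit
  | node n _ ch => A n × ∀ i : Fin n, Lab A (ch i)

instance Lab.instTop (A : ℕ → Type u) [∀ n, TopologicalSpace (A n)] {k : ℕ} :
    ∀ T : Tr (fun _ => Unit) k, TopologicalSpace (Lab A T)
  | leaf _ => inferInstanceAs (TopologicalSpace PUnit)
  | node n _ ch =>
    let _ : ∀ i, TopologicalSpace (Lab A (ch i)) := fun i => Lab.instTop A (ch i)
    inferInstanceAs (TopologicalSpace (A n × ∀ i : Fin n, Lab A (ch i)))

/-- The decorated tree with a given underlying tree and given decorations. -/
def assemble {A : ℕ → Type u} {k : ℕ} : ∀ T : Tr (fun _ => Unit) k, Lab A T → Tr A k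
  | leaf i, _ => leaf i
  | node n _ ch, l => node n l.1 fun i => assemble (ch i) (l.2 i)

/-- Decorated trees are topologized as the disjoint union, over the planar trees `T`, of the
products of the spaces `A |v|` over the vertices `v` of `T`. -/
instance instTop (A : ℕ → Type u) [∀ n, TopologicalSpace (A n)] (k : ℕ) :
    TopologicalSpace (Tr A k) :=
  TopologicalSpace.coinduced
    (fun p : Σ T : Tr (fun _ => Unit) k, Lab A T => assemble p.1 p.2) inferInstance

/-- Replaces the `i`-th entry of the list `f` by the list `g`. -/
def graft {X : Type*} {n m : ℕ} (i : Fin n) (f : Fin n → X) (g : Fin m → X)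
    (p : Fin (n + m - 1)) : X :=
  Sum.elim (fun j => f j.1) g ((slot i).symm p)

end Tr

variable {O : TopOperad.{u}} {M : Ibimodule O} {k : ℕ}

/-- Possible labels of a vertex of arity `n`: elements of `O(n)`, elements of `M(n)` (for
the pearl), and one further junk value (the result of composing two pearls) which never occurs
in a pearled tree. -/
abbrev Lbl (O : TopOperad.{u}) (M : Ibimodule O) (n : ℕ) : Type u :=
  O.obj n ⊕ (M.obj n ⊕ PUnit.{u + 1})

namespace Lbl

/-- Label of a vertex which is not the pearl. -/
abbrev op {n : ℕ} (a : O.obj n) : Lbl O M n := .inl a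

/-- Label of the pearl. -/
abbrev pearl {n : ℕ} (x : M.obj n) : Lbl O M n := .inr (.inl x)

/-- The junk label. -/
abbrev junk {n : ℕ} : Lbl O M n := .inr (.inr ⟨⟩)

/-- Relabelling of inputs. -/
def act {m n : ℕ} (e : Fin m ≃ Fin n) : Lbl O M n → Lbl O M m
  | .inl a => op (O.act e a)
  | .inr (.inl x) => pearl (M.act e x)
  | .inr (.inr _) => junk

/-- The composition of the labels of two adjacent vertices: operadic composition, or the
infinitesimal left or right action if one of the two is the pearl. -/
def comp {n m : ℕ} (i : Fin n) : Lbl O M n → Lbl O M m → Lbl O M (n + m - 1)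
  | .inl a, .inl b => op (O.comp i a b)
  | .inl a, .inr (.inl x) => pearl (M.left i a x)
  | .inr (.inl x), .inl b => pearl (M.right i x b)
  | _, _ => junk

/-- `1` for the pearl, `0` for other vertices. -/
def pearls {n : ℕ} : Lbl O M n → ℕ
  | .inr (.inl _) => 1
  | _ => 0

/-- The label is not junk, and if it is not a pearl, its arity is at least `r`. -/
def Good (r : ℕ) {n : ℕ} : Lbl O M n → Prop
  | .inl _ => r ≤ n
  | .inr (.inl _) => True
  | .inr (.inr _) => False

/-- The map of labels induced by morphisms. -/
def map {O' : TopOperad.{v}} {M' : Ibimodule O'} {φ : OperadHom O O'} (f : IbimoduleHom φ M M')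
    (n : ℕ) : Lbl O M n → Lbl O' M' n
  | .inl a => op (φ.toFun a)
  | .inr (.inl x) => pearl (f.toFun x)
  | .inr (.inr _) => junk

end Lbl

namespace Tr

/-- For `x = some i`, the number of leaves labelled by `i`; for `x = none`, the number of
pearls. -/
def count (x : Option (Fin k)) : Tr (Lbl O M) k → ℕ
  | leaf i => if x = some i then 1 else 0
  | node _ a ch => (if x = none then a.pearls else 0) + ∑ i, count x (ch i)

/-- The labels of the leaves above the root of `D`, together with the element `none` if the
pearl is the root of `D` or lies above it. -/
def supp (D : Tr (Lbl O M) k) : Finset (Option (Fin k)) := {x | D.count x ≠ 0}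

/-- All vertices other than pearls are labelled by `O` and are of arity at least `r`. -/
def Good (r : ℕ) : Tr (Lbl O M) k → Prop
  | leaf _ => True
  | node _ a ch => a.Good r ∧ ∀ i, Good r (ch i)

/-- Labelled pearled trees: there is exactly one pearl, the leaves are labelled bijectively by
`Fin k`, and the arities of the other vertices are at least `r`. -/
def Pearled (r : ℕ) (D : Tr (Lbl O M) k) : Prop :=
  D.Good r ∧ ∀ x, D.count x = 1

/-- The collection of the sets `supp v` for all vertices `v` of the tree. If the non-pearl
vertices have arity at least `2`, different vertices of a pearled tree have different sets. -/
def vertexSets : Tr (Lbl O M) k → Finset (Finset (Option (Fin k)))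
  | leaf _ => ∅
  | node n a ch => insert (supp (node n a ch)) (Finset.univ.biUnion fun i => vertexSets (ch i))

/-- Isomorphism of labelled non-planar trees: at each vertex the inputs may be permuted, with the
label of the vertex changing accordingly. -/
inductive Iso : Tr (Lbl O M) k → Tr (Lbl O M) k → Prop
  | leaf (i : Fin k) : Iso (leaf i) (leaf i)
  | node {m n : ℕ} (e : Fin m ≃ Fin n) (a : Lbl O M n) (ch : Fin m → Tr (Lbl O M) k)
      (chs : Fin n → Tr (Lbl O M) k) (h : ∀ i, Iso (ch i) (chs (e i))) :
      Iso (node m (a.act e) ch) (node n a chs)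

/-- `Step v D D'`: the tree `D'` is obtained from `D` by contracting the inner edge which connects
a vertex `w` with `supp w = v` to the vertex below it; their labels are composed. -/
inductive Step (v : Finset (Option (Fin k))) : Tr (Lbl O M) k → Tr (Lbl O M) k → Prop
  | root {n m : ℕ} (a : Lbl O M n) (ch : Fin n → Tr (Lbl O M) k) (i : Fin n) (b : Lbl O M m)
      (ch' : Fin m → Tr (Lbl O M) k) (h : ch i = node m b ch') (hv : supp (ch i) = v) :
      Step v (node n a ch) (node (n + m - 1) (a.comp i b) (graft i ch ch'))
  | above {n : ℕ} (a : Lbl O M n) (ch : Fin n → Tr (Lbl O M) k) (i : Fin n)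
      (c : Tr (Lbl O M) k) (h : Step v (ch i) c) :
      Step v (node n a ch) (node n a (Function.update ch i c))

end Tr

/-! ### Contracting inner edges is well defined on non-planar trees -/

@[simp] lemma slot_inl_val {n m : ℕ} (i : Fin n) (j : {j : Fin n // j ≠ i}) :
    (slot (m := m) i (.inl j)).1 = if j.1.1 < i.1 then j.1.1 else j.1.1 + m - 1 := rfl

@[simp] lemma slot_inr_val {n m : ℕ} (i : Fin n) (l : Fin m) :
    (slot (n := n) i (.inr l)).1 = i.1 + l.1 := rfl

namespace Lbl

lemma act_refl {n : ℕ} (a : Lbl O M n) : a.act (Equiv.refl (Fin n)) = a := by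
  rcases a with a | x | x <;> simp [act, O.act_refl, M.act_refl]

lemma act_trans {l m n : ℕ} (e : Fin l ≃ Fin m) (f : Fin m ≃ Fin n) (a : Lbl O M n) :
    a.act (e.trans f) = (a.act f).act e := by
  rcases a with a | x | x <;> simp [act, O.act_trans, M.act_trans]

lemma act_comp_act {n n' m m' : ℕ} (σ : Fin n' ≃ Fin n) (τ : Fin m' ≃ Fin m) (i : Fin n')
    (a : Lbl O M n) (b : Lbl O M m) :
    (a.act σ).comp i (b.act τ) = (a.comp (σ i) b).act (blockEquiv σ τ i) := by
  rcases a with a | x | x <;> rcases b with b | y | y <;>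
    simp [act, comp, O.act_comp_act, M.act_left_act, M.act_right_act]

lemma assoc {n m l : ℕ} (i : Fin n) (j : Fin m) (a : Lbl O M n) (b : Lbl O M m) (c : Lbl O M l)
    (h : n + m - 1 + l - 1 = n + (m + l - 1) - 1) :
    (a.comp i b).comp (slot i (.inr j)) c = (a.comp i (b.comp j c)).act (finCongr h) := by
  rcases a with a | x | x <;> rcases b with b | y | y <;> rcases c with c | z | z <;>
    simp [act, comp, O.assoc i j _ _ _ h, M.left_left i j _ _ _ h, M.left_right i j _ _ _ h,
      M.right_right i j _ _ _ h]

lemma comm {n m l : ℕ} (i j : Fin n) (hij : i ≠ j) (a : Lbl O M n) (b : Lbl O M m) (c : Lbl O M l)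
    (h : n + m - 1 + l - 1 = n + l - 1 + m - 1) :
    (a.comp i b).comp (slot i (.inl ⟨j, hij.symm⟩)) c =
      ((a.comp j c).comp (slot j (.inl ⟨i, hij⟩)) b).act (finCongr h) := by
  rcases a with a | x | x <;> rcases b with b | y | y <;> rcases c with c | z | z <;>
    simp [act, comp, O.comm i j hij _ _ _ h, M.left_right_comm i j hij _ _ _ h,
      M.right_right_comm i j hij _ _ _ h]
  rw [M.left_right_comm j i hij.symm _ _ _ h.symm, ← M.act_trans,
    show (finCongr h).trans (finCongr h.symm) = Equiv.refl _ from by ext; simp, M.act_refl]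

lemma pearls_act {m n : ℕ} (e : Fin m ≃ Fin n) (a : Lbl O M n) : (a.act e).pearls = a.pearls := by
  rcases a with a | x | x <;> rfl

lemma good_act {r m n : ℕ} (e : Fin m ≃ Fin n) (a : Lbl O M n) : (a.act e).Good r ↔ a.Good r := by
  have : m = n := by simpa using Fintype.card_congr e
  rcases a with a | x | x <;> simp [Good, act, this]

lemma pearls_comp {r n m : ℕ} (i : Fin n) (a : Lbl O M n) (b : Lbl O M m) (ha : a.Good r)
    (hb : b.Good r) (h : a.pearls + b.pearls ≤ 1) :
    (a.comp i b).pearls = a.pearls + b.pearls := by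
  rcases a with a | x | x <;> rcases b with b | y | y <;> simp_all [pearls, comp, Good]

lemma good_comp {n m : ℕ} (i : Fin n) (a : Lbl O M n) (b : Lbl O M m) (ha : a.Good 2)
    (hb : b.Good 2) (h : a.pearls + b.pearls ≤ 1) : (a.comp i b).Good 2 := by
  rcases a with a | x | x <;> rcases b with b | y | y <;> simp_all [pearls, comp, Good]
  omega

end Lbl

namespace Tr

section graft

variable {X Y : Type*} {n m : ℕ}

@[simp] lemma graft_inl (i : Fin n) (f : Fin n → X) (g : Fin m → X) (j : {j : Fin n // j ≠ i}) :
    graft i f g (slot i (.inl j)) = f j := by simp [graft]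

@[simp] lemma graft_inr (i : Fin n) (f : Fin n → X) (g : Fin m → X) (l : Fin m) :
    graft i f g (slot i (.inr l)) = g l := by simp [graft]

@[elab_as_elim]
lemma slot_cases (i : Fin n) {P : Fin (n + m - 1) → Prop} (h1 : ∀ j, P (slot i (.inl j)))
    (h2 : ∀ l, P (slot i (.inr l))) (p : Fin (n + m - 1)) : P p := by
  obtain ⟨q, rfl⟩ := (slot i).surjective p
  rcases q with j | l
  exacts [h1 j, h2 l]

lemma map_graft (F : X → Y) (i : Fin n) (f : Fin n → X) (g : Fin m → X) (p : Fin (n + m - 1)) :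
    F (graft i f g p) = graft i (fun j => F (f j)) (fun l => F (g l)) p := by
  refine slot_cases i (fun j => ?_) (fun l => ?_) p <;> simp

lemma sum_graft (i : Fin n) (f : Fin n → ℕ) (g : Fin m → ℕ) :
    f i + ∑ p, graft i f g p = ∑ j, f j + ∑ l, g l := by
  rw [← (slot i).sum_comp, Fintype.sum_sum_type]
  simp only [graft_inl, graft_inr]
  rw [Fintype.sum_eq_add_sum_subtype_ne f i]
  ring

end graft

lemma Iso.refl (D : Tr (Lbl O M) k) : Iso D D := by
  induction D with
  | leaf i => exact .leaf i
  | node n a ch ih =>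
    have := Iso.node (Equiv.refl _) a ch ch ih
    rwa [Lbl.act_refl] at this

lemma Iso.symm {D E : Tr (Lbl O M) k} (h : Iso D E) : Iso E D := by
  induction h with
  | leaf i => exact .leaf i
  | node e a ch ch' h ih =>
    have := Iso.node e.symm (a.act e) ch' ch (fun i => by simpa using ih (e.symm i))
    rwa [← Lbl.act_trans, Equiv.symm_trans_self, Lbl.act_refl] at this

lemma Iso.trans {D E F : Tr (Lbl O M) k} (h : Iso D E) (h' : Iso E F) : Iso D F := by
  induction h generalizing F with
  | leaf i => exact h'
  | node e a ch ch' h ih =>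
    cases h' with
    | node f b _ ch'' h2 =>
      rw [← Lbl.act_trans]
      exact .node _ _ _ _ fun i => ih i (h2 (e i))

lemma Iso.count_eq {D E : Tr (Lbl O M) k} (h : Iso D E) (x : Option (Fin k)) :
    D.count x = E.count x := by
  induction h with
  | leaf i => rfl
  | node e a ch ch' h ih =>
    simp only [count, Lbl.pearls_act, ih]
    rw [e.sum_comp fun i => count x (ch' i)]

lemma supp_congr {D E : Tr (Lbl O M) k} (h : ∀ x, D.count x = E.count x) : D.supp = E.supp := by
  simp [supp, h]

lemma Iso.supp_eq {D E : Tr (Lbl O M) k} (h : Iso D E) : D.supp = E.supp :=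
  supp_congr h.count_eq

lemma Iso.good {r : ℕ} {D E : Tr (Lbl O M) k} (h : Iso D E) (hE : E.Good r) : D.Good r := by
  induction h with
  | leaf i => trivial
  | node e a ch ch' h ih => exact ⟨(Lbl.good_act e a).2 hE.1, fun i => ih i (hE.2 _)⟩

lemma Iso.vertexSets_eq {D E : Tr (Lbl O M) k} (h : Iso D E) : D.vertexSets = E.vertexSets := by
  induction h with
  | leaf i => rfl
  | node e a ch ch' h ih =>
    simp only [vertexSets]
    rw [(Iso.node e a ch ch' h).supp_eq]
    congr 1
    ext s
    simp only [Finset.mem_biUnion, Finset.mem_univ, true_and, ih]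
    exact ⟨fun ⟨i, hi⟩ => ⟨e i, hi⟩, fun ⟨i, hi⟩ => ⟨e.symm i, by simpa using hi⟩⟩

/-- The condition satisfied by all the subtrees of a pearled tree. -/
def Ok (D : Tr (Lbl O M) k) : Prop := D.Good 2 ∧ ∀ x, D.count x ≤ 1

lemma Pearled.ok {D : Tr (Lbl O M) k} (h : D.Pearled 2) : D.Ok := ⟨h.1, fun x => (h.2 x).le⟩

lemma Ok.child {n : ℕ} {a : Lbl O M n} {ch : Fin n → Tr (Lbl O M) k} (h : (node n a ch).Ok)
    (i : Fin n) : (ch i).Ok := by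
  refine ⟨h.1.2 i, fun x => le_trans ?_ (h.2 x)⟩
  exact le_trans (Finset.single_le_sum (f := fun i => count x (ch i)) (fun _ _ => Nat.zero_le _)
    (Finset.mem_univ i)) (Nat.le_add_left _ _)

lemma Iso.ok {D E : Tr (Lbl O M) k} (h : Iso D E) (hE : E.Ok) : D.Ok :=
  ⟨h.good hE.1, fun x => (h.count_eq x).trans_le (hE.2 x)⟩

lemma mem_supp {D : Tr (Lbl O M) k} {x : Option (Fin k)} : x ∈ D.supp ↔ D.count x ≠ 0 := by
  simp [supp]

lemma supp_child_subset {n : ℕ} (a : Lbl O M n) (ch : Fin n → Tr (Lbl O M) k) (i : Fin n) :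
    (ch i).supp ⊆ (node n a ch).supp := by
  intro x hx
  rw [mem_supp] at hx ⊢
  have := Finset.single_le_sum (f := fun i => count x (ch i)) (fun _ _ => Nat.zero_le _)
    (Finset.mem_univ i)
  simp only [count] at *
  omega

lemma Ok.disjoint {n : ℕ} {a : Lbl O M n} {ch : Fin n → Tr (Lbl O M) k} (h : (node n a ch).Ok)
    {i j : Fin n} (hij : i ≠ j) : Disjoint (ch i).supp (ch j).supp := by
  rw [Finset.disjoint_left]
  intro x hi hj
  rw [mem_supp] at hi hj
  have h1 := h.2 x
  have := Finset.add_le_sum (f := fun i => count x (ch i)) (fun _ _ => Nat.zero_le _)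
    (Finset.mem_univ i) (Finset.mem_univ j) hij
  simp only [count] at *
  omega

lemma Ok.supp_nonempty {D : Tr (Lbl O M) k} (h : D.Ok) : D.supp.Nonempty := by
  induction D with
  | leaf i => exact ⟨some i, by simp [mem_supp, count]⟩
  | node n a ch ih =>
    rcases a with a | x | x
    · have hn : 2 ≤ n := h.1.1
      obtain ⟨y, hy⟩ := ih ⟨0, by omega⟩ (h.child _)
      exact ⟨y, supp_child_subset _ _ _ hy⟩
    · exact ⟨none, by simp [mem_supp, count, Lbl.pearls]⟩
    · exact h.1.1.elim

lemma Ok.supp_ssubset {n : ℕ} {a : Lbl O M n} {ch : Fin n → Tr (Lbl O M) k}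
    (h : (node n a ch).Ok) (i : Fin n) : (ch i).supp ⊂ (node n a ch).supp := by
  refine (Finset.ssubset_iff_of_subset (supp_child_subset a ch i)).2 ?_
  rcases a with a | x | x
  · have hn : 2 ≤ n := h.1.1
    obtain ⟨j, hj⟩ : ∃ j, j ≠ i := by
      have := Fin.nontrivial_iff_two_le.2 hn
      exact exists_ne i
    obtain ⟨y, hy⟩ := (h.child j).supp_nonempty
    exact ⟨y, supp_child_subset _ _ _ hy, Finset.disjoint_left.1 (h.disjoint hj) hy⟩
  · refine ⟨none, by simp [mem_supp, count, Lbl.pearls], fun hm => ?_⟩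
    have h1 := h.2 none
    have := Finset.single_le_sum (f := fun i => count none (ch i)) (fun _ _ => Nat.zero_le _)
      (Finset.mem_univ i)
    rw [mem_supp] at hm
    simp only [count, Lbl.pearls, if_true] at *
    omega
  · exact h.1.1.elim

lemma Ok.subset_of_mem {D : Tr (Lbl O M) k} (h : D.Ok) {v : Finset (Option (Fin k))}
    (hv : v ∈ D.vertexSets) : v ⊆ D.supp ∧ v.Nonempty := by
  induction D with
  | leaf i => simp [vertexSets] at hv
  | node n a ch ih =>
    simp only [vertexSets, Finset.mem_insert, Finset.mem_biUnion, Finset.mem_univ, true_and] at hv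
    rcases hv with rfl | ⟨i, hi⟩
    · exact ⟨subset_rfl, h.supp_nonempty⟩
    · exact ⟨(ih i (h.child i) hi).1.trans (supp_child_subset _ _ _), (ih i (h.child i) hi).2⟩

lemma Ok.notMem_of_ne {n : ℕ} {a : Lbl O M n} {ch : Fin n → Tr (Lbl O M) k}
    (h : (node n a ch).Ok) {i j : Fin n} (hij : i ≠ j) {v : Finset (Option (Fin k))}
    (hv : v ⊆ (ch i).supp) : v ∉ (ch j).vertexSets := fun hj => by
  obtain ⟨h1, y, hy⟩ := (h.child j).subset_of_mem hj
  exact Finset.disjoint_left.1 (h.disjoint hij) (hv hy) (h1 hy)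

lemma Ok.notMem_child {n : ℕ} {a : Lbl O M n} {ch : Fin n → Tr (Lbl O M) k}
    (h : (node n a ch).Ok) (i : Fin n) : (node n a ch).supp ∉ (ch i).vertexSets := fun hj =>
  (h.supp_ssubset i).2 ((h.child i).subset_of_mem hj).1

section graft

variable {n m : ℕ} {a : Lbl O M n} {ch : Fin n → Tr (Lbl O M) k} {i : Fin n} {b : Lbl O M m}
  {ch' : Fin m → Tr (Lbl O M) k}

lemma Ok.pearls_le (h : (node n a ch).Ok) (hi : ch i = node m b ch') :
    a.pearls + b.pearls ≤ 1 := by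
  have h1 := h.2 none
  have := Finset.single_le_sum (f := fun i => count none (ch i)) (fun _ _ => Nat.zero_le _)
      (Finset.mem_univ i)
  simp only [count, if_true, hi] at *
  omega

lemma Ok.count_graft (h : (node n a ch).Ok) (hi : ch i = node m b ch') (x : Option (Fin k)) :
    (node (n + m - 1) (a.comp i b) (graft i ch ch')).count x = (node n a ch).count x := by
  have hb := (h.child i).1
  rw [hi] at hb
  have h1 := sum_graft i (fun j => count x (ch j)) (fun l => count x (ch' l))
  simp only [count, map_graft (count x), Lbl.pearls_comp i a b h.1.1 hb.1 (h.pearls_le hi)]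
  simp only [hi, count] at h1
  split_ifs at h1 ⊢ <;> omega

lemma Ok.ok_graft (h : (node n a ch).Ok) (hi : ch i = node m b ch') :
    (node (n + m - 1) (a.comp i b) (graft i ch ch')).Ok := by
  have hb := (h.child i).1
  rw [hi] at hb
  refine ⟨⟨Lbl.good_comp i a b h.1.1 hb.1 (h.pearls_le hi), fun p => ?_⟩, fun x => ?_⟩
  · refine slot_cases i (fun j => ?_) (fun l => ?_) p
    · simpa using h.1.2 _
    · simpa using hb.2 _
  · rw [h.count_graft hi]; exact h.2 x

lemma Ok.vertexSets_graft (h : (node n a ch).Ok) (hi : ch i = node m b ch') :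
    (node (n + m - 1) (a.comp i b) (graft i ch ch')).vertexSets =
      (node n a ch).vertexSets.erase (ch i).supp := by
  have hc := h.child i
  rw [hi] at hc
  have hne : (node n a ch).supp ≠ (ch i).supp := fun e => (h.supp_ssubset i).2 e.subset
  simp only [vertexSets]
  rw [supp_congr (h.count_graft hi), Finset.erase_insert_of_ne hne]
  congr 1
  ext s
  simp only [Finset.mem_biUnion, Finset.mem_univ, true_and, Finset.mem_erase]
  constructor
  · rintro ⟨p, hp⟩
    revert hp
    refine slot_cases i (fun j => ?_) (fun l => ?_) p
    · rw [graft_inl]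
      exact fun hp => ⟨fun e => h.notMem_of_ne j.2.symm subset_rfl (e ▸ hp), j, hp⟩
    · rw [graft_inr]
      refine fun hp => ⟨fun e => hc.notMem_child l ?_, i, ?_⟩
      · rw [← hi, ← e]; exact hp
      · rw [hi]
        exact Finset.mem_insert_of_mem (Finset.mem_biUnion.2 ⟨l, Finset.mem_univ _, hp⟩)
  · rintro ⟨hs, j, hj⟩
    by_cases hji : j = i
    · subst hji
      rw [hi] at hj hs
      simp only [vertexSets, Finset.mem_insert, hs, Finset.mem_biUnion, Finset.mem_univ, true_and,
        false_or] at hj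
      obtain ⟨l, hl⟩ := hj
      exact ⟨slot j (.inr l), by simpa using hl⟩
    · exact ⟨slot i (.inl ⟨j, hji⟩), by simpa using hj⟩

end graft

lemma Step.spec {v : Finset (Option (Fin k))} {D D' : Tr (Lbl O M) k} (hs : Step v D D')
    (h : D.Ok) : D'.Ok ∧ (∀ x, D'.count x = D.count x) ∧ v ∈ D.vertexSets ∧ v ⊂ D.supp ∧
      D'.vertexSets = D.vertexSets.erase v := by
  induction hs with
  | root a ch i b ch' hi hv =>
    subst hv
    refine ⟨h.ok_graft hi, h.count_graft hi, ?_, h.supp_ssubset i, h.vertexSets_graft hi⟩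
    refine Finset.mem_insert_of_mem (Finset.mem_biUnion.2 ⟨i, Finset.mem_univ _, ?_⟩)
    rw [hi]
    exact Finset.mem_insert_self _ _
  | @above n a ch i c hc ih =>
    obtain ⟨h1, h2, h3, h4, h5⟩ := ih (h.child i)
    have hcount : ∀ x, (node n a (Function.update ch i c)).count x = (node n a ch).count x := by
      intro x
      simp only [count]
      congr 1
      refine Finset.sum_congr rfl fun j _ => ?_
      by_cases hj : j = i
      · subst hj; simpa using h2 x
      · simp [hj]
    have hss : v ⊂ (node n a ch).supp := h4.trans_subset (supp_child_subset _ _ _)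
    refine ⟨⟨⟨h.1.1, fun j => ?_⟩, fun x => (hcount x).trans_le (h.2 x)⟩, hcount,
      Finset.mem_insert_of_mem (Finset.mem_biUnion.2 ⟨i, Finset.mem_univ _, h3⟩), hss, ?_⟩
    · by_cases hj : j = i
      · subst hj; simpa using h1.1
      · simpa [hj] using h.1.2 j
    · simp only [vertexSets]
      rw [supp_congr hcount, Finset.erase_insert_of_ne (fun e => hss.2 e.subset)]
      congr 1
      ext s
      simp only [Finset.mem_biUnion, Finset.mem_univ, true_and, Finset.mem_erase]
      constructor
      · rintro ⟨j, hj⟩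
        by_cases hji : j = i
        · subst hji
          rw [Function.update_self, h5, Finset.mem_erase] at hj
          exact ⟨hj.1, j, hj.2⟩
        · rw [Function.update_of_ne hji] at hj
          exact ⟨fun e => h.notMem_of_ne (Ne.symm hji) h4.1 (e ▸ hj), j, hj⟩
      · rintro ⟨hs, j, hj⟩
        refine ⟨j, ?_⟩
        by_cases hji : j = i
        · subst hji
          rw [Function.update_self, h5, Finset.mem_erase]
          exact ⟨hs, hj⟩
        · rwa [Function.update_of_ne hji]

/-- The vertex to be contracted is unique. -/
lemma Step.unique {v : Finset (Option (Fin k))} {D D₁ D₂ : Tr (Lbl O M) k} (h₁ : Step v D D₁)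
    (h₂ : Step v D D₂) (h : D.Ok) : D₁ = D₂ := by
  induction h₁ generalizing D₂ with
  | root a ch i b ch' hi hv =>
    cases h₂ with
    | root _ _ j b' ch'' hj hv' =>
      by_cases hij : i = j
      · subst hij
        rw [hi] at hj
        cases hj
        rfl
      · have := h.disjoint hij
        rw [hv, hv', disjoint_self] at this
        exact absurd (this ▸ hv ▸ (h.child i).supp_nonempty) (by simp)
    | above _ _ j c hc =>
      exfalso
      obtain ⟨-, -, h3, h4, -⟩ := hc.spec (h.child j)
      by_cases hij : i = j
      · subst hij; rw [hv] at h4; exact h4.2 subset_rfl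
      · exact h.notMem_of_ne hij hv.ge h3
  | above a ch i c hc ih =>
    obtain ⟨-, -, h3, h4, -⟩ := hc.spec (h.child i)
    cases h₂ with
    | root _ _ j b' ch'' hj hv' =>
      exfalso
      by_cases hij : i = j
      · subst hij; rw [hv'] at h4; exact h4.2 subset_rfl
      · exact h.notMem_of_ne (Ne.symm hij) hv'.ge h3
    | above _ _ j c' hc' =>
      by_cases hij : i = j
      · subst hij; rw [ih hc' (h.child i)]
      · exact absurd (hc'.spec (h.child j)).2.2.1 (h.notMem_of_ne hij h4.1)

lemma iso_node_congr {n : ℕ} (a : Lbl O M n) {ch ch' : Fin n → Tr (Lbl O M) k}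
    (h : ∀ i, Iso (ch i) (ch' i)) : Iso (node n a ch) (node n a ch') := by
  have := Iso.node (Equiv.refl _) a ch ch' h
  rwa [Lbl.act_refl] at this

lemma iso_update {n : ℕ} (a : Lbl O M n) (ch : Fin n → Tr (Lbl O M) k) (i : Fin n)
    {c c' : Tr (Lbl O M) k} (h : Iso c c') :
    Iso (node n a (Function.update ch i c)) (node n a (Function.update ch i c')) := by
  refine iso_node_congr a fun j => ?_
  by_cases hj : j = i
  · subst hj; simpa using h
  · simpa [hj] using Iso.refl _

lemma blockEquiv_inl {n n' m m' : ℕ} (σ : Fin n' ≃ Fin n) (τ : Fin m' ≃ Fin m) (i : Fin n')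
    (j : {j : Fin n' // j ≠ i}) :
    blockEquiv σ τ i (slot i (.inl j)) = slot (σ i) (.inl ⟨σ j, by simpa using j.2⟩) := by
  simp [blockEquiv]

lemma blockEquiv_inr {n n' m m' : ℕ} (σ : Fin n' ≃ Fin n) (τ : Fin m' ≃ Fin m) (i : Fin n')
    (l : Fin m') : blockEquiv σ τ i (slot i (.inr l)) = slot (σ i) (.inr (τ l)) := by
  simp [blockEquiv]

lemma Step.iso {v : Finset (Option (Fin k))} {D D' E : Tr (Lbl O M) k} (hs : Step v D D')
    (h : Iso D E) : ∃ E', Step v E E' ∧ Iso D' E' := by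
  induction hs generalizing E with
  | root a ch i b ch₁ hi hv =>
    cases h with
    | node e a _ ch' h =>
      have hii := h i
      have hsupp := hii.supp_eq
      rw [hi] at hii
      generalize hE : ch' (e i) = c at hii
      cases hii with
      | node τ b _ ch₂ h2 =>
        refine ⟨_, .root a ch' (e i) b ch₂ hE (hsupp ▸ hv), ?_⟩
        rw [Lbl.act_comp_act]
        refine .node _ _ _ _ fun p => ?_
        refine slot_cases i (fun j => ?_) (fun l => ?_) p
        · rw [blockEquiv_inl, graft_inl, graft_inl]; exact h _
        · rw [blockEquiv_inr, graft_inr, graft_inr]; exact h2 _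
  | above a ch i c hc ih =>
    cases h with
    | node e a _ ch' h =>
      obtain ⟨c', hc', hi⟩ := ih (h i)
      refine ⟨_, .above a ch' (e i) c' hc', .node _ _ _ _ fun j => ?_⟩
      by_cases hj : j = i
      · subst hj; simpa using hi
      · have : e j ≠ e i := fun h => hj (e.injective h)
        simpa [hj, this] using h j

lemma graft_update_inl {X : Type*} {n m : ℕ} (i : Fin n) (ch : Fin n → X) (ch' : Fin m → X)
    (j : {j : Fin n // j ≠ i}) (c : X) :
    Function.update (graft i ch ch') (slot i (.inl j)) c =
      graft i (Function.update ch j c) ch' := by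
  funext p
  refine slot_cases i (fun j' => ?_) (fun l => ?_) p
  · by_cases h : j' = j
    · subst h; simp
    · have h' : (j' : Fin n) ≠ j := fun e => h (Subtype.ext e)
      simp [h, h', Function.update_of_ne]
  · simp [Function.update_of_ne]

lemma graft_update_inr {X : Type*} {n m : ℕ} (i : Fin n) (ch : Fin n → X) (ch' : Fin m → X)
    (j : Fin m) (c d : X) :
    Function.update (graft i ch ch') (slot i (.inr j)) c =
      graft i (Function.update ch i d) (Function.update ch' j c) := by
  funext p
  refine slot_cases i (fun j' => ?_) (fun l => ?_) p
  · simp [j'.2, Function.update_of_ne]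
  · by_cases h : l = j
    · subst h; simp
    · simp [h, Function.update_of_ne]

lemma graft_graft_inr {X : Type*} {n m l : ℕ} (i : Fin n) (j : Fin m) (ch : Fin n → X)
    (ch' : Fin m → X) (ch'' : Fin l → X) (d : X)
    (h : n + m - 1 + l - 1 = n + (m + l - 1) - 1) (p : Fin (n + m - 1 + l - 1)) :
    graft (slot i (.inr j)) (graft i ch ch') ch'' p =
      graft i (Function.update ch i d) (graft j ch' ch'') (finCongr h p) := by
  have hi := i.2
  have hj := j.2
  refine slot_cases (slot i (.inr j)) (fun q => ?_) (fun q => ?_) p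
  · obtain ⟨q, hq⟩ := q
    rw [graft_inl]
    revert hq
    refine slot_cases i (fun r => ?_) (fun r => ?_) q
    · intro hq
      have e : finCongr h (slot (m := l) (slot i (.inr j)) (.inl ⟨slot i (.inl r), hq⟩)) =
          slot i (.inl r) := by
        apply Fin.ext
        have hr : r.1.1 ≠ i.1 := fun e => r.2 (Fin.ext e)
        simp only [finCongr_apply, Fin.val_cast, slot_inl_val, slot_inr_val]
        split_ifs <;> omega
      rw [e, graft_inl, graft_inl, Function.update_of_ne r.2]
    · intro hq
      have hr : r ≠ j := fun e => hq (by rw [e])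
      have e : finCongr h (slot (m := l) (slot i (.inr j)) (.inl ⟨slot i (.inr r), hq⟩)) =
          slot i (.inr (slot j (.inl ⟨r, hr⟩))) := by
        apply Fin.ext
        have hr : r.1 ≠ j.1 := fun e => hr (Fin.ext e)
        simp only [finCongr_apply, Fin.val_cast, slot_inl_val, slot_inr_val, add_lt_add_iff_left]
        by_cases h1 : r.1 < j.1
        · simp only [h1, if_true]
        · simp only [h1, if_false]; omega
      rw [e, graft_inr, graft_inr, graft_inl]
  · have e : finCongr h (slot (slot i (.inr j)) (.inr q)) = slot i (.inr (slot j (.inr q))) := by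
      apply Fin.ext
      simp only [finCongr_apply, Fin.val_cast, slot_inr_val]
      omega
    rw [e, graft_inr, graft_inr, graft_inr]

lemma graft_graft_inl {X : Type*} {n m l : ℕ} (i j : Fin n) (hij : i ≠ j) (ch : Fin n → X)
    (ch' : Fin m → X) (ch'' : Fin l → X)
    (h : n + m - 1 + l - 1 = n + l - 1 + m - 1) (p : Fin (n + m - 1 + l - 1)) :
    graft (slot i (.inl ⟨j, hij.symm⟩)) (graft i ch ch') ch'' p =
      graft (slot j (.inl ⟨i, hij⟩)) (graft j ch ch'') ch' (finCongr h p) := by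
  have hi := i.2
  have hj := j.2
  have hne : i.1 ≠ j.1 := fun e => hij (Fin.ext e)
  refine slot_cases (slot i (.inl ⟨j, hij.symm⟩)) (fun q => ?_) (fun q => ?_) p
  · obtain ⟨q, hq⟩ := q
    rw [graft_inl]
    revert hq
    refine slot_cases i (fun r => ?_) (fun r => ?_) q
    · intro hq
      have hrj : r.1 ≠ j := fun e => hq (by congr; exact Subtype.ext e)
      have e : finCongr h (slot (m := l) (slot i (.inl ⟨j, hij.symm⟩)) (.inl ⟨slot i (.inl r), hq⟩)) =
          slot (slot j (.inl ⟨i, hij⟩)) (.inl ⟨slot j (.inl ⟨r.1, hrj⟩), fun e => r.2 (by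
            simpa using e)⟩) := by
        apply Fin.ext
        have hr : r.1.1 ≠ i.1 := fun e => r.2 (Fin.ext e)
        have hr' : r.1.1 ≠ j.1 := fun e => hrj (Fin.ext e)
        simp only [finCongr_apply, Fin.val_cast, slot_inl_val]
        split_ifs <;> omega
      rw [e, graft_inl, graft_inl, graft_inl]
    · intro hq
      have e : finCongr h (slot (m := l) (slot i (.inl ⟨j, hij.symm⟩)) (.inl ⟨slot i (.inr r), hq⟩)) =
          slot (slot j (.inl ⟨i, hij⟩)) (.inr r) := by
        apply Fin.ext
        have := r.2
        simp only [finCongr_apply, Fin.val_cast, slot_inl_val, slot_inr_val]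
        split_ifs <;> omega
      rw [e, graft_inr, graft_inr]
  · have e : finCongr h (slot (slot i (.inl ⟨j, hij.symm⟩)) (.inr q)) =
        slot (slot j (.inl ⟨i, hij⟩)) (.inl ⟨slot j (.inr q), by
          intro e; simpa using (slot j).injective e⟩) := by
      apply Fin.ext
      have := q.2
      simp only [finCongr_apply, Fin.val_cast, slot_inl_val, slot_inr_val]
      split_ifs <;> omega
    rw [e, graft_inr, graft_inl, graft_inr]

/-- Contractions of different edges commute. -/
lemma Step.diamond {v w : Finset (Option (Fin k))} (hvw : v ≠ w) {D D₁ D₂ : Tr (Lbl O M) k}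
    (h₁ : Step v D D₁) (h₂ : Step w D D₂) (h : D.Ok) :
    ∃ E₁ E₂, Step w D₁ E₁ ∧ Step v D₂ E₂ ∧ Iso E₁ E₂ := by
  -- the case where one of the two edges is adjacent to the root and the other one is not
  have key : ∀ {v w : Finset (Option (Fin k))} {n m : ℕ} (a : Lbl O M n)
      (ch : Fin n → Tr (Lbl O M) k) (i : Fin n) (b : Lbl O M m) (ch' : Fin m → Tr (Lbl O M) k)
      (_ : ch i = node m b ch') (_ : supp (ch i) = v) (j : Fin n) (c : Tr (Lbl O M) k)
      (_ : Step w (ch j) c) (_ : (node n a ch).Ok),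
      ∃ E₁ E₂, Step w (node (n + m - 1) (a.comp i b) (graft i ch ch')) E₁ ∧
        Step v (node n a (Function.update ch j c)) E₂ ∧ Iso E₁ E₂ := by
    intro v w n m a ch i b ch' hi hv j c hc h
    by_cases hij : j = i
    · subst hij
      obtain ⟨-, h2, -, -, -⟩ := hc.spec (h.child j)
      have hsupp := (supp_congr h2).trans hv
      rw [hi] at hc
      cases hc with
      | @root m l _ _ j' b' ch'' hj' hw =>
        refine ⟨_, _, .root _ _ (slot j (.inr j')) b' ch'' (by rw [graft_inr, hj'])
          (by rw [graft_inr, hw]), .root a _ j _ _ (Function.update_self _ _ _)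
            (by rw [Function.update_self, hsupp]), ?_⟩
        have e : n + m - 1 + l - 1 = n + (m + l - 1) - 1 := by
          have := j.2; have := j'.2; omega
        rw [Lbl.assoc j j' a b b' e]
        refine .node _ _ _ _ fun p => ?_
        rw [← graft_graft_inr]
        exact Iso.refl _
      | above _ _ j' c' hc' =>
        refine ⟨_, _, .above _ _ (slot j (.inr j')) c' (by rwa [graft_inr]),
          .root a _ j _ _ (Function.update_self _ _ _) (by rw [Function.update_self, hsupp]), ?_⟩
        rw [graft_update_inr]
        exact Iso.refl _
    · refine ⟨_, _, .above _ _ (slot i (.inl ⟨j, hij⟩)) c (by rwa [graft_inl]),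
        .root a _ i b ch' (by rw [Function.update_of_ne (Ne.symm hij), hi])
          (by rw [Function.update_of_ne (Ne.symm hij), hv]), ?_⟩
      rw [graft_update_inl]
      exact Iso.refl _
  induction h₁ generalizing D₂ with
  | @root n m a ch i b ch' hi hv =>
    cases h₂ with
    | @root _ l _ _ j b' ch'' hj hw =>
      have hij : i ≠ j := fun e => hvw (by rw [← hv, ← hw, e])
      refine ⟨_, _, .root _ _ (slot i (.inl ⟨j, hij.symm⟩)) b' ch'' (by rw [graft_inl, hj])
        (by rw [graft_inl, hw]), .root _ _ (slot j (.inl ⟨i, hij⟩)) b ch' (by rw [graft_inl, hi])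
        (by rw [graft_inl, hv]), ?_⟩
      have e : n + m - 1 + l - 1 = n + l - 1 + m - 1 := by
        have := i.2; have := j.2
        have : i.1 ≠ j.1 := fun e => hij (Fin.ext e)
        omega
      rw [Lbl.comm i j hij a b b' e]
      refine .node _ _ _ _ fun p => ?_
      rw [← graft_graft_inl]
      exact Iso.refl _
    | above _ _ j c hc => exact key a ch i b ch' hi hv j c hc h
  | above a ch i c hc ih =>
    cases h₂ with
    | root _ _ j b' ch'' hj hw =>
      obtain ⟨E₁, E₂, h1, h2, h3⟩ := key a ch j b' ch'' hj hw i c hc h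
      exact ⟨E₂, E₁, h2, h1, h3.symm⟩
    | above _ _ j c' hc' =>
      by_cases hij : i = j
      · subst hij
        obtain ⟨E₁, E₂, h1, h2, h3⟩ := ih hc' (h.child i)
        refine ⟨_, _, .above _ _ i E₁ (by rwa [Function.update_self]),
          .above _ _ i E₂ (by rwa [Function.update_self]), ?_⟩
        rw [Function.update_idem, Function.update_idem]
        exact iso_update a ch i h3
      · refine ⟨_, _, .above _ _ j c' (by rwa [Function.update_of_ne (Ne.symm hij)]),
          .above _ _ i c (by rwa [Function.update_of_ne hij]), ?_⟩
        rw [Function.update_comm hij]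
        exact Iso.refl _

lemma Ok.exists_step {D : Tr (Lbl O M) k} (h : D.Ok) {v : Finset (Option (Fin k))}
    (hv : v ∈ D.vertexSets) (hv' : v ≠ D.supp) : ∃ D', Step v D D' := by
  induction D with
  | leaf i => simp [vertexSets] at hv
  | node n a ch ih =>
    simp only [vertexSets, Finset.mem_insert, hv', Finset.mem_biUnion, Finset.mem_univ, true_and,
      false_or] at hv
    obtain ⟨i, hi⟩ := hv
    by_cases hvi : v = (ch i).supp
    · match hc : ch i with
      | leaf j => simp [hc, vertexSets] at hi
      | node m b ch' => exact ⟨_, .root a ch i b ch' hc hvi.symm⟩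
    · obtain ⟨c, hc⟩ := ih i (h.child i) hi hvi
      exact ⟨_, .above a ch i c hc⟩

end Tr

/-! ### The spaces of labelled non-planar pearled trees -/

lemma continuous_to_compactlyGenerated {K : Type u} [TopologicalSpace K] [CompactSpace K]
    [T2Space K] {X : Type v} [TopologicalSpace X] {f : K → X} (hf : Continuous f) :
    @Continuous K X _ (TopologicalSpace.compactlyGenerated.{u} X) f := by
  let i : (S : CompHaus.{u}) × C(S, X) := ⟨CompHaus.of K, ⟨f, hf⟩⟩
  let j : K → Σ i : (S : CompHaus.{u}) × C(S, X), i.1 := fun x => ⟨i, x⟩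
  have hj : Continuous j :=
    continuous_sigmaMk (σ := fun i : (S : CompHaus.{u}) × C(S, X) => i.1) (i := i)
  let F : (Σ i : (S : CompHaus.{u}) × C(S, X), i.1) → X := fun p => p.1.2 p.2
  have hF : @Continuous _ X _ (TopologicalSpace.compactlyGenerated.{u} X) F :=
    continuous_coinduced_rng
  exact @Continuous.comp K _ X _ _ (TopologicalSpace.compactlyGenerated.{u} X) j F hF hj

lemma continuous_kprod_mk {K : Type u} [TopologicalSpace K] [CompactSpace K] [T2Space K]
    {X : Type v} {Y : Type u} [TopologicalSpace X] [TopologicalSpace Y] {f : K → X} {g : K → Y}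
    (hf : Continuous f) (hg : Continuous g) :
    @Continuous K (KProd X Y) _ _ fun x => (f x, g x) :=
  @continuous_to_compactlyGenerated K _ _ _ (X × Y) _ (fun x => (f x, g x)) (hf.prodMk hg)

/-- Planar labelled pearled trees whose leaves are labelled bijectively by `Fin k`, whose pearl is
labelled by a point of `M` and whose other vertices, of arity at least `r`, are labelled by
points of `O`. The topology is that of the disjoint union over all planar trees of the products
`M(|p|) × ∏ O(|v|)` (in the category of `k`-spaces). -/
structure PlanarTree (O : TopOperad.{u}) (M : Ibimodule O) (k r : ℕ) : Type u where
  tr : Tr (Lbl O M) k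
  pearled : tr.Pearled r

instance PlanarTree.instTop (O : TopOperad.{u}) (M : Ibimodule O) (k r : ℕ) :
    TopologicalSpace (PlanarTree O M k r) :=
  @TopologicalSpace.compactlyGenerated.{u} (PlanarTree O M k r)
    (TopologicalSpace.induced PlanarTree.tr inferInstance)

instance LTree.instSetoid (O : TopOperad.{u}) (M : Ibimodule O) (k : ℕ) :
    Setoid (PlanarTree O M k 2) where
  r D E := D.1.Iso E.1
  iseqv := ⟨fun D => .refl D.1, fun h => h.symm, fun h1 h2 => h1.trans h2⟩

/-- Non-planar labelled pearled trees, whose non-pearl vertices have arity at least `2`: the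
quotient of the space of planar ones by isomorphism. -/
def LTree (O : TopOperad.{u}) (M : Ibimodule O) (k : ℕ) : Type u :=
  Quotient (LTree.instSetoid O M k)

instance LTree.instTop (O : TopOperad.{u}) (M : Ibimodule O) (k : ℕ) :
    TopologicalSpace (LTree O M k) :=
  inferInstanceAs (TopologicalSpace (Quotient (LTree.instSetoid O M k)))

namespace LTree

/-- The labelled non-planar tree represented by a labelled planar tree. -/
def mk (D : PlanarTree O M k 2) : LTree O M k := Quotient.mk _ D

lemma continuous_mk : Continuous (mk : PlanarTree O M k 2 → LTree O M k) :=
  continuous_quotient_mk'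

lemma mk_eq_iff {D E : PlanarTree O M k 2} : mk D = mk E ↔ D.1.Iso E.1 := Quotient.eq

lemma ind {P : LTree O M k → Prop} (h : ∀ D, P (mk D)) (z : LTree O M k) : P z := Quotient.ind h z

/-- The collection of the sets `supp v` for all the vertices `v` of the tree. -/
def vertexSets (z : LTree O M k) : Finset (Finset (Option (Fin k))) :=
  Quotient.lift (fun D : PlanarTree O M k 2 => D.1.vertexSets)
    (fun _ _ h => Tr.Iso.vertexSets_eq h) z

@[simp] lemma vertexSets_mk (D : PlanarTree O M k 2) : (mk D).vertexSets = D.1.vertexSets := rfl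

open Classical in
/-- The contraction of the inner edge connecting the vertex `w` with `supp w = v` to the vertex
below it; if `z` has no such edge, then `z` is not changed. -/
noncomputable def contract (v : Finset (Option (Fin k))) (z : LTree O M k) : LTree O M k :=
  if h : ∃ D D' : PlanarTree O M k 2, mk D = z ∧ Tr.Step v D.1 D'.1 then
    mk h.choose_spec.choose
  else z

lemma _root_.BoardmanVogt.Tr.Step.pearled {v : Finset (Option (Fin k))} {D D' : Tr (Lbl O M) k}
    (h : Tr.Step v D D') (hD : D.Pearled 2) : D'.Pearled 2 :=
  ⟨(h.spec hD.ok).1.1, fun x => ((h.spec hD.ok).2.1 x).trans (hD.2 x)⟩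

lemma _root_.BoardmanVogt.Tr.Pearled.supp {r : ℕ} {D : Tr (Lbl O M) k} (hD : D.Pearled r) :
    D.supp = Finset.univ := by
  ext x; simp [Tr.mem_supp, hD.2 x]

lemma contract_mk {v : Finset (Option (Fin k))} {D D' : PlanarTree O M k 2}
    (h : Tr.Step v D.1 D'.1) : contract v (mk D) = mk D' := by
  have hex : ∃ E E' : PlanarTree O M k 2, mk E = mk D ∧ Tr.Step v E.1 E'.1 := ⟨D, D', rfl, h⟩
  rw [contract, dif_pos hex]
  obtain ⟨h1, h2⟩ := hex.choose_spec.choose_spec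
  obtain ⟨F, hF, hi⟩ := h2.iso (mk_eq_iff.1 h1)
  rw [mk_eq_iff, ← hF.unique h D.2.ok]
  exact hi

lemma contract_of_not {v : Finset (Option (Fin k))} {z : LTree O M k}
    (h : ¬ (v ∈ z.vertexSets ∧ v ≠ Finset.univ)) : contract v z = z := by
  rw [contract, dif_neg]
  rintro ⟨D, D', rfl, hs⟩
  obtain ⟨-, -, h3, h4, -⟩ := hs.spec D.2.ok
  rw [D.2.supp] at h4
  exact h ⟨h3, h4.ne⟩

lemma exists_step {v : Finset (Option (Fin k))} {D : PlanarTree O M k 2}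
    (h : v ∈ (mk D).vertexSets ∧ v ≠ Finset.univ) :
    ∃ D' : PlanarTree O M k 2, Tr.Step v D.1 D'.1 := by
  obtain ⟨D', hD'⟩ := D.2.ok.exists_step h.1 (by rw [D.2.supp]; exact h.2)
  exact ⟨⟨D', hD'.pearled D.2⟩, hD'⟩

lemma vertexSets_contract {v : Finset (Option (Fin k))} (hv : v ≠ Finset.univ)
    (z : LTree O M k) : (contract v z).vertexSets = z.vertexSets.erase v := by
  by_cases h : v ∈ z.vertexSets ∧ v ≠ Finset.univ
  · induction z using ind with
    | h D =>
      obtain ⟨D', hD'⟩ := exists_step h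
      rw [contract_mk hD']
      exact (hD'.spec D.2.ok).2.2.2.2
  · rw [contract_of_not h, Finset.erase_eq_of_notMem (fun h' => h ⟨h', hv⟩)]

lemma contract_comm (v w : Finset (Option (Fin k))) (z : LTree O M k) :
    contract v (contract w z) = contract w (contract v z) := by
  by_cases hvw : v = w
  · rw [hvw]
  by_cases hv : v ∈ z.vertexSets ∧ v ≠ Finset.univ
  · by_cases hw : w ∈ z.vertexSets ∧ w ≠ Finset.univ
    · induction z using ind with
      | h D =>
        obtain ⟨D₁, h₁⟩ := exists_step hv
        obtain ⟨D₂, h₂⟩ := exists_step hw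
        obtain ⟨E₁, E₂, h1, h2, h3⟩ := h₁.diamond hvw h₂ D.2.ok
        rw [contract_mk h₁, contract_mk h₂, contract_mk (D' := ⟨E₁, h1.pearled D₁.2⟩) h1,
          contract_mk (D' := ⟨E₂, h2.pearled D₂.2⟩) h2, mk_eq_iff]
        exact h3.symm
    · rw [contract_of_not hw, contract_of_not (v := w)]
      rw [vertexSets_contract hv.2]
      exact fun h => hw ⟨Finset.mem_of_mem_erase h.1, h.2⟩
  · rw [contract_of_not hv, contract_of_not (v := v)]
    by_cases hw : w = Finset.univ
    · rw [contract_of_not (v := w) (fun h => h.2 hw)]; exact hv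
    · rw [vertexSets_contract hw]
      exact fun h => hv ⟨Finset.mem_of_mem_erase h.1, h.2⟩

instance : LeftCommutative (contract : Finset (Option (Fin k)) → LTree O M k → LTree O M k) :=
  ⟨contract_comm⟩

/-- The contraction of several inner edges. -/
noncomputable def contractAll (F : Finset (Finset (Option (Fin k)))) (z : LTree O M k) :
    LTree O M k :=
  F.val.foldr contract z

lemma vertexSets_subset_of_contract (v : Finset (Option (Fin k))) (z : LTree O M k) :
    contract v z = z ∨
      v ∈ z.vertexSets ∧ (contract v z).vertexSets = z.vertexSets.erase v := by
  by_cases h : v ∈ z.vertexSets ∧ v ≠ Finset.univ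
  · exact .inr ⟨h.1, vertexSets_contract h.2 z⟩
  · exact .inl (contract_of_not h)

/-! Continuous families of trees of a fixed shape. -/

section continuity

/-- Continuous families of labels. -/
def LblFam {K : Type u} [TopologicalSpace K] {n : ℕ} (a : K → Lbl O M n) : Prop :=
  (∃ a' : K → O.obj n, Continuous a' ∧ a = fun x => .op (a' x)) ∨
    ∃ a' : K → M.obj n, Continuous a' ∧ a = fun x => .pearl (a' x)

/-- Continuous families of labelled planar trees. -/
inductive Fam {K : Type u} [TopologicalSpace K] : (K → Tr (Lbl O M) k) → Prop
  | leaf (i : Fin k) : Fam fun _ => .leaf i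
  | node {n : ℕ} (a : K → Lbl O M n) (ha : LblFam a) (ch : Fin n → K → Tr (Lbl O M) k)
      (h : ∀ i, Fam (ch i)) : Fam fun x => .node n (a x) fun i => ch i x

variable {K L : Type u} [TopologicalSpace K] [TopologicalSpace L]

lemma LblFam.continuous {n : ℕ} {a : K → Lbl O M n} (h : LblFam a) : Continuous a := by
  rcases h with ⟨a, ha, rfl⟩ | ⟨a, ha, rfl⟩
  · exact continuous_inl.comp ha
  · exact continuous_inr.comp (continuous_inl.comp ha)

lemma LblFam.comp_right {n : ℕ} {a : K → Lbl O M n} (h : LblFam a) {φ : L → K}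
    (hφ : Continuous φ) : LblFam fun x => a (φ x) := by
  rcases h with ⟨a, ha, rfl⟩ | ⟨a, ha, rfl⟩
  · exact .inl ⟨_, ha.comp hφ, rfl⟩
  · exact .inr ⟨_, ha.comp hφ, rfl⟩

lemma LblFam.pearls_eq {n : ℕ} {a : K → Lbl O M n} (h : LblFam a) (x y : K) :
    (a x).pearls = (a y).pearls := by
  rcases h with ⟨a, ha, rfl⟩ | ⟨a, ha, rfl⟩ <;> rfl

lemma LblFam.comp [CompactSpace K] [T2Space K] {n m : ℕ} (i : Fin n) {a : K → Lbl O M n}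
    {b : K → Lbl O M m} (ha : LblFam a) (hb : LblFam b) (x₀ : K)
    (h : (a x₀).pearls + (b x₀).pearls ≤ 1) : LblFam fun x => (a x).comp i (b x) := by
  rcases ha with ⟨a, ha, rfl⟩ | ⟨a, ha, rfl⟩ <;> rcases hb with ⟨b, hb, rfl⟩ | ⟨b, hb, rfl⟩
  · exact .inl ⟨_, (O.continuous_comp i).comp (continuous_kprod_mk ha hb), rfl⟩
  · exact .inr ⟨_, (M.continuous_left i).comp (continuous_kprod_mk ha hb), rfl⟩
  · exact .inr ⟨_, (M.continuous_right i).comp (continuous_kprod_mk ha hb), rfl⟩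
  · simp [Lbl.pearls] at h

lemma Fam.comp_right {f : K → Tr (Lbl O M) k} (h : Fam f) {φ : L → K} (hφ : Continuous φ) :
    Fam fun x => f (φ x) := by
  induction h with
  | leaf i => exact .leaf i
  | node a ha ch h ih => exact .node _ (ha.comp_right hφ) _ ih

lemma Fam.count_eq {f : K → Tr (Lbl O M) k} (h : Fam f) (s : Option (Fin k)) (x y : K) :
    (f x).count s = (f y).count s := by
  induction h with
  | leaf i => rfl
  | node a ha ch h ih => simp only [Tr.count, ih, ha.pearls_eq x y]

lemma Fam.vertexSets_eq {f : K → Tr (Lbl O M) k} (h : Fam f) (x y : K) :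
    (f x).vertexSets = (f y).vertexSets := by
  induction h with
  | leaf i => rfl
  | node a ha ch h ih =>
    simp only [Tr.vertexSets, ih]
    rw [Tr.supp_congr fun s => (Fam.node a ha ch h).count_eq s x y]

lemma Fam.exists_assemble {f : K → Tr (Lbl O M) k} (h : Fam f) :
    ∃ (T : Tr (fun _ => Unit) k) (g : K → Tr.Lab (Lbl O M) T), Continuous g ∧
      ∀ x, f x = Tr.assemble T (g x) := by
  induction h with
  | leaf i => exact ⟨.leaf i, fun _ => (⟨⟩ : PUnit), continuous_const, fun _ => rfl⟩
  | node a ha ch h ih =>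
    choose T g hg h using ih
    refine ⟨.node _ () T, fun x => (a x, fun i => g i x),
      ha.continuous.prodMk (continuous_pi hg), fun x => ?_⟩
    simp only [Tr.assemble, h]

lemma Fam.continuous {f : K → Tr (Lbl O M) k} (h : Fam f) : Continuous f := by
  obtain ⟨T, g, hg, h⟩ := h.exists_assemble
  rw [funext h]
  exact (continuous_coinduced_rng (f := fun p : Σ T : Tr (fun _ => Unit) k, Tr.Lab (Lbl O M) T =>
    Tr.assemble p.1 p.2)).comp (continuous_sigmaMk.comp hg)

/-- The underlying undecorated tree and the decorations of a decorated tree. -/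
def _root_.BoardmanVogt.Tr.disassemble {A : ℕ → Type u} {k : ℕ} :
    Tr A k → Σ T : Tr (fun _ => Unit) k, Tr.Lab A T
  | .leaf i => ⟨.leaf i, (⟨⟩ : PUnit)⟩
  | .node n a ch => ⟨.node n () fun i => (ch i).disassemble.1,
      (a, fun i => (ch i).disassemble.2)⟩

lemma _root_.BoardmanVogt.Tr.disassemble_assemble {A : ℕ → Type u} {k : ℕ}
    (T : Tr (fun _ => Unit) k) (l : Tr.Lab A T) : (Tr.assemble T l).disassemble = ⟨T, l⟩ := by
  induction T with
  | leaf i => rfl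
  | node n a ch ih =>
    have : (fun i => (Tr.assemble (ch i) (l.2 i)).disassemble) = fun i => ⟨ch i, l.2 i⟩ :=
      funext fun i => ih i _
    exact congrArg (fun F : Fin n → Σ T : Tr (fun _ => Unit) k, Tr.Lab A T =>
      (⟨.node n () fun i => (F i).1, (l.1, fun i => (F i).2)⟩ :
        Σ T : Tr (fun _ => Unit) k, Tr.Lab A T)) this

lemma _root_.BoardmanVogt.Tr.assemble_disassemble {A : ℕ → Type u} {k : ℕ} (D : Tr A k) :
    Tr.assemble D.disassemble.1 D.disassemble.2 = D := by
  induction D with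
  | leaf i => rfl
  | node n a ch ih => simp only [Tr.disassemble, Tr.assemble, ih]

lemma _root_.BoardmanVogt.Tr.continuous_disassemble {A : ℕ → Type u}
    [∀ n, TopologicalSpace (A n)] {k : ℕ} :
    Continuous (Tr.disassemble : Tr A k → Σ T : Tr (fun _ => Unit) k, Tr.Lab A T) := by
  refine continuous_coinduced_dom.2 ?_
  rw [show (Tr.disassemble ∘ fun p : Σ T : Tr (fun _ => Unit) k, Tr.Lab A T =>
    Tr.assemble p.1 p.2) = id from funext fun p => Tr.disassemble_assemble p.1 p.2]
  exact continuous_id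

lemma LblFam.of_continuous {n r : ℕ} {a : K → Lbl O M n} (ha : Continuous a)
    (hr : ∀ x, (a x).Good r) (x₀ : K) :
    ∃ V : Set K, IsClopen V ∧ x₀ ∈ V ∧ LblFam fun x : V => a x := by
  have hc1 : IsClopen (Set.range (Sum.inl : O.obj n → Lbl O M n)) :=
    ⟨isClosed_range_inl, isOpen_range_inl⟩
  have hc2 : IsClopen (Set.range (Sum.inr : _ → Lbl O M n)) :=
    ⟨isClosed_range_inr, isOpen_range_inr⟩
  rcases h : a x₀ with y | y
  · refine ⟨_, hc1.preimage ha, ⟨y, h.symm⟩, .inl ?_⟩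
    choose a' ha' using fun x : a ⁻¹' Set.range Sum.inl => x.2
    refine ⟨a', ?_, funext fun x => (ha' x).symm⟩
    refine (Topology.IsEmbedding.inl (Y := M.obj n ⊕ PUnit.{u + 1})).continuous_iff.2 ?_
    exact (ha.comp continuous_subtype_val).congr fun x => (ha' x).symm
  · refine ⟨_, hc2.preimage ha, ⟨y, h.symm⟩, .inr ?_⟩
    have : ∀ x : a ⁻¹' Set.range Sum.inr,
        ∃ z : M.obj n, (.inr (.inl z) : Lbl O M n) = a x := by
      rintro ⟨x, y, hy⟩
      rcases y with y | y
      · exact ⟨y, hy⟩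
      · have := hr x
        rw [← hy] at this
        exact this.elim
    choose a' ha' using this
    refine ⟨a', ?_, funext fun x => (ha' x).symm⟩
    refine (Topology.IsEmbedding.inl (Y := PUnit.{u + 1})).continuous_iff.2
      ((Topology.IsEmbedding.inr (X := O.obj n)).continuous_iff.2 ?_)
    exact (ha.comp continuous_subtype_val).congr fun x => (ha' x).symm

lemma Fam.of_continuous_lab (T : Tr (fun _ => Unit) k) (g : K → Tr.Lab (Lbl O M) T)
    (hg : Continuous g) {r : ℕ} (hr : ∀ x, (Tr.assemble T (g x)).Good r) (x₀ : K) :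
    ∃ U : Set K, IsClopen U ∧ x₀ ∈ U ∧ Fam fun x : U => Tr.assemble T (g x) := by
  induction T with
  | leaf i => exact ⟨Set.univ, isClopen_univ, trivial, .leaf i⟩
  | node n a ch ih =>
    have h1 : Continuous fun x => (show Lbl O M n × (∀ i, Tr.Lab (Lbl O M) (ch i)) from g x).1 :=
      continuous_fst.comp hg
    have h2 : ∀ i, Continuous fun x =>
        (show Lbl O M n × (∀ i, Tr.Lab (Lbl O M) (ch i)) from g x).2 i := fun i =>
      (continuous_apply i).comp (continuous_snd.comp hg)
    choose U hU hx hF using fun i => ih i _ (h2 i) fun x => (hr x).2 i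
    obtain ⟨V, hV, hxV, hFV⟩ := LblFam.of_continuous h1 (fun x => (hr x).1) x₀
    refine ⟨V ∩ ⋂ i, U i, hV.inter (isClopen_iInter_of_finite hU),
      ⟨hxV, Set.mem_iInter.2 hx⟩, ?_⟩
    exact .node _ (hFV.comp_right (φ := Set.inclusion Set.inter_subset_left)
      (continuous_inclusion _)) _ fun i => (hF i).comp_right
        (φ := Set.inclusion (Set.inter_subset_right.trans (Set.iInter_subset _ i)))
        (continuous_inclusion _)

lemma Fam.of_continuous {f : K → Tr (Lbl O M) k} (hf : Continuous f) {r : ℕ}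
    (hr : ∀ x, (f x).Good r) (x₀ : K) :
    ∃ U : Set K, IsClopen U ∧ x₀ ∈ U ∧ Fam fun x : U => f x := by
  have h := Tr.continuous_disassemble.comp hf
  set T := (f x₀).disassemble.1 with hT
  have hc : IsClopen (Set.range (Sigma.mk T : Tr.Lab (Lbl O M) T → _)) := isClopen_range_sigmaMk
  have hc' := hc.preimage h
  choose g hg using fun x : (Tr.disassemble ∘ f) ⁻¹' Set.range (Sigma.mk T) => x.2
  have hgf : ∀ x, Tr.assemble T (g x) = f x := fun x => by
    have := Tr.assemble_disassemble (f x)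
    rw [← show _ = (f x).disassemble from hg x] at this
    exact this
  have hgc : Continuous g := by
    refine (Topology.IsEmbedding.sigmaMk (σ := Tr.Lab (Lbl O M) (k := k))
      (i := T)).continuous_iff.2 ?_
    exact (h.comp continuous_subtype_val).congr fun x => (hg x).symm
  obtain ⟨U, hU, hx, hF⟩ := Fam.of_continuous_lab T g hgc (r := r)
    (fun x => by rw [hgf]; exact hr x) ⟨x₀, ⟨(f x₀).disassemble.2, rfl⟩⟩
  refine ⟨Subtype.val '' U, ?_, ⟨_, hx, rfl⟩, ?_⟩
  · exact ⟨hc'.1.isClosedEmbedding_subtypeVal.isClosedMap _ hU.1,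
      hc'.2.isOpenEmbedding_subtypeVal.isOpenMap _ hU.2⟩
  · have hφ : ∀ x : (Subtype.val '' U : Set K), ∃ y : U, y.1.1 = x.1 := by
      rintro ⟨_, y, hy, rfl⟩; exact ⟨⟨y, hy⟩, rfl⟩
    choose φ hφ' using hφ
    have hφc : Continuous φ := by
      refine continuous_induced_rng.2 (continuous_induced_rng.2 ?_)
      exact continuous_subtype_val.congr fun x => (hφ' x).symm
    have := hF.comp_right hφc
    simp only [hgf, hφ'] at this
    exact this

lemma Fam.exists_step [CompactSpace K] [T2Space K] {f : K → Tr (Lbl O M) k} (h : Fam f)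
    (hok : ∀ x, (f x).Ok) (x₀ : K) {v : Finset (Option (Fin k))}
    (hv : v ∈ (f x₀).vertexSets) (hv' : v ≠ (f x₀).supp) :
    ∃ f' : K → Tr (Lbl O M) k, Fam f' ∧ ∀ x, Tr.Step v (f x) (f' x) := by
  induction h with
  | leaf i => simp [Tr.vertexSets] at hv
  | node a ha ch h ih =>
    simp only [Tr.vertexSets, Finset.mem_insert, hv', Finset.mem_biUnion, Finset.mem_univ,
      true_and, false_or] at hv
    obtain ⟨i, hi⟩ := hv
    by_cases hvi : v = (ch i x₀).supp
    · have hci := h i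
      generalize hc : ch i = c at hci
      cases hci with
      | leaf j => rw [hc] at hi; simp [Tr.vertexSets] at hi
      | node b hb ch' h' =>
        have hci : ∀ x, ch i x = .node _ (b x) fun l => ch' l x := fun x => by rw [hc]
        refine ⟨fun x => .node _ ((a x).comp i (b x)) fun p => Tr.graft i ch ch' p x,
          .node _ (ha.comp i hb x₀ ((hok x₀).pearls_le (hci x₀))) _ fun p =>
            Tr.slot_cases i (fun j => by rw [Tr.graft_inl]; exact h j)
              (fun l => by rw [Tr.graft_inr]; exact h' l) p, fun x => ?_⟩
        have hs := Tr.Step.root (v := v) (a x) (fun j => ch j x) i (b x) (fun l => ch' l x)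
          (hci x) (by rw [hvi]; exact Tr.supp_congr fun s => (h i).count_eq s x x₀)
        convert hs using 2
        funext p
        exact Tr.map_graft (fun F : K → Tr (Lbl O M) k => F x) i ch ch' p
    · obtain ⟨f', hf', hs⟩ := ih i (fun x => (hok x).child i) hi hvi
      refine ⟨fun x => .node _ (a x) fun j => Function.update ch i f' j x,
        .node _ ha _ fun j => ?_, fun x => ?_⟩
      · by_cases hj : j = i
        · subst hj; simpa using hf'
        · simpa [hj] using h j
      · have hs := Tr.Step.above (v := v) (a x) (fun j => ch j x) i (f' x) (hs x)
        convert hs using 2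
        funext j
        by_cases hj : j = i
        · subst hj; simp
        · simp [hj]

/-- A map on the space of labelled planar trees is continuous if it is so on continuous
families. -/
lemma continuous_of_fam {Y : Type*} [TopologicalSpace Y] {r : ℕ} {F : PlanarTree O M k r → Y}
    (h : ∀ (K : Type u) [TopologicalSpace K] [CompactSpace K] [T2Space K]
      (f : K → PlanarTree O M k r), Fam (fun x => (f x).1) → ∀ _ : K, Continuous (F ∘ f)) :
    Continuous F := by
  let _ : TopologicalSpace (PlanarTree O M k r) :=
    TopologicalSpace.induced PlanarTree.tr inferInstance
  refine continuous_from_compactlyGenerated _ fun S g => ?_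
  rw [continuous_iff_continuousAt]
  intro x₀
  obtain ⟨U, hU, hx, hF⟩ := Fam.of_continuous (continuous_induced_dom.comp g.2)
    (fun x => (g x).2.1) x₀
  have : CompactSpace U := isCompact_iff_compactSpace.1 hU.1.isCompact
  have h1 : Continuous fun x : U => F (g x) := h U (fun x => g x) hF ⟨x₀, hx⟩
  have h2 : ContinuousOn (F ∘ g) U := continuousOn_iff_continuous_domRestrict.2 h1
  exact h2.continuousAt (hU.2.mem_nhds hx)

lemma Fam.continuous_planarTree [CompactSpace K] [T2Space K] {r : ℕ}
    {f : K → PlanarTree O M k r} (h : Fam fun x => (f x).1) : Continuous f :=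
  @continuous_to_compactlyGenerated K _ _ _ (PlanarTree O M k r)
    (TopologicalSpace.induced PlanarTree.tr inferInstance) f
    (continuous_induced_rng.2 h.continuous)

end continuity

lemma continuous_contract (v : Finset (Option (Fin k))) :
    Continuous (contract v : LTree O M k → LTree O M k) := by
  refine continuous_quot_lift (r := (LTree.instSetoid O M k).r) (f := fun D => contract v (mk D))
    (fun D E h => congrArg (contract v) (mk_eq_iff.2 h)) ?_ |>.congr fun z => ?_
  · refine continuous_of_fam fun K _ _ _ f hf x₀ => ?_
    by_cases hv : v ∈ (mk (f x₀)).vertexSets ∧ v ≠ Finset.univ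
    · obtain ⟨f', hf', hs⟩ := hf.exists_step (fun x => (f x).2.ok) x₀ hv.1
        (by rw [(f x₀).2.supp]; exact hv.2)
      have : ∀ x, contract v (mk (f x)) = mk ⟨f' x, (hs x).pearled (f x).2⟩ := fun x =>
        contract_mk (hs x)
      have hc : Continuous fun x => (⟨f' x, (hs x).pearled (f x).2⟩ : PlanarTree O M k 2) :=
        Fam.continuous_planarTree hf'
      exact (continuous_mk.comp hc).congr fun x => (this x).symm
    · refine (continuous_mk.comp hf.continuous_planarTree).congr fun x => ?_
      refine (contract_of_not ?_).symm
      change ¬ (v ∈ (f x).1.vertexSets ∧ v ≠ Finset.univ)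
      rw [hf.vertexSets_eq x x₀]
      exact hv
  · induction z using ind with
    | h D => rfl

lemma continuous_contractAll (F : Finset (Finset (Option (Fin k)))) :
    Continuous (contractAll F : LTree O M k → LTree O M k) := by
  unfold contractAll
  induction F.val using Multiset.induction with
  | empty => simp only [Multiset.foldr_zero]; exact continuous_id
  | cons v s ih => simp only [Multiset.foldr_cons]; exact (continuous_contract v).comp ih

end LTree

/-! ### Functoriality of the spaces of labelled trees -/

section maps

variable {O' : TopOperad.{v}} {M' : Ibimodule O'} {φ : OperadHom O O'}
  (f : IbimoduleHom φ M M')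

namespace Lbl

@[simp] lemma pearls_map {n : ℕ} (a : Lbl O M n) : (a.map f n).pearls = a.pearls := by
  rcases a with a | a | a <;> rfl

@[simp] lemma good_map {r n : ℕ} (a : Lbl O M n) : (a.map f n).Good r ↔ a.Good r := by
  rcases a with a | a | a <;> rfl

lemma map_act {m n : ℕ} (e : Fin m ≃ Fin n) (a : Lbl O M n) :
    (a.act e).map f m = (a.map f n).act e := by
  rcases a with a | a | a
  · exact congrArg op (φ.map_act e a)
  · exact congrArg pearl (f.map_act e a)
  · rfl

lemma map_comp {n m : ℕ} (i : Fin n) (a : Lbl O M n) (b : Lbl O M m) :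
    (a.comp i b).map f (n + m - 1) = (a.map f n).comp i (b.map f m) := by
  rcases a with a | a | a <;> rcases b with b | b | b
  · exact congrArg op (φ.map_comp i a b)
  · exact congrArg pearl (f.map_left i a b)
  · rfl
  · exact congrArg pearl (f.map_right i a b)
  all_goals rfl

end Lbl

namespace Tr

@[simp] lemma count_map (D : Tr (Lbl O M) k) (x : Option (Fin k)) :
    (D.map (Lbl.map f)).count x = D.count x := by
  induction D with
  | leaf i => rfl
  | node n a ch ih => simp only [map, count, Lbl.pearls_map, ih]

@[simp] lemma supp_map (D : Tr (Lbl O M) k) : (D.map (Lbl.map f)).supp = D.supp := by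
  ext x; simp only [mem_supp, count_map]

@[simp] lemma good_map {r : ℕ} (D : Tr (Lbl O M) k) :
    (D.map (Lbl.map f)).Good r ↔ D.Good r := by
  induction D with
  | leaf i => rfl
  | node n a ch ih => simp only [map, Good, Lbl.good_map, ih]

@[simp] lemma pearled_map {r : ℕ} (D : Tr (Lbl O M) k) :
    (D.map (Lbl.map f)).Pearled r ↔ D.Pearled r := by
  simp only [Pearled, good_map, count_map]

@[simp] lemma vertexSets_map (D : Tr (Lbl O M) k) :
    (D.map (Lbl.map f)).vertexSets = D.vertexSets := by
  induction D with
  | leaf i => rfl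
  | node n a ch ih =>
    have := supp_map f (node n a ch)
    simp only [map] at this
    simp only [map, vertexSets, ih, this]

lemma Iso.map {D E : Tr (Lbl O M) k} (h : Iso D E) :
    Iso (D.map (Lbl.map f)) (E.map (Lbl.map f)) := by
  induction h with
  | leaf i => exact .leaf i
  | node e a ch ch' h ih =>
    simp only [Tr.map, Lbl.map_act]
    exact .node e _ _ _ ih

lemma Step.map {w : Finset (Option (Fin k))} {D E : Tr (Lbl O M) k} (h : Step w D E) :
    Step w (D.map (Lbl.map f)) (E.map (Lbl.map f)) := by
  induction h with
  | root a ch i b ch' h hv =>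
    have := Step.root (v := w) (a.map f _) (fun j => (ch j).map (Lbl.map f)) i (b.map f _)
      (fun j => (ch' j).map (Lbl.map f)) (by rw [h]; rfl) (by rw [supp_map, hv])
    simp only [Tr.map, Lbl.map_comp]
    convert this using 2
    funext p
    exact (map_graft (Tr.map (Lbl.map f)) i ch ch' p)
  | above a ch i c h ih =>
    have := Step.above (v := w) (a.map f _) (fun j => (ch j).map (Lbl.map f)) i _ ih
    simp only [Tr.map]
    convert this using 2
    funext j
    by_cases hj : j = i
    · subst hj; simp
    · simp [hj]

lemma map_map {A : ℕ → Type*} {B : ℕ → Type*} {C : ℕ → Type*} (g : ∀ n, A n → B n)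
    (h : ∀ n, B n → C n) (D : Tr A k) : (D.map g).map h = D.map fun n a => h n (g n a) := by
  induction D with
  | leaf i => rfl
  | node n a ch ih => simp only [map, ih]

end Tr

/-- The map of spaces of labelled planar trees induced by morphisms. -/
def PlanarTree.map {r : ℕ} (D : PlanarTree O M k r) : PlanarTree O' M' k r :=
  ⟨D.tr.map (Lbl.map f), (Tr.pearled_map f _).2 D.pearled⟩

namespace LTree

/-- The map of spaces of labelled trees induced by morphisms. -/
def map (z : LTree O M k) : LTree O' M' k :=
  Quotient.lift (fun D : PlanarTree O M k 2 => mk (D.map f))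
    (fun _ _ h => mk_eq_iff.2 (Tr.Iso.map f h)) z

@[simp] lemma map_mk (D : PlanarTree O M k 2) : map f (mk D) = mk (D.map f) := rfl

@[simp] lemma vertexSets_map (z : LTree O M k) : (z.map f).vertexSets = z.vertexSets := by
  induction z using ind with
  | h D => exact Tr.vertexSets_map f D.tr

lemma map_contract (w : Finset (Option (Fin k))) (z : LTree O M k) :
    (contract w z).map f = contract w (z.map f) := by
  by_cases h : w ∈ z.vertexSets ∧ w ≠ Finset.univ
  · induction z using ind with
    | h D =>
      obtain ⟨D', hD'⟩ := exists_step h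
      rw [contract_mk hD', map_mk, map_mk]
      exact (contract_mk (Tr.Step.map f hD')).symm
  · rw [contract_of_not h, contract_of_not (by rwa [vertexSets_map])]

lemma map_contractAll (F : Finset (Finset (Option (Fin k)))) (z : LTree O M k) :
    (contractAll F z).map f = contractAll F (z.map f) := by
  unfold contractAll
  induction F.val using Multiset.induction with
  | empty => simp
  | cons w s ih => simp [map_contract, ih]

lemma contractAll_empty (z : LTree O M k) : contractAll ∅ z = z := rfl

lemma contractAll_disjUnion (F G : Finset (Finset (Option (Fin k)))) (h : Disjoint F G)
    (z : LTree O M k) :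
    contractAll (F.disjUnion G h) z = contractAll F (contractAll G z) := by
  simp only [contractAll, Finset.disjUnion_val, Multiset.foldr_add]

lemma contractAll_insert (w : Finset (Option (Fin k))) (F : Finset (Finset (Option (Fin k))))
    (h : w ∉ F) (z : LTree O M k) :
    contractAll (insert w F) z = contract w (contractAll F z) := by
  simp only [contractAll, Finset.insert_val, Multiset.ndinsert_of_notMem h, Multiset.foldr_cons]

end LTree

end maps

section maps

variable {O' : TopOperad.{u}} {M' : Ibimodule O'} {φ : OperadHom O O'}
  (f : IbimoduleHom φ M M')

namespace LTree

lemma LblFam.map {K : Type u} [TopologicalSpace K] {n : ℕ} {a : K → Lbl O M n} (h : LblFam a) :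
    LblFam fun x => (a x).map f n := by
  rcases h with ⟨a, ha, rfl⟩ | ⟨a, ha, rfl⟩
  · exact .inl ⟨_, φ.continuous_toFun.comp ha, rfl⟩
  · exact .inr ⟨_, f.continuous_toFun.comp ha, rfl⟩

lemma Fam.map {K : Type u} [TopologicalSpace K] {g : K → Tr (Lbl O M) k} (h : Fam g) :
    Fam fun x => (g x).map (Lbl.map f) := by
  induction h with
  | leaf i => exact .leaf i
  | node a ha ch h ih => exact .node _ (LblFam.map f ha) _ ih

lemma continuous_map : Continuous (map f : LTree O M k → LTree O' M' k) := by
  refine continuous_quot_lift _ (continuous_mk.comp ?_)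
  refine continuous_of_fam fun K _ _ _ g hg _ => ?_
  exact Fam.continuous_planarTree (Fam.map f hg)

end LTree

end maps

/-! ### The poset of pearled trees -/

/-- The set of non-planar pearled trees with leaves labelled bijectively by `Fin k` (`k` inputs),
whose non-pearl vertices have arity at least `2`: these are trees without labels of the vertices,
i.e. with all labels in the one-point spaces. -/
abbrev Psi (k : ℕ) : Type :=
  LTree pointOperad.{0} pointIbimodule.{0} k

namespace Psi

/-- `s ≤ t` if the tree `t` is obtained from the tree `s` by contracting inner edges. -/
def le (s t : Psi k) : Prop :=
  Relation.ReflTransGen (fun s t => ∃ v, t = LTree.contract v s) s t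

lemma le_vertexSets {s t : Psi k} (h : Psi.le s t) :
    t.vertexSets ⊆ s.vertexSets ∧ t = LTree.contractAll (s.vertexSets \ t.vertexSets) s := by
  induction h with
  | refl => exact ⟨subset_rfl, by rw [Finset.sdiff_self]; rfl⟩
  | tail h h' ih =>
    obtain ⟨v, rfl⟩ := h'
    rename_i t
    rcases LTree.vertexSets_subset_of_contract v t with h1 | ⟨h1, h2⟩
    · rw [h1]; exact ih
    · rw [h2]
      refine ⟨(Finset.erase_subset _ _).trans ih.1, ?_⟩
      have e : s.vertexSets \ t.vertexSets.erase v = insert v (s.vertexSets \ t.vertexSets) := by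
        ext w
        by_cases hw : w = v
        · subst hw; simp [ih.1 h1]
        · simp [hw]
      rw [e, LTree.contractAll_insert _ _ (by simp [h1]), ← ih.2]

instance : PartialOrder (Psi k) where
  le := Psi.le
  le_refl _ := .refl
  le_trans _ _ _ h h' := h.trans h'
  le_antisymm s t h h' := by
    rw [(le_vertexSets h).2, (le_vertexSets h').1.antisymm (le_vertexSets h).1,
      Finset.sdiff_self]
    rfl

end Psi

namespace LTree

/-- The underlying unlabelled tree of a labelled tree. -/
def tree (z : LTree O M k) : Psi k := map (IbimoduleHom.toPoint.{u, 0} M) z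

lemma vertexSets_tree (z : LTree O M k) : vertexSets z.tree = z.vertexSets := vertexSets_map _ z

lemma tree_contractAll (F : Finset (Finset (Option (Fin k)))) (z : LTree O M k) :
    (contractAll F z).tree = contractAll F z.tree := map_contractAll _ F z

lemma tree_map {O' : TopOperad.{v}} {M' : Ibimodule O'} {φ : OperadHom O O'}
    (f : IbimoduleHom φ M M') (z : LTree O M k) : (z.map f).tree = z.tree := by
  induction z using ind with
  | h D =>
    refine congrArg mk ?_
    simp only [PlanarTree.map, Tr.map_map]
    congr 2
    funext n a
    rcases a with a | a | a <;> rfl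

end LTree

/-- The space of all labellings of the pearled tree `t`, of the form `M(|p|) × ∏ O(|v|)`. -/
abbrev Labelling (O : TopOperad.{u}) (M : Ibimodule O) (t : Psi k) : Type u :=
  {z : LTree O M k // z.tree = t}

lemma tree_contractAll_eq {s t : Psi k} (h : s ≤ t) (z : Labelling O M s) :
    (LTree.contractAll (LTree.vertexSets s \ LTree.vertexSets t) z.1).tree = t := by
  rw [LTree.tree_contractAll, z.2, ← (Psi.le_vertexSets h).2]

/-- The composition of the labels along the edges which are contracted when passing from `s`
to `t`. -/
noncomputable def Labelling.comp {s t : Psi k} (h : s ≤ t) :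
    C(Labelling O M s, Labelling O M t) where
  toFun z := ⟨LTree.contractAll (LTree.vertexSets s \ LTree.vertexSets t) z.1,
    tree_contractAll_eq h z⟩
  continuous_toFun := ((LTree.continuous_contractAll _).comp continuous_subtype_val).subtype_mk
    (tree_contractAll_eq h)

/-- The map of spaces of labellings induced by morphisms. -/
def Labelling.map {O' : TopOperad.{u}} {M' : Ibimodule O'} {φ : OperadHom O O'}
    (f : IbimoduleHom φ M M') (t : Psi k) : C(Labelling O M t, Labelling O' M' t) where
  toFun z := ⟨z.1.map f, (LTree.tree_map f z.1).trans z.2⟩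
  continuous_toFun := ((LTree.continuous_map f).comp continuous_subtype_val).subtype_mk
    fun z => (LTree.tree_map f z.1).trans z.2

/-- The diagram of spaces over the poset of pearled trees associated to an infinitesimal bimodule
`M`: the space at `t` is the space of all labellings of `t`, and the map associated to `s ≤ t`
composes the labels along the contracted edges. -/
noncomputable def rho (O : TopOperad.{u}) (M : Ibimodule O) (k : ℕ) : Psi k ⥤ TopCat.{u} where
  obj t := TopCat.of (Labelling O M t)
  map h := TopCat.ofHom (Labelling.comp (leOfHom h))
  map_id t := by
    refine TopCat.hom_ext (ContinuousMap.ext fun (z : Labelling O M t) => Subtype.ext ?_)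
    change LTree.contractAll (LTree.vertexSets t \ LTree.vertexSets t) z.1 = z.1
    rw [Finset.sdiff_self]; rfl
  map_comp {s t w} h h' := by
    refine TopCat.hom_ext (ContinuousMap.ext fun (z : Labelling O M s) => Subtype.ext ?_)
    have h1 := (Psi.le_vertexSets (leOfHom h)).1
    have h2 := (Psi.le_vertexSets (leOfHom h')).1
    change LTree.contractAll (LTree.vertexSets s \ LTree.vertexSets w) z.1 =
      LTree.contractAll (LTree.vertexSets t \ LTree.vertexSets w)
        (LTree.contractAll (LTree.vertexSets s \ LTree.vertexSets t) z.1)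
    rw [← LTree.contractAll_disjUnion _ _ (Finset.disjoint_left.2 fun x hx hx' =>
      (Finset.mem_sdiff.1 hx').2 (Finset.mem_sdiff.1 hx).1)]
    congr 1
    ext x
    simp only [Finset.mem_sdiff, Finset.mem_disjUnion]
    have h3 : x ∈ LTree.vertexSets t → x ∈ LTree.vertexSets s := fun h => h1 h
    have h4 : x ∈ LTree.vertexSets w → x ∈ LTree.vertexSets t := fun h => h2 h
    tauto

/-- The natural transformation of diagrams induced by morphisms. -/
noncomputable def rhoMap {O' : TopOperad.{u}} {M' : Ibimodule O'} {φ : OperadHom O O'}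
    (f : IbimoduleHom φ M M') (k : ℕ) : rho O M k ⟶ rho O' M' k where
  app t := TopCat.ofHom (Labelling.map f t)
  naturality s _ _ := TopCat.hom_ext (ContinuousMap.ext fun (z : Labelling O M s) =>
    Subtype.ext (LTree.map_contractAll f _ z.1))

/-! ### Homotopy colimits over posets -/

section hocolim

universe w wQ

/-- The geometric realization of the nerve of a poset, in barycentric coordinates: its points are
the finite formal convex combinations of elements of `P` whose support is a chain. -/
def Realization (P : Type w) [PartialOrder P] : Type w :=
  {x : P →₀ ℝ // (∀ p, 0 ≤ x p) ∧ (x.sum fun _ r => r) = 1 ∧ IsChain (· ≤ ·) (x.support : Set P)}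

namespace Realization

variable {P : Type w} [PartialOrder P] {Q : Type wQ} [PartialOrder Q]

/-- The (possibly degenerate) simplex given by `p₀ ≤ ⋯ ≤ pₙ`. -/
noncomputable def simplex {n : ℕ} (p : Fin (n + 1) →o P) (x : stdSimplex ℝ (Fin (n + 1))) :
    Realization P :=
  ⟨∑ i, Finsupp.single (p i) (x.1 i), by
    classical
    refine ⟨fun q => ?_, ?_, ?_⟩
    · rw [Finsupp.finsetSum_apply]
      refine Finset.sum_nonneg fun i _ => ?_
      rw [Finsupp.single_apply]
      split_ifs
      exacts [x.2.1 i, le_rfl]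
    · rw [← Finsupp.sum_finsetSum_index (fun _ => rfl) (fun _ _ _ => rfl)]
      simp only [Finsupp.sum_single_index]
      exact x.2.2
    · have hs : ((∑ i, Finsupp.single (p i) (x.1 i)).support : Set P) ⊆ Set.range p := by
        intro q hq
        obtain ⟨i, -, hi⟩ := Finset.mem_biUnion.1 (Finsupp.support_finsetSum hq)
        exact ⟨i, (Finset.mem_singleton.1 (Finsupp.support_single_subset hi)).symm⟩
      refine IsChain.mono hs ?_
      rintro _ ⟨i, rfl⟩ _ ⟨j, rfl⟩ -
      exact (le_total i j).imp (fun h => p.monotone h) (fun h => p.monotone h)⟩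

/-- The topology is the quotient topology of the disjoint union of all simplices. -/
noncomputable instance instTop : TopologicalSpace (Realization P) :=
  TopologicalSpace.coinduced
    (fun s : Σ c : (Σ n : ℕ, Fin (n + 1) →o P), stdSimplex ℝ (Fin (c.1 + 1)) => simplex s.1.2 s.2)
    inferInstance

/-- The map of realizations induced by a monotone map. -/
noncomputable def map (f : P →o Q) (x : Realization P) : Realization Q :=
  ⟨x.1.mapDomain f, by
    classical
    refine ⟨fun q => ?_, ?_, ?_⟩
    · rw [Finsupp.mapDomain, Finsupp.sum_apply]
      refine Finset.sum_nonneg fun i _ => ?_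
      dsimp only
      rw [Finsupp.single_apply]
      split_ifs
      exacts [x.2.1 i, le_rfl]
    · rw [Finsupp.sum_mapDomain_index (fun _ => rfl) (fun _ _ _ => rfl)]
      exact x.2.2.1
    · have hs : ((x.1.mapDomain f).support : Set Q) ⊆ f '' x.1.support := by
        intro q hq
        simpa using Finsupp.mapDomain_support hq
      refine IsChain.mono hs ?_
      rintro _ ⟨i, hi, rfl⟩ _ ⟨j, hj, rfl⟩ -
      exact (x.2.2.2.total hi hj).imp (fun h => f.monotone h) (fun h => f.monotone h)⟩

lemma map_map {R : Type*} [PartialOrder R] (g : Q →o R) (f : P →o Q) (x : Realization P) :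
    (x.map f).map g = x.map (g.comp f) :=
  Subtype.ext (Finsupp.mapDomain_comp (f := f) (g := g) (v := x.1)).symm

end Realization

variable {P : Type w} [PartialOrder P]

/-- The inclusion of under-posets for `c ≤ c'`. -/
def iciIncl {c c' : P} (h : c ≤ c') : Set.Ici c' →o Set.Ici c where
  toFun x := ⟨x.1, le_trans h x.2⟩
  monotone' _ _ hxy := hxy

/-- The identifications in the homotopy colimit of a diagram `F` over `P`. -/
inductive HocolimRel (F : P ⥤ TopCat.{u}) :
    (Σ c : P, KProd (Realization (Set.Ici c)) (F.obj c)) →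
      (Σ c : P, KProd (Realization (Set.Ici c)) (F.obj c)) → Prop
  | glue {c c' : P} (h : c ≤ c') (x : Realization (Set.Ici c')) (a : F.obj c) :
      HocolimRel F ⟨c, x.map (iciIncl h), a⟩ ⟨c', x, F.map (homOfLE h) a⟩

/-- The homotopy colimit of a diagram `F` of spaces over a poset `P`: the tensor product of the
contravariant functor `c ↦ |c ↓ P|` and `F`, i.e. the quotient of the disjoint union of the spaces
`|c ↓ P| × F(c)`. -/
def hocolim (F : P ⥤ TopCat.{u}) : Type (max w u) := Quot (HocolimRel F)

noncomputable instance hocolim.instTop (F : P ⥤ TopCat.{u}) : TopologicalSpace (hocolim F) :=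
  inferInstanceAs (TopologicalSpace (Quot (HocolimRel F)))

/-- The map of homotopy colimits induced by a natural transformation. -/
def hocolim.map {F G : P ⥤ TopCat.{u}} (α : F ⟶ G) : hocolim F → hocolim G :=
  Quot.lift (fun y => Quot.mk _ ⟨y.1, y.2.1, α.app y.1 y.2.2⟩) (by
    rintro _ _ ⟨h, x, a⟩
    have e : α.app _ (F.map (homOfLE h) a) = G.map (homOfLE h) (α.app _ a) :=
      ConcreteCategory.congr_hom (α.naturality (homOfLE h)) a
    refine (Quot.sound (HocolimRel.glue (F := G) h x (α.app _ a))).trans ?_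
    rw [← e])

/-- The restriction of a diagram to a subset of the poset. -/
def restrict (F : P ⥤ TopCat.{u}) (S : Set P) : S ⥤ TopCat.{u} :=
  Monotone.functor (f := fun c : S => c.1) (fun _ _ h => h) ⋙ F

/-- The inclusion of under-posets. -/
def subIcl (S : Set P) (c : S) : Set.Ici c →o Set.Ici c.1 where
  toFun x := ⟨x.1.1, x.2⟩
  monotone' _ _ hxy := hxy

/-- The canonical map from the homotopy colimit over a subset of `P` to the homotopy colimit over
`P`. -/
noncomputable def hocolimIncl (F : P ⥤ TopCat.{u}) (S : Set P) :
    hocolim (restrict F S) → hocolim F :=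
  Quot.lift (fun y => Quot.mk _ ⟨y.1.1, y.2.1.map (subIcl S y.1), y.2.2⟩) (by
    rintro _ _ ⟨h, x, a⟩
    rename_i c c'
    refine Eq.trans ?_ (Quot.sound (HocolimRel.glue (F := F) (c := c.1) (c' := c'.1) h
      (x.map (subIcl S c')) a))
    rw [Realization.map_map]
    dsimp only
    rw [Realization.map_map]
    rfl)

end hocolim

/-! ### The Boardman–Vogt resolution of an infinitesimal bimodule -/

/-- Labels together with a real number in `[0,1]`. -/
abbrev TLbl (O : TopOperad.{u}) (M : Ibimodule O) (n : ℕ) : Type u := Lbl O M n × unitInterval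

namespace Tr

/-- Forgets the numbers. -/
def forget (D : Tr (TLbl O M) k) : Tr (Lbl O M) k := D.map fun _ a => a.1

/-- The pearl is the root of `D` or lies above it. -/
def HasPearl (D : Tr (TLbl O M) k) : Prop := none ∈ D.forget.supp

/-- Admissible numbers: the pearl is labelled by `0`, and along every inner edge the vertex which
is closer to the pearl has the smaller number. -/
def Adm : Tr (TLbl O M) k → Prop
  | leaf _ => True
  | node _ a ch => (a.1.pearls ≠ 0 → a.2 = 0) ∧ ∀ i, Adm (ch i) ∧
      ∀ (m : ℕ) (b : TLbl O M m) (ch' : Fin m → Tr (TLbl O M) k), ch i = node m b ch' →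
        (HasPearl (ch i) → b.2 ≤ a.2) ∧ (¬ HasPearl (ch i) → a.2 ≤ b.2)

/-- The generating relations of the Boardman–Vogt resolution, applied anywhere in a tree:
* a bivalent vertex labelled by the unit of `O` is removed;
* the inputs of a vertex are permuted, with the corresponding action on its label;
* an inner edge between two vertices with the same number is contracted, and the labels are
  composed. (As the pearl has the number `0`, a vertex with number `0` adjacent to the pearl is
  contracted to the pearl through the infinitesimal bimodule structure.) -/
inductive IbRel : Tr (TLbl O M) k → Tr (TLbl O M) k → Prop
  | unit (t : unitInterval) (ch : Fin 1 → Tr (TLbl O M) k) :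
      IbRel (node 1 (Lbl.op O.one, t) ch) (ch 0)
  | perm {m n : ℕ} (e : Fin m ≃ Fin n) (a : Lbl O M n) (t : unitInterval)
      (ch : Fin n → Tr (TLbl O M) k) :
      IbRel (node m (a.act e, t) fun i => ch (e i)) (node n (a, t) ch)
  | contract {n m : ℕ} (a : Lbl O M n) (t : unitInterval) (ch : Fin n → Tr (TLbl O M) k)
      (i : Fin n) (b : Lbl O M m) (ch' : Fin m → Tr (TLbl O M) k) (h : ch i = node m (b, t) ch') :
      IbRel (node n (a, t) ch) (node (n + m - 1) (a.comp i b, t) (graft i ch ch'))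
  | above {n : ℕ} (a : TLbl O M n) (ch : Fin n → Tr (TLbl O M) k) (i : Fin n)
      (c : Tr (TLbl O M) k) (h : IbRel (ch i) c) :
      IbRel (node n a ch) (node n a (Function.update ch i c))

open Classical in
/-- The number of geometrical inputs of the prime component, which is obtained by removing all
vertices with number `1` (for trees all of whose vertices other than the pearl have arity at
least `1`, so that it is the number of leaves of the prime component). -/
noncomputable def geomInputs : Tr (TLbl O M) k → ℕ
  | leaf _ => 1
  | node n a ch =>
    if a.2 = 1 then
      if HasPearl (node n a ch) then ∑ i, if HasPearl (ch i) then geomInputs (ch i) else 0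
      else 1
    else ∑ i, geomInputs (ch i)

end Tr

/-- Planar pearled trees whose vertices other than the pearl are of arity at least `1`, with
leaves labelled bijectively by `Fin k`, with the pearl `p` labelled by `M(|p|)`, the other
vertices `v` labelled by `O(|v|)`, and with admissible numbers in `[0,1]`. The topology is the one
of the disjoint union over all planar trees of the corresponding subspaces of
`M(|p|) × ∏ O(|v|) × ∏ [0,1]` (in the category of `k`-spaces). -/
structure IbTree (O : TopOperad.{u}) (M : Ibimodule O) (k : ℕ) : Type u where
  tr : Tr (TLbl O M) k
  pearled : tr.forget.Pearled 1
  adm : tr.Adm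

instance IbTree.instTop (O : TopOperad.{u}) (M : Ibimodule O) (k : ℕ) :
    TopologicalSpace (IbTree O M k) :=
  @TopologicalSpace.compactlyGenerated.{u} (IbTree O M k)
    (TopologicalSpace.induced IbTree.tr inferInstance)

/-- The space `Ib^Λ(M)(k)` of the Boardman–Vogt resolution of the infinitesimal bimodule `M`. -/
def Ib (O : TopOperad.{u}) (M : Ibimodule O) (k : ℕ) : Type u :=
  Quot fun D E : IbTree O M k => D.tr.IbRel E.tr

instance Ib.instTop (O : TopOperad.{u}) (M : Ibimodule O) (k : ℕ) : TopologicalSpace (Ib O M k) :=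
  inferInstanceAs (TopologicalSpace (Quot fun D E : IbTree O M k => D.tr.IbRel E.tr))

/-- The point of `Ib^Λ(M)(k)` represented by a tree with labels and numbers. -/
def Ib.mk (D : IbTree O M k) : Ib O M k := Quot.mk _ D

/-- The `j`-th filtration term of `Ib^Λ(M)(k)`: points whose prime component has at most `j`
geometrical inputs. -/
def Ib.filtration (O : TopOperad.{u}) (M : Ibimodule O) (k : ℕ) (j : ℤ) : Set (Ib O M k) :=
  {x | ∃ D : IbTree O M k, Ib.mk D = x ∧ (D.tr.geomInputs : ℤ) ≤ j}

/-- The boundary `∂Ib^Λ(M)(k)`: the filtration term `k - 1` of `Ib^Λ(M)(k)`. -/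
def Ib.boundary (O : TopOperad.{u}) (M : Ibimodule O) (k : ℕ) : Set (Ib O M k) :=
  Ib.filtration O M k (k - 1)

/-- The point `x` is labelled by the non-planar tree `T`: it is represented by a tree whose
non-pearl vertices have arity at least `2` and whose underlying non-planar tree is `T`. -/
def Ib.LabelledBy (x : Ib O M k) (T : Psi k) : Prop :=
  ∃ (D : IbTree O M k) (h : D.tr.forget.Pearled 2),
    Ib.mk D = x ∧ (LTree.mk ⟨D.tr.forget, h⟩).tree = T

section maps

variable {O' : TopOperad.{v}} {M' : Ibimodule O'} {φ : OperadHom O O'}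
  (f : IbimoduleHom φ M M')

namespace Tr

/-- The map of trees with labels and numbers induced by morphisms. -/
def tmap (D : Tr (TLbl O M) k) : Tr (TLbl O' M') k :=
  D.map fun n a => (a.1.map f n, a.2)

@[simp] lemma forget_tmap (D : Tr (TLbl O M) k) :
    (D.tmap f).forget = D.forget.map (Lbl.map f) := by
  simp only [tmap, forget, map_map]

@[simp] lemma hasPearl_tmap (D : Tr (TLbl O M) k) : (D.tmap f).HasPearl ↔ D.HasPearl := by
  simp only [HasPearl, forget_tmap, supp_map]

lemma Adm.tmap {D : Tr (TLbl O M) k} (h : D.Adm) : (D.tmap f).Adm := by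
  induction D with
  | leaf i => trivial
  | node n a ch ih =>
    refine ⟨fun h' => h.1 (by simpa using h'), fun i => ⟨ih i (h.2 i).1, fun m b ch' hb => ?_⟩⟩
    change (ch i).tmap f = _ at hb
    change (HasPearl ((ch i).tmap f) → _) ∧ (¬ HasPearl ((ch i).tmap f) → _)
    rw [hasPearl_tmap]
    rcases hc : ch i with j | ⟨l, c, ch''⟩
    · rw [hc] at hb; simp [Tr.tmap, Tr.map] at hb
    · have := (h.2 i).2 l c ch'' hc
      rw [hc] at hb this
      simp only [Tr.tmap, Tr.map, Tr.node.injEq] at hb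
      obtain ⟨rfl, hb, -⟩ := hb
      rw [← eq_of_heq hb]
      exact this

lemma IbRel.tmap {D E : Tr (TLbl O M) k} (h : IbRel D E) : IbRel (D.tmap f) (E.tmap f) := by
  induction h with
  | unit t ch =>
    have := IbRel.unit (O := O') (M := M') t fun i => (ch i).tmap f
    rw [← φ.map_one] at this
    exact this
  | perm e a t ch =>
    have := IbRel.perm e (a.map f _) t fun i => (ch i).tmap f
    rw [← Lbl.map_act] at this
    exact this
  | @contract n m a t ch i b ch' h =>
    have := IbRel.contract (a.map f _) t (fun j => (ch j).tmap f) i (b.map f _)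
      (fun j => (ch' j).tmap f) (by rw [h]; rfl)
    rw [← Lbl.map_comp] at this
    have e : (node (n + m - 1) (a.comp i b, t) (graft i ch ch')).tmap f =
        node (n + m - 1) ((a.comp i b).map f _, t)
          (graft i (fun j => (ch j).tmap f) fun j => (ch' j).tmap f) :=
      congrArg (node (A := TLbl O' M') (n + m - 1) ((a.comp i b).map f _, t))
        (funext fun p => map_graft (Tr.tmap f) i ch ch' p)
    rw [e]
    exact this
  | @above n a ch i c h ih =>
    have := IbRel.above (a.1.map f _, a.2) (fun j => (ch j).tmap f) i _ ih
    have e : (node n a (Function.update ch i c)).tmap f = node n (a.1.map f n, a.2)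
        (Function.update (fun j => (ch j).tmap f) i (c.tmap f)) := by
      refine congrArg (node (A := TLbl O' M') n (a.1.map f n, a.2)) (funext fun j => ?_)
      change (Function.update ch i c j).tmap f = _
      by_cases hj : j = i
      · subst hj; simp
      · simp [hj]
    rw [e]
    exact this

end Tr

/-- The map of Boardman–Vogt resolutions induced by morphisms. -/
def ibMap (k : ℕ) : Ib O M k → Ib O' M' k :=
  Quot.map (fun D : IbTree O M k => (⟨D.tr.tmap f, by
    rw [Tr.forget_tmap, Tr.pearled_map]; exact D.pearled, D.adm.tmap f⟩ : IbTree O' M' k))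
    fun _ _ h => Tr.IbRel.tmap f h

end maps

end BoardmanVogt

open BoardmanVogt

set_option linter.unusedSectionVars false

namespace BoardmanVogt

/-! ### Path lengths in laminar families

A laminar family `V` of subsets of `α` encodes a rooted tree whose vertices are the members of
`V`; the vertex nearest to the base point `o` plays the role of the pearl. The edge below the
vertex `e` is also denoted by `e`. -/

section laminar

variable {α : Type*} [Fintype α] [DecidableEq α]

/-! Fix a pearled tree `c`. A tree above `c` is determined by the set of inner edges of `c` that
survive in it, and every set of edges occurs. So the under-poset of `c` is a lattice of subsets with
the order reversed, and its realization is a cube: the coordinate of an edge is the total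
barycentric weight of the trees in which the edge survives (`Realization.weight_injective`,
`Realization.exists_weight_eq`).

The admissible numbers on the vertices of `c` vanish at the pearl, do not decrease along paths
leaving the pearl, and are at most `1`. Taking differences along edges turns them into edge lengths,
and the number of a vertex is the length of its path to the pearl. This identifies the cone of edge
lengths with the cone of admissible numbers, but not the cube with the numbers bounded by `1`,
because a path may be longer than each of its edges. Hence each ray is rescaled by the quotient of
the longest edge by the longest path. The result `time` is a continuous bijection from the cube onto
the numbers in `[0,1]` (`time_injOn`, `exists_time_eq`, `continuousOn_time`). An edge of length `0`
joins vertices with equal numbers (`time_eq_of_covers`), and some edge has length `1` exactly when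
some vertex has number `1` (`exists_mem_time_eq_one_iff`).

The map from the homotopy colimit gives the vertices of a labelled tree these numbers. For `c ≤ c'`
and a point over `c'`, the edges contracted on the way to `c'` have coordinate `0`, so their ends
have equal numbers, and the gluing relation becomes the contraction relation of the resolution
(`place_contract`). In the other direction, `O(1)` consists of the unit only, so the bivalent
vertices other than the pearl can be removed. After this reduction every generating relation is
either an isomorphism preserving the numbers or the contraction of an edge between equal numbers
(`Tr.IbRel.red`), and the gluing relation absorbs the latter (`collect_contract`). The two maps are
inverse to each other.

Continuity is checked on compact Hausdorff families of fixed shape. The realizations of the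
under-posets are compact Hausdorff. This permits passing to function spaces in one direction
(`continuous_placeMap`), and in the other it makes the numbers an embedding of the realization
(`Psi.continuous_of_timeI`).

A point lies over the poset without the corolla when its supporting chain avoids the corolla, that
is, when some edge survives along the whole chain. Equivalently some edge has length `1`, or some
vertex has number `1`, or the prime component has fewer than `k` leaves
(`Psi.exists_timeI_eq_one_iff`, `Tr.Ok.geomInputs_deco_lt`). The embedding statements hold because
inclusions of subsets of the poset induce closed injections of homotopy colimits
(`isClosedMap_hocolimIncl`). -/

/-- A family of nonempty sets containing the whole set, any two of which are disjoint or
nested. -/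
structure Laminar (V : Finset (Finset α)) : Prop where
  univ_mem : Finset.univ ∈ V
  nonempty : ∀ v ∈ V, v.Nonempty
  nested : ∀ v ∈ V, ∀ w ∈ V, ∀ x, x ∈ v → x ∈ w → v ⊆ w ∨ w ⊆ v

/-- `w` is the vertex directly below `v`. -/
def Covers (V : Finset (Finset α)) (v w : Finset α) : Prop :=
  v ∈ V ∧ w ∈ V ∧ v ⊂ w ∧ ∀ g ∈ V, v ⊆ g → g ⊆ w → g = v ∨ g = w

lemma Laminar.exists_covers {V : Finset (Finset α)} (hV : Laminar V) {v : Finset α} (hv : v ∈ V)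
    (h : v ≠ Finset.univ) : ∃ w, Covers V v w := by
  obtain ⟨w, hw, hmin⟩ := Finset.exists_min_image (V.filter fun w => v ⊂ w) Finset.card
    ⟨Finset.univ, by simp [hV.univ_mem, Finset.ssubset_univ_iff, h]⟩
  rw [Finset.mem_filter] at hw
  refine ⟨w, hv, hw.1, hw.2, fun g hg h1 h2 => ?_⟩
  by_cases hgv : g = v
  · exact .inl hgv
  · exact .inr (Finset.eq_of_subset_of_card_le h2
      (hmin g (Finset.mem_filter.2 ⟨hg, h1.ssubset_of_ne (Ne.symm hgv)⟩)))

/-- The witness is the smallest member containing `q`; by nestedness every other member containing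
`q` contains it. Relative to `V` an arbitrary nonempty set thus behaves like a vertex. For `q = {o}`
this vertex is the pearl. -/
lemma Laminar.exists_subset_iff {V : Finset (Finset α)} (hV : Laminar V) {q : Finset α}
    (hq : q.Nonempty) : ∃ v ∈ V, ∀ e ∈ V, q ⊆ e ↔ v ⊆ e := by
  obtain ⟨v, hv, hmin⟩ := Finset.exists_min_image (V.filter fun w => q ⊆ w) Finset.card
    ⟨Finset.univ, by simp [hV.univ_mem]⟩
  rw [Finset.mem_filter] at hv
  refine ⟨v, hv.1, fun e he => ⟨fun h => ?_, hv.2.trans⟩⟩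
  obtain ⟨x, hx⟩ := hq
  rcases hV.nested e he v hv.1 x (h hx) (hv.2 hx) with h1 | h1
  · exact (Finset.eq_of_subset_of_card_le h1 (hmin e (Finset.mem_filter.2 ⟨he, h⟩))).ge
  · exact h1

/-- No member lies strictly between `v` and `w`, so `v` is the only edge of the tree that separates
the two vertices. -/
lemma Laminar.subset_iff_of_covers {V : Finset (Finset α)} (hV : Laminar V) {v w g : Finset α}
    (h : Covers V v w) (hg : g ∈ V) (hgv : g ≠ v) : v ⊆ g ↔ w ⊆ g := by
  refine ⟨fun h1 => ?_, fun h1 => h.2.2.1.1.trans h1⟩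
  obtain ⟨x, hx⟩ := hV.nonempty v h.1
  rcases hV.nested g hg w h.2.1 x (h1 hx) (h.2.2.1.1 hx) with h2 | h2
  · rcases h.2.2.2 g hg h1 h2 with h3 | h3
    exacts [absurd h3 hgv, h3.ge]
  · exact h2

variable (o : α)

/-- The edge lengths in `[0,1]` on the inner edges of `V`, extended by zero. -/
def edgeCube (V : Finset (Finset α)) : Set (Finset α → ℝ) :=
  {s | (∀ e, 0 ≤ s e ∧ s e ≤ 1) ∧ ∀ e, s e ≠ 0 → e ∈ V ∧ e ≠ Finset.univ}

/-- The length of the path from `v` to the pearl. -/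
noncomputable def pathLength (s : Finset α → ℝ) (v : Finset α) : ℝ :=
  ∑ e, if v ⊆ e ↔ o ∈ e then 0 else s e

/-- The length of the longest edge. -/
noncomputable def maxEdge (s : Finset α → ℝ) : ℝ := Finset.univ.sup' Finset.univ_nonempty s

/-- The length of the longest path starting at the pearl. -/
noncomputable def maxPath (s : Finset α → ℝ) : ℝ :=
  (Finset.univ.filter Finset.Nonempty).sup' ⟨{o}, by simp⟩ (pathLength o s)

/-- The path lengths, rescaled in such a way that the longest path is as long as the longest
edge. -/
noncomputable def time (s : Finset α → ℝ) (v : Finset α) : ℝ :=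
  maxEdge s / maxPath o s * pathLength o s v

/-- Numbers on the vertices which increase along paths starting at the pearl, where they are
zero. -/
def IsAdm (V : Finset (Finset α)) (θ : Finset α → ℝ) : Prop :=
  (∀ v ∈ V, o ∈ v → (∀ e ∈ V, o ∈ e → v ⊆ e) → θ v = 0) ∧
    ∀ v w, Covers V v w → (o ∈ v → θ v ≤ θ w) ∧ (o ∉ v → θ w ≤ θ v)

lemma edgeCube_mono {V W : Finset (Finset α)} (h : V ⊆ W) : edgeCube V ⊆ edgeCube W :=
  fun _ hs => ⟨hs.1, fun e he => ⟨h (hs.2 e he).1, (hs.2 e he).2⟩⟩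

lemma le_maxEdge (s : Finset α → ℝ) (e : Finset α) : s e ≤ maxEdge s :=
  Finset.le_sup' s (Finset.mem_univ e)

lemma exists_eq_maxEdge (s : Finset α → ℝ) : ∃ e, s e = maxEdge s := by
  obtain ⟨e, -, he⟩ := Finset.exists_mem_eq_sup' Finset.univ_nonempty s
  exact ⟨e, he.symm⟩

lemma pathLength_le_maxPath (s : Finset α → ℝ) {v : Finset α} (hv : v.Nonempty) :
    pathLength o s v ≤ maxPath o s :=
  Finset.le_sup' (pathLength o s) (by simpa using hv)

lemma exists_pathLength_eq_maxPath (s : Finset α → ℝ) :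
    ∃ v : Finset α, v.Nonempty ∧ pathLength o s v = maxPath o s := by
  obtain ⟨e, h, he⟩ := Finset.exists_mem_eq_sup' (s := Finset.univ.filter Finset.Nonempty)
    ⟨{o}, by simp⟩ (pathLength o s)
  exact ⟨e, by simpa using h, he.symm⟩

section nonneg

variable {s : Finset α → ℝ} (hs : ∀ e, 0 ≤ s e)
include hs

lemma maxEdge_nonneg : 0 ≤ maxEdge s := (hs ∅).trans (le_maxEdge s _)

lemma pathLength_nonneg (v : Finset α) : 0 ≤ pathLength o s v :=
  Finset.sum_nonneg fun e _ => by split_ifs; exacts [le_rfl, hs e]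

lemma maxPath_nonneg : 0 ≤ maxPath o s :=
  (pathLength_nonneg o hs {o}).trans (pathLength_le_maxPath o s (by simp))

lemma le_pathLength {v e : Finset α} (h : ¬ (v ⊆ e ↔ o ∈ e)) : s e ≤ pathLength o s v := by
  have := Finset.single_le_sum (f := fun e => if v ⊆ e ↔ o ∈ e then 0 else s e)
    (fun e _ => by split_ifs; exacts [le_rfl, hs e]) (Finset.mem_univ e)
  rwa [if_neg h] at this

lemma time_nonneg (v : Finset α) : 0 ≤ time o s v :=
  mul_nonneg (div_nonneg (maxEdge_nonneg hs) (maxPath_nonneg o hs)) (pathLength_nonneg o hs v)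

lemma time_le_maxEdge {v : Finset α} (hv : v.Nonempty) : time o s v ≤ maxEdge s := by
  rcases (maxPath_nonneg o hs).eq_or_lt with h | h
  · simp only [time, ← h, div_zero, zero_mul, maxEdge_nonneg hs]
  · rw [time, div_mul_eq_mul_div, div_le_iff₀ h]
    exact mul_le_mul_of_nonneg_left (pathLength_le_maxPath o s hv) (maxEdge_nonneg hs)

end nonneg

/-! ### The rescaling from edge lengths to numbers: bijectivity and continuity -/

section cube

variable {V : Finset (Finset α)} (hV : Laminar V)
include hV

/-- Every edge lies on a path ending at the pearl: the path from the root if the pearl is above the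
edge, and otherwise the path from the upper end of the edge. -/
lemma edge_le_maxPath {s : Finset α → ℝ} (hs : s ∈ edgeCube V) (e : Finset α) :
    s e ≤ maxPath o s := by
  by_cases he : s e = 0
  · rw [he]; exact maxPath_nonneg o fun e => (hs.1 e).1
  · obtain ⟨h1, h2⟩ := hs.2 e he
    by_cases ho : o ∈ e
    · refine (le_pathLength o (fun e => (hs.1 e).1) (v := Finset.univ) ?_).trans
        (pathLength_le_maxPath o s ⟨o, Finset.mem_univ o⟩)
      simp [Finset.univ_subset_iff, h2, ho]
    · refine (le_pathLength o (fun e => (hs.1 e).1) (v := e) ?_).trans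
        (pathLength_le_maxPath o s (hV.nonempty e h1))
      simp [ho]

/-- In particular the longest edge vanishes wherever the longest path does, so the value `0` that
division by zero gives to `time` there is the correct one. -/
lemma maxEdge_le_maxPath {s : Finset α → ℝ} (hs : s ∈ edgeCube V) : maxEdge s ≤ maxPath o s :=
  Finset.sup'_le _ _ fun e _ => edge_le_maxPath o hV hs e

omit hV in
lemma pathLength_congr {s : Finset α → ℝ} (hs : s ∈ edgeCube V) {v q : Finset α}
    (h : ∀ e ∈ V, q ⊆ e ↔ v ⊆ e) : pathLength o s q = pathLength o s v := by
  refine Finset.sum_congr rfl fun e _ => ?_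
  by_cases he : s e = 0
  · simp [he]
  · simp only [h e (hs.2 e he).1]

/-- In `maxPath` the maximum runs over all nonempty sets, which makes its value independent of `V`
and hence unchanged under contraction. For lengths supported on `V` it is still attained at a
vertex. -/
lemma exists_mem_pathLength_eq_maxPath {s : Finset α → ℝ} (hs : s ∈ edgeCube V) :
    ∃ v ∈ V, pathLength o s v = maxPath o s := by
  obtain ⟨q, hq, h⟩ := exists_pathLength_eq_maxPath o s
  obtain ⟨v, hv, h'⟩ := hV.exists_subset_iff hq
  exact ⟨v, hv, (pathLength_congr o hs h').symm.trans h⟩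

lemma exists_mem_time_eq_maxEdge {s : Finset α → ℝ} (hs : s ∈ edgeCube V) :
    ∃ v ∈ V, time o s v = maxEdge s := by
  obtain ⟨v, hv, h⟩ := exists_mem_pathLength_eq_maxPath o hV hs
  refine ⟨v, hv, ?_⟩
  rw [time, h]
  rcases (maxPath_nonneg o fun e => (hs.1 e).1).eq_or_lt with h0 | h0
  · rw [← h0, mul_zero]
    exact le_antisymm (maxEdge_nonneg fun e => (hs.1 e).1)
      ((maxEdge_le_maxPath o hV hs).trans h0.ge)
  · exact div_mul_cancel₀ _ h0.ne'

/-- The path from `v` to the pearl crosses the edge `e` when exactly one of the vertex `v` and the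
pearl lies above `e`, that is, when exactly one of `v ⊆ e` and `o ∈ e` holds. The paths from `v` and
from the vertex `w` below it differ by the edge `v` alone. This edge is on the path from `w` if the
pearl is above `v`, and on the path from `v` otherwise. -/
lemma pathLength_covers {s : Finset α → ℝ} (hs : ∀ e, s e ≠ 0 → e ∈ V ∧ e ≠ Finset.univ)
    {v w : Finset α} (h : Covers V v w) :
    pathLength o s v - pathLength o s w = if o ∈ v then - s v else s v := by
  rw [pathLength, pathLength, ← Finset.sum_sub_distrib, Finset.sum_eq_single v]
  · have : ¬ w ⊆ v := h.2.2.1.2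
    by_cases ho : o ∈ v <;> simp [ho, this]
  · intro g _ hg
    by_cases hg0 : s g = 0
    · simp [hg0]
    · simp only [hV.subset_iff_of_covers h (hs g hg0).1 hg, sub_self]
  · simp

lemma time_eq_of_covers {s : Finset α → ℝ} (hs : s ∈ edgeCube V) {v w : Finset α}
    (h : Covers V v w) (h0 : s v = 0) : time o s v = time o s w := by
  have := pathLength_covers o hV hs.2 h
  rw [h0, neg_zero, ite_self, sub_eq_zero] at this
  rw [time, this, time]

lemma isAdm_time {s : Finset α → ℝ} (hs : s ∈ edgeCube V) : IsAdm o V (time o s) := by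
  have h0 : 0 ≤ maxEdge s / maxPath o s :=
    div_nonneg (maxEdge_nonneg fun e => (hs.1 e).1) (maxPath_nonneg o fun e => (hs.1 e).1)
  refine ⟨fun v hv ho hmin => ?_, fun v w h => ?_⟩
  · have : pathLength o s v = 0 := by
      refine Finset.sum_eq_zero fun e _ => ?_
      by_cases he : s e = 0
      · simp [he]
      · rw [if_pos ⟨fun h => h ho, hmin e (hs.2 e he).1⟩]
    rw [time, this, mul_zero]
  · have := pathLength_covers o hV hs.2 h
    have hv := (hs.1 v).1
    refine ⟨fun ho => mul_le_mul_of_nonneg_left ?_ h0, fun ho => mul_le_mul_of_nonneg_left ?_ h0⟩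
    · rw [if_pos ho] at this; linarith
    · rw [if_neg ho] at this; linarith

/-- The rescaling is normalized so that the largest number equals the longest edge, and both are
bounded by `1`. -/
lemma exists_mem_time_eq_one_iff {s : Finset α → ℝ} (hs : s ∈ edgeCube V) :
    (∃ v ∈ V, time o s v = 1) ↔ ∃ e, s e = 1 := by
  constructor
  · rintro ⟨v, hv, h⟩
    obtain ⟨e, he⟩ := exists_eq_maxEdge s
    refine ⟨e, le_antisymm (hs.1 e).2 ?_⟩
    rw [he, ← h]
    exact time_le_maxEdge o (fun e => (hs.1 e).1) (hV.nonempty v hv)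
  · rintro ⟨e, he⟩
    obtain ⟨v, hv, h⟩ := exists_mem_time_eq_maxEdge o hV hs
    refine ⟨v, hv, h.trans (le_antisymm ?_ (he.ge.trans (le_maxEdge s e)))⟩
    exact Finset.sup'_le _ _ fun e _ => (hs.1 e).2

/-- Differences of the numbers along edges recover the edge lengths up to the scalar `maxEdge /
maxPath`. The largest number is the longest edge, so the longest edges of `s` and `s'` agree, and
this fixes the scalar. -/
lemma time_injOn {s s' : Finset α → ℝ} (hs : s ∈ edgeCube V) (hs' : s' ∈ edgeCube V)
    (h : ∀ v ∈ V, time o s v = time o s' v) : s = s' := by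
  have key : ∀ {s}, s ∈ edgeCube V → ∀ e w, Covers V e w →
      maxEdge s / maxPath o s * s e = |time o s e - time o s w| := by
    intro s hs e w hc
    have h0 : 0 ≤ maxEdge s / maxPath o s :=
      div_nonneg (maxEdge_nonneg fun e => (hs.1 e).1) (maxPath_nonneg o fun e => (hs.1 e).1)
    rw [time, time, ← mul_sub, pathLength_covers o hV hs.2 hc, abs_mul, abs_of_nonneg h0]
    split_ifs <;> simp [abs_of_nonneg (hs.1 e).1]
  have hmul : ∀ e, maxEdge s / maxPath o s * s e = maxEdge s' / maxPath o s' * s' e := by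
    intro e
    by_cases he : e ∈ V ∧ e ≠ Finset.univ
    · obtain ⟨w, hw⟩ := hV.exists_covers he.1 he.2
      rw [key hs e w hw, key hs' e w hw, h e he.1, h w hw.2.1]
    · have h1 : s e = 0 := by_contra fun hc => he (hs.2 e hc)
      have h2 : s' e = 0 := by_contra fun hc => he (hs'.2 e hc)
      simp [h1, h2]
  have hle : ∀ {s s'}, s ∈ edgeCube V → s' ∈ edgeCube V →
      (∀ v ∈ V, time o s v = time o s' v) → maxEdge s ≤ maxEdge s' := by
    intro s s' hs hs' h
    obtain ⟨v, hv, h1⟩ := exists_mem_time_eq_maxEdge o hV hs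
    rw [← h1, h v hv]
    exact time_le_maxEdge o (fun e => (hs'.1 e).1) (hV.nonempty v hv)
  have hmax : maxEdge s = maxEdge s' :=
    le_antisymm (hle hs hs' h) (hle hs' hs fun v hv => (h v hv).symm)
  rcases (maxEdge_nonneg fun e => (hs.1 e).1).eq_or_lt with h0 | h0
  · funext e
    have h1 := le_maxEdge s e
    have h2 := le_maxEdge s' e
    have h3 := (hs.1 e).1
    have h4 := (hs'.1 e).1
    linarith
  · have hp : 0 < maxEdge s / maxPath o s := div_pos h0 (h0.trans_le (maxEdge_le_maxPath o hV hs))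
    have hp' : 0 < maxEdge s' / maxPath o s' :=
      div_pos (hmax ▸ h0) ((hmax ▸ h0).trans_le (maxEdge_le_maxPath o hV hs'))
    obtain ⟨e, he⟩ := exists_eq_maxEdge s
    obtain ⟨e', he'⟩ := exists_eq_maxEdge s'
    -- The two multiples of `s` and `s'` coincide. Evaluating them at a longest edge of either one
    -- and using that the maxima agree gives both inequalities between the scalars.
    have hc : maxEdge s / maxPath o s = maxEdge s' / maxPath o s' := by
      refine le_antisymm (le_of_mul_le_mul_right ?_ h0) (le_of_mul_le_mul_right ?_ h0)
      · rw [show maxEdge s / maxPath o s * maxEdge s = maxEdge s' / maxPath o s' * s' e by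
          rw [← hmul, he]]
        exact mul_le_mul_of_nonneg_left ((le_maxEdge s' e).trans hmax.ge) hp'.le
      · rw [show maxEdge s' / maxPath o s' * maxEdge s = maxEdge s / maxPath o s * s e' by
          rw [hmul, he', hmax]]
        exact mul_le_mul_of_nonneg_left (le_maxEdge s e') hp.le
    funext e
    have := hmul e
    rw [hc] at this
    exact mul_left_cancel₀ hp'.ne' this

omit hV in
lemma pathLength_smul (c : ℝ) (s : Finset α → ℝ) (v : Finset α) :
    pathLength o (fun e => c * s e) v = c * pathLength o s v := by
  rw [pathLength, pathLength, Finset.mul_sum]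
  exact Finset.sum_congr rfl fun e _ => by split_ifs <;> simp

/-- Each inner edge gets the absolute difference of the numbers at its two ends. By admissibility
its sign matches that in `pathLength_covers`, so path length minus `θ` is constant on the tree, and
it is zero at the pearl. -/
lemma exists_pathLength_eq {θ : Finset α → ℝ} (hθ : IsAdm o V θ) :
    ∃ s : Finset α → ℝ, (∀ e, 0 ≤ s e) ∧ (∀ e, s e ≠ 0 → e ∈ V ∧ e ≠ Finset.univ) ∧
      ∀ v ∈ V, pathLength o s v = θ v := by
  classical
  have hex : ∀ e : Finset α, ∃ w, e ∈ V → e ≠ Finset.univ → Covers V e w := fun e => by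
    by_cases h : e ∈ V ∧ e ≠ Finset.univ
    · obtain ⟨w, hw⟩ := hV.exists_covers h.1 h.2
      exact ⟨w, fun _ _ => hw⟩
    · exact ⟨∅, fun h1 h2 => absurd ⟨h1, h2⟩ h⟩
  choose par hpar using hex
  let s : Finset α → ℝ := fun e => if e ∈ V ∧ e ≠ Finset.univ then |θ e - θ (par e)| else 0
  have hs : ∀ e, s e ≠ 0 → e ∈ V ∧ e ≠ Finset.univ := fun e he => by
    by_contra hc; exact he (if_neg hc)
  have hdiff : ∀ v ∈ V, v ≠ Finset.univ →
      pathLength o s v - pathLength o s (par v) = θ v - θ (par v) := by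
    intro v hv hne
    have hc := hpar v hv hne
    rw [pathLength_covers o hV hs hc]
    simp only [s, hv, hne, ne_eq, not_false_eq_true, and_self, if_true]
    split_ifs with ho
    · rw [abs_of_nonpos (sub_nonpos.2 ((hθ.2 v _ hc).1 ho)), neg_neg]
    · rw [abs_of_nonneg (sub_nonneg.2 ((hθ.2 v _ hc).2 ho))]
  -- Descent to the root: the complement of a set shrinks when passing to the vertex below.
  have hconst : ∀ (n : ℕ) (v : Finset α), v ∈ V → vᶜ.card = n →
      pathLength o s v - θ v = pathLength o s Finset.univ - θ Finset.univ := by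
    intro n
    induction n using Nat.strong_induction_on with
    | _ n ih =>
      intro v hv hn
      by_cases hne : v = Finset.univ
      · rw [hne]
      · have hc := hpar v hv hne
        rw [← ih _ ?_ (par v) hc.2.1 rfl]
        · linarith [hdiff v hv hne]
        · rw [← hn]
          exact Finset.card_lt_card (compl_lt_compl_iff_lt.2 hc.2.2.1)
  -- The pearl, as the smallest member containing `o`.
  obtain ⟨p, hp, hmin⟩ := hV.exists_subset_iff (Finset.singleton_nonempty o)
  simp only [Finset.singleton_subset_iff] at hmin
  have hop : o ∈ p := (hmin p hp).2 subset_rfl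
  have hp0 : pathLength o s p = 0 := by
    refine Finset.sum_eq_zero fun e _ => ?_
    by_cases he : s e = 0
    · simp [he]
    · rw [if_pos (hmin e (hs e he).1).symm]
  refine ⟨s, fun e => ?_, hs, fun v hv => ?_⟩
  · dsimp only [s]; split_ifs; exacts [abs_nonneg _, le_rfl]
  · have h1 := hconst _ v hv rfl
    have h2 := hconst _ p hp rfl
    rw [hθ.1 p hp hop fun e he => (hmin e he).1] at h2
    linarith

/-- The lengths `r` whose path lengths are `θ` lie on the right ray; it remains to find the point of
this ray at which the rescaling gives back `θ`. -/
lemma exists_time_eq {θ : Finset α → ℝ} (hθ : IsAdm o V θ)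
    (h01 : ∀ v ∈ V, 0 ≤ θ v ∧ θ v ≤ 1) : ∃ s ∈ edgeCube V, ∀ v ∈ V, time o s v = θ v := by
  obtain ⟨r, hr0, hr, hrθ⟩ := exists_pathLength_eq o hV hθ
  have hr1 : r ∈ edgeCube V := by
    refine ⟨fun e => ⟨hr0 e, ?_⟩, hr⟩
    by_cases he : r e = 0
    · rw [he]; exact zero_le_one
    · obtain ⟨h1, h2⟩ := hr e he
      obtain ⟨w, hw⟩ := hV.exists_covers h1 h2
      have := pathLength_covers o hV hr hw
      rw [hrθ e h1, hrθ w hw.2.1] at this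
      have h3 := h01 e h1
      have h4 := h01 w hw.2.1
      split_ifs at this <;> linarith
  obtain ⟨v₀, hv₀, hmax⟩ := exists_mem_pathLength_eq_maxPath o hV hr1
  have hm1 : maxPath o r ≤ 1 := by rw [← hmax, hrθ v₀ hv₀]; exact (h01 v₀ hv₀).2
  rcases (maxEdge_nonneg hr0).eq_or_lt with h0 | h0
  · have hrz : r = 0 := funext fun e => le_antisymm ((le_maxEdge r e).trans h0.ge) (hr0 e)
    refine ⟨r, hr1, fun v hv => ?_⟩
    rw [← hrθ v hv, time, ← h0, zero_div, zero_mul, hrz]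
    exact (Finset.sum_eq_zero fun e _ => by simp).symm
  · have hm := h0.trans_le (maxEdge_le_maxPath o hV hr1)
    -- With this factor the longest edge of `c * r` is the longest path of `r`, so it cancels the
    -- factor in `time`. It is at most `1` because that path length is one of the given numbers, so
    -- `c * r` stays in the cube.
    set c := maxPath o r / maxEdge r with hc
    have hc0 : 0 < c := div_pos hm h0
    have hmE : maxEdge (fun e => c * r e) = c * maxEdge r := by
      obtain ⟨e, he⟩ := exists_eq_maxEdge r
      obtain ⟨e', he'⟩ := exists_eq_maxEdge fun e => c * r e
      refine le_antisymm ?_ ?_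
      · rw [← he']; exact mul_le_mul_of_nonneg_left (le_maxEdge r e') hc0.le
      · rw [← he]; exact le_maxEdge (fun e => c * r e) e
    have hmP : maxPath o (fun e => c * r e) = c * maxPath o r := by
      obtain ⟨v, hv, h1⟩ := exists_pathLength_eq_maxPath o r
      obtain ⟨v', hv', h1'⟩ := exists_pathLength_eq_maxPath o fun e => c * r e
      refine le_antisymm ?_ ?_
      · rw [← h1', pathLength_smul]
        exact mul_le_mul_of_nonneg_left (pathLength_le_maxPath o r hv') hc0.le
      · rw [← h1, ← pathLength_smul]; exact pathLength_le_maxPath o _ hv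
    have hcm : c * maxEdge r = maxPath o r := div_mul_cancel₀ _ h0.ne'
    refine ⟨fun e => c * r e, ⟨fun e => ⟨mul_nonneg hc0.le (hr0 e), ?_⟩, fun e he => ?_⟩,
      fun v hv => ?_⟩
    · exact (mul_le_mul_of_nonneg_left (le_maxEdge r e) hc0.le).trans (hcm.trans_le hm1)
    · exact hr e (right_ne_zero_of_mul he)
    · rw [time, hmE, hmP, hcm, pathLength_smul, hrθ v hv]
      field_simp

omit hV in
lemma continuous_pathLength (v : Finset α) :
    Continuous fun s : Finset α → ℝ => pathLength o s v :=
  continuous_finsetSum _ fun e _ => by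
    split_ifs
    exacts [continuous_const, continuous_apply e]

omit [DecidableEq α] hV in
lemma continuous_maxEdge : Continuous (maxEdge : (Finset α → ℝ) → ℝ) :=
  Continuous.finset_sup'_apply _ fun e _ => continuous_apply e

omit hV in
lemma continuous_maxPath : Continuous (maxPath o : (Finset α → ℝ) → ℝ) :=
  Continuous.finset_sup'_apply _ fun v _ => continuous_pathLength o v

/-- Only points where the longest path vanishes are problematic. There the longest edge vanishes
too, and `time` is squeezed between `0` and the longest edge at nearby points of the cube. -/
lemma continuousOn_time {v : Finset α} (hv : v.Nonempty) :
    ContinuousOn (fun s : Finset α → ℝ => time o s v) (edgeCube V) := by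
  intro s hs
  by_cases h : maxPath o s = 0
  · have hE : maxEdge s = 0 := le_antisymm ((maxEdge_le_maxPath o hV hs).trans h.le)
      (maxEdge_nonneg fun e => (hs.1 e).1)
    have h1 : time o s v = 0 := by rw [time, h, div_zero, zero_mul]
    have h2 : Filter.Tendsto (maxEdge : (Finset α → ℝ) → ℝ) (nhdsWithin s (edgeCube V))
        (nhds 0) := by
      rw [← hE]; exact continuous_maxEdge.continuousWithinAt
    rw [ContinuousWithinAt, h1]
    refine tendsto_of_tendsto_of_tendsto_of_le_of_le' tendsto_const_nhds h2 ?_ ?_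
    · filter_upwards [self_mem_nhdsWithin] with r hr
      exact time_nonneg o (fun e => (hr.1 e).1) v
    · filter_upwards [self_mem_nhdsWithin] with r hr
      exact time_le_maxEdge o (fun e => (hr.1 e).1) hv
  · exact (((continuous_maxEdge.continuousAt).div (continuous_maxPath o).continuousAt h).mul
      (continuous_pathLength o v).continuousAt).continuousWithinAt

end cube

end laminar

/-! ### Realizations of finite posets -/

namespace Realization

section

variable {P : Type*} [PartialOrder P] {Q : Type*} [PartialOrder Q]

lemma continuous_simplex {n : ℕ} (p : Fin (n + 1) →o P) : Continuous (simplex p) :=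
  (continuous_coinduced_rng (f := fun s : Σ c : (Σ n : ℕ, Fin (n + 1) →o P),
    stdSimplex ℝ (Fin (c.1 + 1)) => simplex s.1.2 s.2)).comp
    (continuous_sigmaMk (σ := fun c : (Σ n : ℕ, Fin (n + 1) →o P) =>
      stdSimplex ℝ (Fin (c.1 + 1))) (i := ⟨n, p⟩))

lemma continuous_of_simplex {Y : Type*} [TopologicalSpace Y] {f : Realization P → Y}
    (h : ∀ (n : ℕ) (p : Fin (n + 1) →o P), Continuous fun x => f (simplex p x)) :
    Continuous f :=
  continuous_coinduced_dom.2 (continuous_sigma fun c => h c.1 c.2)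

lemma support_nonempty (x : Realization P) : x.1.support.Nonempty := by
  by_contra h
  rw [Finset.not_nonempty_iff_eq_empty, Finsupp.support_eq_empty] at h
  have := x.2.2.1
  rw [h, Finsupp.sum_zero_index] at this
  exact zero_ne_one this

/-- The support, a finite chain, is listed in increasing order. The bound on the dimension by the
size of the support is what makes finitely many simplices suffice when `P` is finite. -/
lemma exists_simplex (x : Realization P) :
    ∃ (n : ℕ) (p : Fin (n + 1) →o P) (y : stdSimplex ℝ (Fin (n + 1))),
      n + 1 = x.1.support.card ∧ simplex p y = x := by
  classical
  obtain ⟨n, hn⟩ : ∃ n, x.1.support.card = n + 1 :=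
    ⟨_, (Nat.succ_pred_eq_of_pos (Finset.card_pos.2 x.support_nonempty)).symm⟩
  let _ : LinearOrder x.1.support :=
    { (inferInstance : PartialOrder x.1.support) with
      le_total := fun a b => x.2.2.2.total a.2 b.2
      toDecidableLE := Classical.decRel _ }
  let e : Fin (n + 1) ≃o x.1.support := monoEquivOfFin _ (by simpa using hn)
  have hsum : ∀ {A : Type} [AddCommMonoid A] (g : P → A),
      ∑ i, g (e i) = ∑ q ∈ x.1.support, g q := by
    intro A _ g
    rw [← Finset.sum_coe_sort x.1.support g]
    exact e.toEquiv.sum_comp fun q => g q.1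
  have hfs : ∑ i, Finsupp.single (e i).1 (x.1 (e i)) = x.1 := by
    conv_rhs => rw [← Finsupp.sum_single x.1]
    rw [Finsupp.sum, ← Finset.sum_coe_sort x.1.support]
    exact e.toEquiv.sum_comp fun q => Finsupp.single q.1 (x.1 q.1)
  exact ⟨n, ⟨fun i => (e i).1, fun i j h => e.monotone h⟩,
    ⟨fun i => x.1 (e i), fun i => x.2.1 _, (hsum fun q => x.1 q).trans x.2.2.1⟩, hn.symm,
    Subtype.ext hfs⟩

instance [Finite P] : CompactSpace (Realization P) := by
  classical
  cases nonempty_fintype P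
  have hfin : ∀ n, Finite (Fin (n + 1) →o P) := fun n =>
    Finite.of_injective _ DFunLike.coe_injective
  have h : (Set.univ : Set (Realization P)) ⊆
      ⋃ c : (Σ n : Fin (Fintype.card P), Fin (n + 1) →o P), Set.range (simplex c.2) := by
    intro x _
    obtain ⟨n, p, y, hn, hx⟩ := x.exists_simplex
    have : n < Fintype.card P := by
      have := Finset.card_le_univ x.1.support
      omega
    exact Set.mem_iUnion.2 ⟨⟨⟨n, this⟩, p⟩, y, hx⟩
  have hc : IsCompact (⋃ c : (Σ n : Fin (Fintype.card P), Fin (n + 1) →o P),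
      Set.range (simplex c.2)) :=
    isCompact_iUnion fun c => isCompact_range (continuous_simplex c.2)
  exact ⟨(Set.univ_subset_iff.1 h) ▸ hc⟩

lemma simplex_apply [DecidableEq P] {n : ℕ} (p : Fin (n + 1) →o P)
    (x : stdSimplex ℝ (Fin (n + 1))) (q : P) :
    (simplex p x).1 q = ∑ i, if p i = q then x.1 i else 0 := by
  simp only [simplex, Finsupp.finsetSum_apply, Finsupp.single_apply]

lemma continuous_coeff (q : P) : Continuous fun x : Realization P => x.1 q := by
  classical
  refine continuous_of_simplex fun n p => ?_
  simp only [simplex_apply]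
  refine continuous_finsetSum _ fun i _ => ?_
  split_ifs
  exacts [(continuous_apply i).comp continuous_subtype_val, continuous_const]

instance : T2Space (Realization P) :=
  T2Space.of_injective_continuous (f := fun x : Realization P => fun q => x.1 q)
    (fun _ _ h => Subtype.ext (Finsupp.ext (congrFun h)))
    (continuous_pi fun q => continuous_coeff q)

lemma map_simplex (f : P →o Q) {n : ℕ} (p : Fin (n + 1) →o P)
    (x : stdSimplex ℝ (Fin (n + 1))) : (simplex p x).map f = simplex (f.comp p) x := by
  refine Subtype.ext ?_
  simp only [map, simplex, Finsupp.mapDomain_finsetSum, Finsupp.mapDomain_single]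
  rfl

lemma continuous_map (f : P →o Q) : Continuous (map f) :=
  continuous_of_simplex fun _ p => by
    simp only [map_simplex]; exact continuous_simplex _

lemma map_injective (f : P →o Q) (hf : Function.Injective f) : Function.Injective (map f) :=
  fun _ _ h => Subtype.ext (Finsupp.mapDomain_injective hf (congrArg Subtype.val h))

lemma map_apply_ne_zero (f : P →o Q) (hf : Function.Injective f) (x : Realization P) (q : Q) :
    (x.map f).1 q ≠ 0 ↔ ∃ p, f p = q ∧ x.1 p ≠ 0 := by
  constructor
  · intro h
    by_contra hc
    push Not at hc
    by_cases hq : q ∈ Set.range f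
    · obtain ⟨p, rfl⟩ := hq
      exact h ((Finsupp.mapDomain_apply hf x.1 p).trans (hc p rfl))
    · exact h (Finsupp.mapDomain_of_notMem_range x.1 q hq)
  · rintro ⟨p, rfl, hp⟩
    exact (Finsupp.mapDomain_apply hf x.1 p).trans_ne hp

/-- As `f` reflects the order, it is injective and a chain in its range pulls back to a chain. -/
lemma exists_map_eq (f : P →o Q) (hf : ∀ p q, f p ≤ f q → p ≤ q) (x : Realization Q)
    (hx : ∀ q, x.1 q ≠ 0 → q ∈ Set.range f) : ∃ y : Realization P, y.map f = x := by
  have hinj : Function.Injective f := fun p q h => le_antisymm (hf _ _ h.le) (hf _ _ h.ge)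
  have hmap : (x.1.comapDomain f hinj.injOn).mapDomain f = x.1 :=
    Finsupp.mapDomain_comapDomain f hinj x.1 fun q hq =>
      hx q (Finsupp.mem_support_iff.1 (Finset.mem_coe.1 hq))
  refine ⟨⟨x.1.comapDomain f hinj.injOn, fun p => x.2.1 _, ?_, ?_⟩, Subtype.ext hmap⟩
  · have := x.2.2.1
    rw [← hmap, Finsupp.sum_mapDomain_index (fun _ => rfl) (fun _ _ _ => rfl)] at this
    exact this
  · intro p hp q hq hpq
    have hp' : f p ∈ (x.1.support : Set Q) := by simpa using hp
    have hq' : f q ∈ (x.1.support : Set Q) := by simpa using hq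
    exact (x.2.2.2.total hp' hq').imp (hf _ _) (hf _ _)

end

/-! ### Cubical coordinates on the realization of a lattice of subsets -/

section weight

variable {P : Type*} [PartialOrder P] {Q : Type*} [PartialOrder Q] {γ : Type*} [DecidableEq γ]

/-- The total weight of the vertices `p` with `e ∈ W p`. -/
noncomputable def weight (W : P → Finset γ) (x : Realization P) (e : γ) : ℝ :=
  x.1.sum fun p r => if e ∈ W p then r else 0

lemma weight_map (f : P →o Q) (W : Q → Finset γ) (x : Realization P) (e : γ) :
    weight W (x.map f) e = weight (fun p => W (f p)) x e := by
  refine Finsupp.sum_mapDomain_index (fun _ => by simp) fun _ _ _ => ?_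
  split_ifs <;> simp

lemma continuous_weight (W : P → Finset γ) (e : γ) :
    Continuous fun x : Realization P => weight W x e := by
  classical
  refine continuous_of_simplex fun n p => ?_
  have : ∀ x : stdSimplex ℝ (Fin (n + 1)),
      weight W (simplex p x) e = ∑ i, if e ∈ W (p i) then x.1 i else 0 := by
    intro x
    rw [weight, simplex, ← Finsupp.sum_finsetSum_index (fun _ => by simp)
      (fun _ _ _ => by split_ifs <;> simp)]
    exact Finset.sum_congr rfl fun i _ => Finsupp.sum_single_index (by simp)
  simp only [this]
  refine continuous_finsetSum _ fun i _ => ?_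
  split_ifs
  exacts [(continuous_apply i).comp continuous_subtype_val, continuous_const]

lemma weight_nonneg (W : P → Finset γ) (x : Realization P) (e : γ) : 0 ≤ weight W x e :=
  Finset.sum_nonneg fun p _ => by dsimp only; split_ifs; exacts [x.2.1 p, le_rfl]

lemma weight_le_one (W : P → Finset γ) (x : Realization P) (e : γ) : weight W x e ≤ 1 := by
  rw [← x.2.2.1]
  exact Finset.sum_le_sum fun p _ => by dsimp only; split_ifs; exacts [le_rfl, x.2.1 p]

lemma exists_of_weight_ne_zero {W : P → Finset γ} {x : Realization P} {e : γ}
    (h : weight W x e ≠ 0) : ∃ p, x.1 p ≠ 0 ∧ e ∈ W p := by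
  obtain ⟨p, hp, hp'⟩ := Finset.exists_ne_zero_of_sum_ne_zero h
  dsimp only at hp'
  by_cases he : e ∈ W p
  · exact ⟨p, Finsupp.mem_support_iff.1 hp, he⟩
  · exact absurd (if_neg he) hp'

lemma mem_of_weight_eq_one {W : P → Finset γ} {x : Realization P} {e : γ}
    (h : weight W x e = 1) {p : P} (hp : x.1 p ≠ 0) : e ∈ W p := by
  by_contra he
  have : weight W x e < 1 := by
    rw [← x.2.2.1]
    refine Finset.sum_lt_sum (fun q _ => ?_) ⟨p, Finsupp.mem_support_iff.2 hp, ?_⟩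
    · dsimp only; split_ifs; exacts [le_rfl, x.2.1 q]
    · simpa only [he, if_false] using lt_of_le_of_ne (x.2.1 p) hp.symm
  exact this.ne h

lemma weight_eq_one {W : P → Finset γ} {x : Realization P} {e : γ}
    (h : ∀ p, x.1 p ≠ 0 → e ∈ W p) : weight W x e = 1 := by
  rw [← x.2.2.1]
  exact Finset.sum_congr rfl fun p hp => if_pos (h p (Finsupp.mem_support_iff.1 hp))

variable {W : P → Finset γ} (hW : ∀ p q, p ≤ q ↔ W q ⊆ W p)
include hW

/-- Along the chain supporting a point, membership of a suitable element of `G` decides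
whether `G` is contained. -/
lemma exists_mem_forall_subset (x : Realization P) {G : Finset γ} (hG : G.Nonempty) :
    ∃ e ∈ G, ∀ p, x.1 p ≠ 0 → e ∈ W p → G ⊆ W p := by
  classical
  by_cases h : (x.1.support.filter fun p => ¬ G ⊆ W p).Nonempty
  · obtain ⟨q, hq, hmax⟩ := Finset.exists_max_image _ (fun p => (W p).card) h
    rw [Finset.mem_filter] at hq
    obtain ⟨e, he, heq⟩ := Finset.not_subset.1 hq.2
    refine ⟨e, he, fun p hp hep => ?_⟩
    by_contra hc
    have hp' := Finsupp.mem_support_iff.2 hp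
    have hcard := hmax p (Finset.mem_filter.2 ⟨hp', hc⟩)
    rcases x.2.2.2.total (Finset.mem_coe.2 hp') (Finset.mem_coe.2 hq.1) with h1 | h1
    · exact heq (Finset.eq_of_subset_of_card_le ((hW _ _).1 h1) hcard ▸ hep)
    · exact heq ((hW _ _).1 h1 hep)
  · obtain ⟨e, he⟩ := hG
    refine ⟨e, he, fun p hp _ => ?_⟩
    by_contra hc
    exact h ⟨p, Finset.mem_filter.2 ⟨Finsupp.mem_support_iff.2 hp, hc⟩⟩

/-- Along a chain the weight of the vertices `p` with `G ⊆ W p` is the minimum of the weights of the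
elements of `G`: it is at most each of them, and equality holds for the element from
`exists_mem_forall_subset`. So it depends only on the cubical coordinates. -/
lemma sum_superset_le {x y : Realization P} (h : ∀ e, weight W x e = weight W y e)
    (G : Finset γ) : (x.1.sum fun p r => if G ⊆ W p then r else 0) ≤
      y.1.sum fun p r => if G ⊆ W p then r else 0 := by
  rcases G.eq_empty_or_nonempty with rfl | hG
  · simp only [Finset.empty_subset, if_true]
    rw [x.2.2.1, y.2.2.1]
  · obtain ⟨e, he, hy⟩ := exists_mem_forall_subset hW y hG
    calc (x.1.sum fun p r => if G ⊆ W p then r else 0) ≤ weight W x e := by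
          refine Finset.sum_le_sum fun p _ => ?_
          have := x.2.1 p
          dsimp only
          split_ifs with h1 h2 h2
          exacts [le_rfl, absurd (h1 he) h2, this, le_rfl]
      _ = weight W y e := h e
      _ = _ := by
          refine Finset.sum_congr rfl fun p hp => ?_
          have h1 := hy p (Finsupp.mem_support_iff.1 hp)
          dsimp only
          split_ifs with h2 h3 h3
          exacts [rfl, absurd (h1 h2) h3, absurd (h3 he) h2, rfl]

/-- The cubical coordinates determine the sums over `{p | G ⊆ W p}` for all `G`. If two points with
equal sums differed, take `q` with `W q` as large as possible among the vertices where they differ,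
and `G = W q`: all other terms agree, hence so do the coefficients at `q`. -/
lemma weight_injective : Function.Injective (weight W) := by
  classical
  intro x y h
  have hsum : ∀ G : Finset γ, (x.1.sum fun p r => if G ⊆ W p then r else 0) =
      y.1.sum fun p r => if G ⊆ W p then r else 0 := fun G =>
    le_antisymm (sum_superset_le hW (congrFun h) G)
      (sum_superset_le hW (fun e => (congrFun h e).symm) G)
  have hinj : Function.Injective W := fun p q h =>
    le_antisymm ((hW p q).2 h.ge) ((hW q p).2 h.le)
  by_contra hne
  have : ((x.1.support ∪ y.1.support).filter fun p => x.1 p ≠ y.1 p).Nonempty := by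
    by_contra hc
    rw [Finset.not_nonempty_iff_eq_empty, Finset.filter_eq_empty_iff] at hc
    refine hne (Subtype.ext (Finsupp.ext fun p => ?_))
    by_contra hp
    refine hc (x := p) ?_ hp
    rw [Finset.mem_union, Finsupp.mem_support_iff, Finsupp.mem_support_iff]
    by_contra h0
    push Not at h0
    exact hp (h0.1.trans h0.2.symm)
  obtain ⟨q, hq, hmax⟩ := Finset.exists_max_image _ (fun p => (W p).card) this
  rw [Finset.mem_filter] at hq
  have h1 := hsum (W q)
  rw [Finsupp.sum_of_support_subset x.1 Finset.subset_union_left (g := fun p r =>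
      if W q ⊆ W p then r else 0) (fun _ _ => by simp),
    Finsupp.sum_of_support_subset y.1 Finset.subset_union_right (g := fun p r =>
      if W q ⊆ W p then r else 0) (fun _ _ => by simp),
    ← Finset.add_sum_erase _ _ hq.1, ← Finset.add_sum_erase _ _ hq.1,
    Finset.sum_congr rfl (g := fun p => if W q ⊆ W p then y.1 p else 0)] at h1
  · simp only [subset_rfl, if_true, add_left_inj] at h1
    exact hq.2 h1
  · intro p hp
    rw [Finset.mem_erase] at hp
    split_ifs with hs
    · by_contra hc
      have hcard := hmax p (Finset.mem_filter.2 ⟨hp.2, hc⟩)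
      exact hp.1 (hinj (Finset.eq_of_subset_of_card_le hs hcard).symm)
    · rfl

/-- Peeling off layers, with the total mass `M` as a parameter of the induction. The smallest
positive coordinate becomes the coefficient of the vertex whose set is the whole support `S` of `s`;
subtracting it leaves smaller support and mass. When no coordinate is left, the remaining mass goes
to the vertex with the empty set. The clause `W p ⊆ S` keeps the support of the result a chain. -/
lemma exists_sum_eq (E : Finset γ) (hE : ∀ F ⊆ E, ∃ p, W p = F) (n : ℕ) :
    ∀ (s : γ → ℝ) (M : ℝ) (S : Finset γ), S ⊆ E → S.card = n → (∀ e, s e ≠ 0 ↔ e ∈ S) →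
      (∀ e, 0 ≤ s e ∧ s e ≤ M) → 0 ≤ M → ∃ x : P →₀ ℝ, (∀ p, 0 ≤ x p) ∧
        (x.sum fun _ r => r) = M ∧ IsChain (· ≤ ·) (x.support : Set P) ∧
        (∀ p, x p ≠ 0 → W p ⊆ S) ∧ ∀ e, (x.sum fun p r => if e ∈ W p then r else 0) = s e := by
  classical
  induction n using Nat.strong_induction_on with
  | _ n ih =>
    intro s M S hSE hn hS hs hM
    obtain ⟨p, hp⟩ := hE S hSE
    rcases S.eq_empty_or_nonempty with rfl | hne
    · refine ⟨Finsupp.single p M, fun q => ?_, Finsupp.sum_single_index rfl, ?_, fun q hq => ?_,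
        fun e => ?_⟩
      · rw [Finsupp.single_apply]; split_ifs; exacts [hM, le_rfl]
      · exact (Set.subsingleton_singleton.anti fun q hq => Finset.mem_singleton.1
          (Finsupp.support_single_subset (Finset.mem_coe.1 hq)) : Set.Subsingleton _).isChain
      · rw [Finsupp.single_apply] at hq
        by_cases h : p = q
        · rw [← h, hp]
        · rw [if_neg h] at hq; exact absurd rfl hq
      · rw [Finsupp.sum_single_index (by simp), hp]
        have : s e = 0 := by_contra fun h => by simpa using (hS e).1 h
        simp [this]
    · obtain ⟨e₀, he₀, hmin⟩ := Finset.exists_min_image S s hne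
      have hm : 0 < s e₀ := lt_of_le_of_ne (hs e₀).1 ((hS e₀).2 he₀).symm
      have hsub : S.filter (fun e => s e ≠ s e₀) ⊂ S := by
        refine (Finset.ssubset_iff_of_subset (Finset.filter_subset _ _)).2 ⟨e₀, he₀, by simp⟩
      obtain ⟨x, hx0, hxM, hxc, hxS, hxs⟩ := ih _ (hn ▸ Finset.card_lt_card hsub)
        (fun e => if e ∈ S then s e - s e₀ else 0) (M - s e₀) (S.filter fun e => s e ≠ s e₀)
        (hsub.1.trans hSE) rfl (fun e => by by_cases h : e ∈ S <;> simp [h, sub_eq_zero])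
        (fun e => by
          have h2 := (hs e).2
          have h3 := (hs e₀).2
          by_cases h : e ∈ S
          · have h1 := hmin e h
            simp only [h, if_true]; constructor <;> linarith
          · simp only [h, if_false]; exact ⟨le_rfl, by linarith⟩)
        (by linarith [(hs e₀).2])
      refine ⟨x + Finsupp.single p (s e₀), fun q => ?_, ?_, ?_, fun q hq => ?_, fun e => ?_⟩
      · rw [Finsupp.add_apply, Finsupp.single_apply]
        have := hx0 q
        split_ifs <;> linarith
      · rw [Finsupp.sum_add_index' (fun _ => rfl) (fun _ _ _ => rfl), hxM,
          Finsupp.sum_single_index rfl]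
        ring
      · refine (hxc.insert (a := p) fun q hq _ => ?_).mono ?_
        · left
          rw [hW, hp]
          exact (hxS q (Finsupp.mem_support_iff.1 hq)).trans hsub.1
        · intro q hq
          rcases Finset.mem_union.1 (Finsupp.support_add hq) with h | h
          · exact .inr h
          · exact .inl (Finset.mem_singleton.1 (Finsupp.support_single_subset h))
      · by_cases hqp : p = q
        · rw [← hqp, hp]
        · rw [Finsupp.add_apply, Finsupp.single_apply, if_neg hqp, add_zero] at hq
          exact (hxS q hq).trans hsub.1
      · rw [Finsupp.sum_add_index' (fun _ => by simp) (fun _ _ _ => by split_ifs <;> simp), hxs,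
          Finsupp.sum_single_index (by simp), hp]
        by_cases h : e ∈ S
        · simp [h]
        · have : s e = 0 := by_contra fun h' => h ((hS e).1 h')
          simp [h, this]

lemma exists_weight_eq {E : Finset γ} (hE : ∀ F ⊆ E, ∃ p, W p = F) {s : γ → ℝ}
    (hs : ∀ e, 0 ≤ s e ∧ s e ≤ 1) (hsE : ∀ e, s e ≠ 0 → e ∈ E) : ∃ x, weight W x = s := by
  classical
  obtain ⟨x, h1, h2, h3, -, h4⟩ := exists_sum_eq hW E hE _ s 1 (E.filter fun e => s e ≠ 0)
    (Finset.filter_subset _ _) rfl (fun e => by simpa using hsE e) hs zero_le_one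
  exact ⟨⟨x, h1, h2, h3⟩, funext h4⟩

end weight

end Realization

/-! ### Homotopy colimits over subsets of posets -/

/-- In the `k`-ified product closedness is tested on pairs of maps from compact Hausdorff spaces. -/
lemma isClosed_kprod {X : Type v} {Y : Type u} [TopologicalSpace X] [TopologicalSpace Y]
    {A : Set (KProd X Y)}
    (h : ∀ (K : Type u) [TopologicalSpace K] [CompactSpace K] [T2Space K] (f : K → X)
      (g : K → Y), Continuous f → Continuous g →
        IsClosed {s : K | ((f s, g s) : KProd X Y) ∈ A}) : IsClosed A := by
  refine isClosed_coinduced.2 (isClosed_sigma_iff.2 fun i => ?_)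
  exact h i.1 (fun s => (i.2 s).1) (fun s => (i.2 s).2) (continuous_fst.comp i.2.2)
    (continuous_snd.comp i.2.2)

section hocolim

universe w

variable {P : Type w} [PartialOrder P]

/-- The inclusion of an under-poset. -/
def iciVal (c : P) : Set.Ici c →o P where
  toFun x := x.1
  monotone' _ _ h := h

lemma Realization.exists_least {Q : Type*} [PartialOrder Q] (x : Realization Q) :
    ∃ d, x.1 d ≠ 0 ∧ ∀ q, x.1 q ≠ 0 → d ≤ q := by
  obtain ⟨d, hd⟩ := x.1.support.exists_minimal x.support_nonempty
  refine ⟨d, Finsupp.mem_support_iff.1 hd.1, fun q hq => ?_⟩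
  have hq' := Finsupp.mem_support_iff.2 hq
  rcases x.2.2.2.total (Finset.mem_coe.2 hd.1) (Finset.mem_coe.2 hq') with h | h
  · exact h
  · exact hd.2 hq' h

lemma exists_least_ici {c : P} (x : Realization (Set.Ici c)) :
    ∃ (d : P) (h : c ≤ d), x.1 ⟨d, h⟩ ≠ 0 ∧ ∀ q, x.1 q ≠ 0 → d ≤ q.1 := by
  obtain ⟨⟨d, h⟩, h1, h2⟩ := x.exists_least
  exact ⟨d, h, h1, h2⟩

lemma iciIncl_injective {c d : P} (h : c ≤ d) : Function.Injective (iciIncl h) :=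
  fun _ _ h => by
    have h1 := congrArg Subtype.val h
    exact Subtype.ext h1

lemma exists_map_iciIncl {c d : P} (h : c ≤ d) (x : Realization (Set.Ici c))
    (hx : ∀ q, x.1 q ≠ 0 → d ≤ q.1) : ∃ y : Realization (Set.Ici d), y.map (iciIncl h) = x :=
  Realization.exists_map_eq _ (fun _ _ h => h) x fun q hq => ⟨⟨q.1, hx q hq⟩, rfl⟩

lemma map_iciVal_injective (c : P) : Function.Injective (Realization.map (iciVal c)) :=
  Realization.map_injective _ Subtype.val_injective

/-! ### Equality of points of a homotopy colimit, and the image of a subset -/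

variable (F : P ⥤ TopCat.{u})

/-- The point of the homotopy colimit represented by a pair. -/
def hocolim.mk (c : P) (x : Realization (Set.Ici c)) (a : F.obj c) : hocolim F :=
  Quot.mk _ ⟨c, x, a⟩

variable {F}

lemma hocolim.glue {c c' : P} (h : c ≤ c') (x : Realization (Set.Ici c')) (a : F.obj c) :
    hocolim.mk F c (x.map (iciIncl h)) a = hocolim.mk F c' x (F.map (homOfLE h) a) :=
  Quot.sound (.glue h x a)

lemma hocolim.ind {p : hocolim F → Prop} (h : ∀ c x a, p (hocolim.mk F c x a))
    (z : hocolim F) : p z :=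
  Quot.ind (fun y => h y.1 y.2.1 y.2.2) z

lemma hocolimIncl_mk (S : Set P) (c : S) (x : Realization (Set.Ici c))
    (a : (restrict F S).obj c) : hocolimIncl F S (hocolim.mk (restrict F S) c x a) =
      hocolim.mk F c.1 (x.map (subIcl S c)) a := rfl

lemma functor_map_trans {c d e : P} (h : c ≤ d) (h' : d ≤ e) (a : F.obj c) :
    F.map (homOfLE h') (F.map (homOfLE h) a) = F.map (homOfLE (h.trans h')) a := by
  rw [← homOfLE_comp h h', F.map_comp]
  rfl

/-- A point over `c` can be pushed to the least vertex `d` of its support. The representative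
obtained there depends only on the point of the realization of `P` and on the image of the label at
`d`. -/
lemma hocolim.mk_eq_of {c c' : P} {x : Realization (Set.Ici c)} {x' : Realization (Set.Ici c')}
    {a : F.obj c} {a' : F.obj c'} (hx : x.map (iciVal c) = x'.map (iciVal c'))
    (ha : ∀ (d : P) (h : c ≤ d) (h' : c' ≤ d), x.1 ⟨d, h⟩ ≠ 0 →
      F.map (homOfLE h) a = F.map (homOfLE h') a') : hocolim.mk F c x a = hocolim.mk F c' x' a' := by
  obtain ⟨d, hd, hd0, hmin⟩ := exists_least_ici x
  have hsupp : ∀ q, x'.1 q ≠ 0 → d ≤ q.1 := by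
    intro q hq
    have := (Realization.map_apply_ne_zero (iciVal c') Subtype.val_injective x' q.1).2 ⟨q, rfl, hq⟩
    rw [← hx, Realization.map_apply_ne_zero _ Subtype.val_injective] at this
    obtain ⟨p, hp, hp0⟩ := this
    rw [← show p.1 = q.1 from hp]
    exact hmin p hp0
  have hd' : c' ≤ d := by
    have := (Realization.map_apply_ne_zero (iciVal c) Subtype.val_injective x d).2 ⟨_, rfl, hd0⟩
    rw [hx, Realization.map_apply_ne_zero _ Subtype.val_injective] at this
    obtain ⟨p, hp, -⟩ := this
    rw [← show p.1 = d from hp]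
    exact p.2
  obtain ⟨y, rfl⟩ := exists_map_iciIncl hd x fun q hq => hmin q hq
  obtain ⟨y', rfl⟩ := exists_map_iciIncl hd' x' hsupp
  rw [hocolim.glue, hocolim.glue, ha d hd hd' hd0]
  congr 1
  rw [Realization.map_map, Realization.map_map] at hx
  exact map_iciVal_injective d hx

/-- The image in the realization of `P` and the images of the label at the vertices of the support
are invariants of the gluing relation. For transitivity, each vertex of the common support is also
above the middle index. -/
lemma hocolim.of_mk_eq {c c' : P} {x : Realization (Set.Ici c)} {x' : Realization (Set.Ici c')}
    {a : F.obj c} {a' : F.obj c'} (h : hocolim.mk F c x a = hocolim.mk F c' x' a') :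
    x.map (iciVal c) = x'.map (iciVal c') ∧ ∀ (d : P) (h : c ≤ d) (h' : c' ≤ d),
      x.1 ⟨d, h⟩ ≠ 0 → F.map (homOfLE h) a = F.map (homOfLE h') a' := by
  let R : (Σ c : P, KProd (Realization (Set.Ici c)) (F.obj c)) →
      (Σ c : P, KProd (Realization (Set.Ici c)) (F.obj c)) → Prop := fun p q =>
    p.2.1.map (iciVal p.1) = q.2.1.map (iciVal q.1) ∧ ∀ (d : P) (h : p.1 ≤ d) (h' : q.1 ≤ d),
      (p.2.1.map (iciVal p.1)).1 d ≠ 0 → F.map (homOfLE h) p.2.2 = F.map (homOfLE h') q.2.2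
  have hR : ∀ p q, Relation.EqvGen (HocolimRel F) p q → R p q := by
    intro p q hpq
    induction hpq with
    | rel p q hpq =>
      cases hpq with
      | glue h x a =>
        refine ⟨Realization.map_map _ _ _, fun d h1 h2 _ => ?_⟩
        exact (functor_map_trans h h2 a).symm
    | refl p => exact ⟨rfl, fun _ _ _ _ => rfl⟩
    | symm p q _ ih =>
      refine ⟨ih.1.symm, fun d h h' hd => (ih.2 d h' h ?_).symm⟩
      rw [ih.1]; exact hd
    | trans p q r _ _ ih1 ih2 =>
      refine ⟨ih1.1.trans ih2.1, fun d h h' hd => ?_⟩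
      have hd' := hd
      rw [ih1.1] at hd'
      obtain ⟨e, he, -⟩ := (Realization.map_apply_ne_zero (iciVal q.1)
        Subtype.val_injective q.2.1 d).1 hd'
      have hqd : q.1 ≤ d := he ▸ e.2
      exact (ih1.2 d h hqd hd).trans (ih2.2 d hqd h' hd')
  obtain ⟨h1, h2⟩ := hR _ _ (Quot.eqvGen_exact h)
  exact ⟨h1, fun d h h' hd => h2 d h h'
    ((Realization.map_apply_ne_zero (iciVal c) Subtype.val_injective x d).2 ⟨_, rfl, hd⟩)⟩

lemma subIcl_injective (S : Set P) (c : S) : Function.Injective (subIcl S c) :=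
  fun _ _ h => by
    have h1 := congrArg Subtype.val h
    exact Subtype.ext (Subtype.ext h1)

/-- The inclusion of an under-poset in a subset. -/
def subIciVal (S : Set P) (c : S) : Set.Ici c →o P where
  toFun x := x.1.1
  monotone' _ _ h := h

lemma subIciVal_injective (S : Set P) (c : S) : Function.Injective (subIciVal S c) :=
  fun _ _ h => Subtype.ext (Subtype.ext h)

/-- The invariants that separate points are preserved: a subset `S` has an injective map of
realizations into that of `P`, and the diagram is merely restricted. -/
lemma hocolimIncl_injective (S : Set P) : Function.Injective (hocolimIncl F S) := by
  intro p q
  induction p using hocolim.ind with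
  | h c x a =>
  induction q using hocolim.ind with
  | h c' x' a' =>
  intro h
  rw [hocolimIncl_mk, hocolimIncl_mk] at h
  obtain ⟨h1, h2⟩ := hocolim.of_mk_eq h
  rw [Realization.map_map, Realization.map_map] at h1
  refine hocolim.mk_eq_of ?_ fun d h h' hd => h2 d.1 h h' ?_
  · let v : S →o P := ⟨Subtype.val, fun _ _ h => h⟩
    refine Realization.map_injective v Subtype.val_injective ?_
    rw [Realization.map_map, Realization.map_map]
    exact h1
  · exact (Realization.map_apply_ne_zero _ (subIcl_injective S c) x _).2 ⟨_, rfl, hd⟩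

/-- If the support lies in `S`, its least vertex does so too, and pushing to that vertex gives a
representative over `S`. The converse holds as the support is an invariant. -/
lemma mem_range_hocolimIncl (S : Set P) {c : P} {x : Realization (Set.Ici c)} {a : F.obj c} :
    hocolim.mk F c x a ∈ Set.range (hocolimIncl F S) ↔ ∀ q, x.1 q ≠ 0 → q.1 ∈ S := by
  constructor
  · rintro ⟨z, hz⟩ q hq
    induction z using hocolim.ind with
    | h c' x' a' =>
    rw [hocolimIncl_mk] at hz
    have h1 := (hocolim.of_mk_eq hz).1
    rw [Realization.map_map] at h1
    have := (Realization.map_apply_ne_zero (iciVal c) Subtype.val_injective x q.1).2 ⟨q, rfl, hq⟩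
    rw [← h1] at this
    obtain ⟨p, hp, -⟩ :=
      (Realization.map_apply_ne_zero _ (subIciVal_injective S c') x' q.1).1 this
    rw [← hp]
    exact p.1.2
  · intro h
    obtain ⟨d, hd, hd0, hmin⟩ := exists_least_ici x
    obtain ⟨y, rfl⟩ := exists_map_iciIncl hd x fun q hq => hmin q hq
    have hdS : d ∈ S := h ⟨d, hd⟩ hd0
    rw [hocolim.glue]
    obtain ⟨z, rfl⟩ := Realization.exists_map_eq (subIcl S ⟨d, hdS⟩) (fun _ _ h => h) y (by
      intro q hq
      exact ⟨⟨⟨q.1, h ⟨q.1, le_trans hd q.2⟩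
        ((Realization.map_apply_ne_zero (iciIncl hd) (iciIncl_injective hd) y _).2 ⟨q, rfl, hq⟩)⟩, q.2⟩, rfl⟩)
    exact ⟨hocolim.mk (restrict F S) ⟨d, hdS⟩ z (F.map (homOfLE hd) a), rfl⟩

lemma hocolim.continuous_mk (c : P) :
    Continuous fun p : KProd (Realization (Set.Ici c)) (F.obj c) => hocolim.mk F c p.1 p.2 :=
  continuous_quot_mk.comp (continuous_sigmaMk
    (σ := fun c : P => KProd (Realization (Set.Ici c)) (F.obj c)) (i := c))

lemma hocolim.continuous_of {Y : Type*} [TopologicalSpace Y] {f : hocolim F → Y}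
    (h : ∀ c, Continuous fun p : KProd (Realization (Set.Ici c)) (F.obj c) =>
      f (hocolim.mk F c p.1 p.2)) : Continuous f :=
  continuous_coinduced_dom.2 (continuous_sigma h)

lemma kprod_continuous_of {X : Type v} {Y : Type u} [TopologicalSpace X] [TopologicalSpace Y]
    {Z : Type*} [TopologicalSpace Z] {f : KProd X Y → Z}
    (h : ∀ (K : Type u) [TopologicalSpace K] [CompactSpace K] [T2Space K] (g : K → X)
      (g' : K → Y), Continuous g → Continuous g' → Continuous fun s => f (g s, g' s)) :
    Continuous f := by
  refine continuous_coinduced_dom.2 (continuous_sigma fun i => ?_)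
  exact h i.1 (fun s => (i.2 s).1) (fun s => (i.2 s).2) (continuous_fst.comp i.2.2)
    (continuous_snd.comp i.2.2)

lemma KProd.continuous_fst {X : Type v} {Y : Type u} [TopologicalSpace X] [TopologicalSpace Y] :
    Continuous fun p : KProd X Y => p.1 :=
  kprod_continuous_of fun _ _ _ _ _ _ h _ => h

lemma KProd.continuous_snd {X : Type v} {Y : Type u} [TopologicalSpace X] [TopologicalSpace Y] :
    Continuous fun p : KProd X Y => p.2 :=
  kprod_continuous_of fun _ _ _ _ _ _ _ h => h

lemma continuous_hocolimIncl (S : Set P) : Continuous (hocolimIncl F S) := by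
  refine hocolim.continuous_of fun c => kprod_continuous_of fun K _ _ _ g g' hg hg' => ?_
  exact (hocolim.continuous_mk c.1).comp
    (continuous_kprod_mk ((Realization.continuous_map (subIcl S c)).comp hg) hg')

/-- On the piece over `c` the preimage of the image of `A` is a union of sets indexed by the `c' ∈
S` above `c`, by taking the least vertex of the support as `c'`. The under-posets being finite, the
union is finite and the realizations are compact, so each set can be shown to be closed. -/
lemma isClosedMap_hocolimIncl [∀ c : P, Finite (Set.Ici c)] (S : Set P) :
    IsClosedMap (hocolimIncl F S) := by
  have hfin : ∀ c : S, Finite (Set.Ici c) := fun c =>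
    Finite.of_injective (subIcl S c) (subIcl_injective S c)
  intro A hA
  refine isClosed_coinduced.2 (isClosed_sigma_iff.2 fun c => ?_)
  let j : ∀ c' : S, c ≤ c'.1 → (Set.Ici c' →o Set.Ici c) := fun c' h =>
    (iciIncl h).comp (subIcl S c')
  have hj : ∀ c' h, Topology.IsClosedEmbedding (Realization.map (j c' h)) := fun c' h =>
    (Realization.continuous_map _).isClosedEmbedding (Realization.map_injective _
      ((iciIncl_injective h).comp (subIcl_injective S c')))
  let I := {c' : S // c ≤ c'.1}
  have hI : Finite I := Finite.of_injective (fun c' : I => (⟨c'.1.1, c'.2⟩ : Set.Ici c))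
    fun _ _ h => by
      have h1 := congrArg Subtype.val h
      exact Subtype.ext (Subtype.ext h1)
  let B : I → Set (KProd (Realization (Set.Ici c)) (F.obj c)) := fun c' =>
    {p | ∃ y, Realization.map (j c'.1 c'.2) y = p.1 ∧
      hocolim.mk (restrict F S) c'.1 y (F.map (homOfLE c'.2) p.2) ∈ A}
  have hB : {p : KProd (Realization (Set.Ici c)) (F.obj c) |
      hocolim.mk F c p.1 p.2 ∈ hocolimIncl F S '' A} = ⋃ c', B c' := by
    ext p
    rw [Set.mem_iUnion]
    obtain ⟨x, a⟩ := p
    constructor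
    · rintro ⟨z, hz, hzx⟩
      induction z using hocolim.ind with
      | h c'' y b =>
      obtain ⟨h1, h2⟩ := hocolim.of_mk_eq (F := F) (c := c''.1) (x := y.map (subIcl S c''))
        (a := b) (c' := c) (x' := x) (a' := a) hzx
      rw [Realization.map_map] at h1
      obtain ⟨d, hd, hd0, hmin⟩ := exists_least_ici y
      have hcd : c ≤ d.1 := by
        have := (Realization.map_apply_ne_zero (subIciVal S c'') (subIciVal_injective S c'')
          y d.1).2 ⟨_, rfl, hd0⟩
        rw [show y.map (subIciVal S c'') = _ from h1] at this
        obtain ⟨p, hp, -⟩ := (Realization.map_apply_ne_zero _ Subtype.val_injective _ _).1 this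
        rw [← show p.1 = d.1 from hp]
        exact p.2
      obtain ⟨y, rfl⟩ := exists_map_iciIncl hd y fun q hq => hmin q hq
      refine ⟨⟨d, hcd⟩, y, ?_, ?_⟩
      · refine map_iciVal_injective c ?_
        rw [← h1, Realization.map_map, Realization.map_map]
        rfl
      · rw [← h2 d.1 hd hcd ((Realization.map_apply_ne_zero _ (subIcl_injective S c'') _ _).2
          ⟨_, rfl, hd0⟩)]
        rw [hocolim.glue] at hz
        exact hz
    · rintro ⟨c', y, rfl, hA⟩
      refine ⟨_, hA, ?_⟩
      exact (hocolim.glue (F := F) c'.2 (y.map (subIcl S c'.1)) a).symm.trans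
        (congrArg (fun z => hocolim.mk F c z a) (Realization.map_map _ _ _))
  change IsClosed {p : KProd (Realization (Set.Ici c)) (F.obj c) |
      hocolim.mk F c p.1 p.2 ∈ hocolimIncl F S '' A}
  rw [hB]
  -- On a compact test space, the points mapped to the closed subspace `|c' ↓ S|` form a compact
  -- subset. There the preimage of `A` is closed, by continuity of the lifted coordinate, and
  -- closedness persists in the test space.
  refine isClosed_iUnion_of_finite fun c' => isClosed_kprod fun K _ _ _ g g' hg hg' => ?_
  have hK : IsClosed (g ⁻¹' Set.range (Realization.map (j c'.1 c'.2))) :=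
    (hj c'.1 c'.2).isClosed_range.preimage hg
  have : CompactSpace (g ⁻¹' Set.range (Realization.map (j c'.1 c'.2))) :=
    isCompact_iff_compactSpace.1 hK.isCompact
  choose y hy using fun s : g ⁻¹' Set.range (Realization.map (j c'.1 c'.2)) => s.2
  have hyc : Continuous y := (hj c'.1 c'.2).isEmbedding.continuous_iff.2
    ((hg.comp continuous_subtype_val).congr fun s => (hy s).symm)
  have hc : Continuous fun s => hocolim.mk (restrict F S) c'.1 (y s)
      (F.map (homOfLE c'.2) (g' s)) :=
    (hocolim.continuous_mk (F := restrict F S) c'.1).comp (continuous_kprod_mk hyc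
      ((F.map (homOfLE c'.2)).hom.continuous.comp (hg'.comp continuous_subtype_val)))
  convert hK.isClosedMap_subtype_val _ (hA.preimage hc) using 1
  ext s
  constructor
  · rintro ⟨z, hz, hz'⟩
    have hs : s ∈ g ⁻¹' Set.range (Realization.map (j c'.1 c'.2)) := ⟨z, hz⟩
    refine ⟨⟨s, hs⟩, ?_, rfl⟩
    have : z = y ⟨s, hs⟩ := (hj c'.1 c'.2).injective (hz.trans (hy ⟨s, hs⟩).symm)
    rw [Set.mem_preimage, ← this]
    exact hz'
  · rintro ⟨s, hs, rfl⟩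
    exact ⟨y s, hy s, hs⟩

end hocolim

variable {O : TopOperad.{u}} {M : Ibimodule O} {k : ℕ}

/-! ### Trees with numbers as trees with functions on the set of vertices -/

namespace Tr

lemma mem_vertexSets_node {n : ℕ} {a : Lbl O M n} {ch : Fin n → Tr (Lbl O M) k}
    {v : Finset (Option (Fin k))} : v ∈ (node n a ch).vertexSets ↔
      v = (node n a ch).supp ∨ ∃ i, v ∈ (ch i).vertexSets := by
  simp [vertexSets]

lemma supp_mem_vertexSets {D : Tr (Lbl O M) k} {v : Finset (Option (Fin k))}
    (hv : v ∈ D.vertexSets) : D.supp ∈ D.vertexSets := by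
  cases D with
  | leaf i => simp [vertexSets] at hv
  | node n a ch => exact mem_vertexSets_node.2 (.inl rfl)

lemma Ok.index_eq {n : ℕ} {a : Lbl O M n} {ch : Fin n → Tr (Lbl O M) k} (h : (node n a ch).Ok)
    {i j : Fin n} {x : Option (Fin k)} (hi : x ∈ (ch i).supp) (hj : x ∈ (ch j).supp) : i = j := by
  by_contra hij
  exact Finset.disjoint_left.1 (h.disjoint hij) hi hj

lemma Ok.nested {D : Tr (Lbl O M) k} (h : D.Ok) {v w : Finset (Option (Fin k))}
    (hv : v ∈ D.vertexSets) (hw : w ∈ D.vertexSets) {x : Option (Fin k)} (hxv : x ∈ v)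
    (hxw : x ∈ w) : v ⊆ w ∨ w ⊆ v := by
  induction D with
  | leaf i => simp [vertexSets] at hv
  | node n a ch ih =>
    rcases mem_vertexSets_node.1 hv with rfl | ⟨i, hi⟩
    · exact .inr (h.subset_of_mem hw).1
    rcases mem_vertexSets_node.1 hw with rfl | ⟨j, hj⟩
    · exact .inl (h.subset_of_mem hv).1
    obtain rfl := h.index_eq (((h.child i).subset_of_mem hi).1 hxv)
      (((h.child j).subset_of_mem hj).1 hxw)
    exact ih i (h.child i) hi hj

lemma Pearled.laminar {D : Tr (Lbl O M) k} (h : D.Pearled 2) : Laminar D.vertexSets where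
  univ_mem := by
    rw [← h.supp]
    cases D with
    | leaf i => have := h.2 none; simp [count] at this
    | node n a ch => exact mem_vertexSets_node.2 (.inl rfl)
  nonempty v hv := (h.ok.subset_of_mem hv).2
  nested v hv w hw _ hxv hxw := h.ok.nested hv hw hxv hxw

/-- Children have disjoint supports properly contained in that of the root, so covering is decided
inside one child unless the lower vertex is the root. The condition `v ∈ (ch i).vertexSets` excludes
children that are leaves. -/
lemma Ok.covers_node_iff {n : ℕ} {a : Lbl O M n} {ch : Fin n → Tr (Lbl O M) k}
    (h : (node n a ch).Ok) {v w : Finset (Option (Fin k))} :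
    Covers (node n a ch).vertexSets v w ↔ (∃ i, Covers (ch i).vertexSets v w) ∨
      ∃ i, v = (ch i).supp ∧ v ∈ (ch i).vertexSets ∧ w = (node n a ch).supp := by
  constructor
  · rintro ⟨hv, hw, hvw, hc⟩
    have hvS : ∃ i, v ∈ (ch i).vertexSets := (mem_vertexSets_node.1 hv).resolve_left fun e =>
      (e ▸ hvw).2 (h.subset_of_mem hw).1
    obtain ⟨i, hi⟩ := hvS
    obtain ⟨h1, x, hx⟩ := (h.child i).subset_of_mem hi
    rcases mem_vertexSets_node.1 hw with rfl | ⟨j, hj⟩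
    · refine .inr ⟨i, ?_, hi, rfl⟩
      rcases hc _ (mem_vertexSets_node.2 (.inr ⟨i, supp_mem_vertexSets hi⟩)) h1
        (supp_child_subset _ _ _) with h2 | h2
      · exact h2.symm
      · exact absurd h2.ge (h.supp_ssubset i).2
    · obtain rfl := h.index_eq (h1 hx) (((h.child j).subset_of_mem hj).1 (hvw.1 hx))
      exact .inl ⟨i, hi, hj, hvw, fun g hg => hc g (mem_vertexSets_node.2 (.inr ⟨i, hg⟩))⟩
  · rintro (⟨i, hv, hw, hvw, hc⟩ | ⟨i, rfl, hv, rfl⟩)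
    · refine ⟨mem_vertexSets_node.2 (.inr ⟨i, hv⟩), mem_vertexSets_node.2 (.inr ⟨i, hw⟩), hvw,
        fun g hg h1 h2 => hc g ?_ h1 h2⟩
      obtain ⟨h3, x, hx⟩ := (h.child i).subset_of_mem hv
      have h4 := h2.trans ((h.child i).subset_of_mem hw).1
      rcases mem_vertexSets_node.1 hg with rfl | ⟨j, hj⟩
      · exact absurd h4 (h.supp_ssubset i).2
      · obtain rfl := h.index_eq (h3 hx) (((h.child j).subset_of_mem hj).1 (h1 hx))
        exact hj
    · refine ⟨mem_vertexSets_node.2 (.inr ⟨i, hv⟩), mem_vertexSets_node.2 (.inl rfl),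
        h.supp_ssubset i, fun g hg h1 h2 => ?_⟩
      obtain ⟨x, hx⟩ := (h.child i).supp_nonempty
      rcases mem_vertexSets_node.1 hg with rfl | ⟨j, hj⟩
      · exact .inr rfl
      · obtain rfl := h.index_eq hx (((h.child j).subset_of_mem hj).1 (h1 hx))
        exact .inl (((h.child i).subset_of_mem hj).1.antisymm h1)

/-- The tree with the number `θ (supp w)` at each vertex `w`. -/
def deco (θ : Finset (Option (Fin k)) → unitInterval) : Tr (Lbl O M) k → Tr (TLbl O M) k
  | leaf i => leaf i
  | node n a ch => node n (a, θ (supp (node n a ch))) fun i => (ch i).deco θ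

/-- The number at the vertex `w` with `supp w = v`. -/
def num (v : Finset (Option (Fin k))) : Tr (TLbl O M) k → unitInterval
  | leaf _ => ⊥
  | node n a ch =>
    if (forget (node n a ch)).supp = v then a.2 else Finset.univ.sup fun i => num v (ch i)

@[simp] lemma forget_node {n : ℕ} (a : TLbl O M n) (ch : Fin n → Tr (TLbl O M) k) :
    (node n a ch).forget = node n a.1 fun i => (ch i).forget := rfl

@[simp] lemma forget_deco (θ : Finset (Option (Fin k)) → unitInterval) (D : Tr (Lbl O M) k) :
    (D.deco θ).forget = D := by
  induction D with
  | leaf i => rfl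
  | node n a ch ih => simp only [deco, forget_node, ih]

lemma num_of_notMem {v : Finset (Option (Fin k))} {D : Tr (TLbl O M) k}
    (h : v ∉ D.forget.vertexSets) : D.num v = ⊥ := by
  induction D with
  | leaf i => rfl
  | node n a ch ih =>
    rw [forget_node, mem_vertexSets_node] at h
    push Not at h
    rw [num, if_neg (show ¬ (node n a ch).forget.supp = v from Ne.symm h.1), Finset.sup_eq_bot_iff]
    exact fun i _ => ih i (h.2 i)

lemma num_root {n : ℕ} (a : TLbl O M n) (ch : Fin n → Tr (TLbl O M) k) :
    (node n a ch).num (node n a ch).forget.supp = a.2 := by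
  rw [num, if_pos rfl]

/-- The siblings of the child containing `v` do not have `v` as a vertex set, so they contribute
`⊥`, which is neutral for the supremum in `num`. -/
lemma Ok.num_child {n : ℕ} {a : TLbl O M n} {ch : Fin n → Tr (TLbl O M) k}
    (h : (node n a ch).forget.Ok) {i : Fin n} {v : Finset (Option (Fin k))}
    (hv : v ∈ (ch i).forget.vertexSets) : (node n a ch).num v = (ch i).num v := by
  rw [num, if_neg (show ¬ (node n a ch).forget.supp = v from
    fun e => h.notMem_child i (e.symm ▸ hv))]
  refine le_antisymm (Finset.sup_le fun j _ => ?_)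
    (Finset.le_sup (f := fun i => num v (ch i)) (Finset.mem_univ i))
  by_cases hij : i = j
  · rw [hij]
  · rw [num_of_notMem (h.notMem_of_ne hij ((h.child i).subset_of_mem hv).1)]
    exact bot_le

lemma deco_congr {θ θ' : Finset (Option (Fin k)) → unitInterval} {D : Tr (Lbl O M) k}
    (h : ∀ v ∈ D.vertexSets, θ v = θ' v) : D.deco θ = D.deco θ' := by
  induction D with
  | leaf i => rfl
  | node n a ch ih =>
    rw [deco, deco, h _ (mem_vertexSets_node.2 (.inl rfl))]
    congr 1
    exact funext fun i => ih i fun v hv => h v (mem_vertexSets_node.2 (.inr ⟨i, hv⟩))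

/-- With `num_deco`, this identifies trees with numbers with pairs of a labelled tree and a function
on its vertex sets. It depends on different vertices having different sets. -/
lemma deco_num {D : Tr (TLbl O M) k} (h : D.forget.Ok) :
    D.forget.deco (fun v => D.num v) = D := by
  induction D with
  | leaf i => rfl
  | node n a ch ih =>
    rw [forget_node, deco]
    have h1 := num_root a ch
    rw [forget_node] at h1
    rw [h1]
    congr 1
    funext i
    conv_rhs => rw [← ih i (h.child i)]
    exact deco_congr fun v hv => h.num_child hv

lemma num_deco {θ : Finset (Option (Fin k)) → unitInterval} {D : Tr (Lbl O M) k} (h : D.Ok)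
    {v : Finset (Option (Fin k))} (hv : v ∈ D.vertexSets) : (D.deco θ).num v = θ v := by
  induction D with
  | leaf i => simp [vertexSets] at hv
  | node n a ch ih =>
    rcases mem_vertexSets_node.1 hv with rfl | ⟨i, hi⟩
    · have := num_root (a, θ (supp (node n a ch))) fun i => (ch i).deco θ
      rw [forget_node] at this
      simp only [forget_deco] at this
      rw [deco]
      exact this
    · have h' : ((node n a ch).deco θ).forget.Ok := by rwa [forget_deco]
      have hi' : v ∈ ((ch i).deco θ).forget.vertexSets := by rwa [forget_deco]
      rw [← ih i (h.child i) hi]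
      exact h'.num_child hi'

lemma Ok.none_notMem_child {n : ℕ} {a : Lbl O M n} {ch : Fin n → Tr (Lbl O M) k}
    (h : (node n a ch).Ok) (ha : a.pearls ≠ 0) (i : Fin n) : none ∉ (ch i).supp := by
  intro hm
  rw [mem_supp] at hm
  have h1 := h.2 none
  have := Finset.single_le_sum (f := fun i => count none (ch i)) (fun _ _ => Nat.zero_le _)
    (Finset.mem_univ i)
  simp only [count, if_true] at h1 this
  omega

/-- The membership `D.supp ∈ D.vertexSets` expresses that `D` is not a leaf. -/
lemma adm_deco_child {θ : Finset (Option (Fin k)) → unitInterval} {D : Tr (Lbl O M) k}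
    {t : unitInterval} :
    (∀ (m : ℕ) (b : TLbl O M m) (ch' : Fin m → Tr (TLbl O M) k), D.deco θ = node m b ch' →
        (HasPearl (D.deco θ) → b.2 ≤ t) ∧ (¬ HasPearl (D.deco θ) → t ≤ b.2)) ↔
      (D.supp ∈ D.vertexSets →
        (none ∈ D.supp → θ D.supp ≤ t) ∧ (none ∉ D.supp → t ≤ θ D.supp)) := by
  rw [HasPearl, forget_deco]
  cases D with
  | leaf i => simp [deco, vertexSets]
  | node n a ch =>
    constructor
    · exact fun h _ => h _ _ _ rfl
    · intro h m b ch' hb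
      rw [deco, node.injEq] at hb
      obtain ⟨rfl, hb, -⟩ := hb
      rw [← eq_of_heq hb]
      exact h (mem_vertexSets_node.2 (.inl rfl))

lemma Ok.adm_deco_iff {θ : Finset (Option (Fin k)) → unitInterval} {D : Tr (Lbl O M) k}
    (h : D.Ok) : (D.deco θ).Adm ↔ IsAdm none D.vertexSets fun v => (θ v : ℝ) := by
  induction D with
  | leaf i => simp [deco, Adm, IsAdm, Covers, vertexSets]
  | node n a ch ih =>
    rw [deco, Adm]
    simp only [adm_deco_child]
    constructor
    · rintro ⟨h1, h2⟩
      refine ⟨fun v hv hn hmin => ?_, fun v w hvw => ?_⟩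
      · rcases mem_vertexSets_node.1 hv with rfl | ⟨i, hi⟩
        · have ha : a.pearls ≠ 0 := by
            intro ha
            rw [mem_supp, count, if_pos rfl, ha, zero_add] at hn
            obtain ⟨i, -, hi⟩ := Finset.exists_ne_zero_of_sum_ne_zero hn
            have hi' : (ch i).supp ∈ (ch i).vertexSets := by
              cases hc : ch i with
              | leaf j => rw [hc] at hi; simp [count] at hi
              | node m b ch' => exact mem_vertexSets_node.2 (.inl rfl)
            exact (h.supp_ssubset i).2
              (hmin _ (mem_vertexSets_node.2 (.inr ⟨i, hi'⟩)) (mem_supp.2 hi))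
          exact congrArg Subtype.val (h1 ha)
        · exact ((ih i (h.child i)).1 (h2 i).1).1 v hi hn fun e he =>
            hmin e (mem_vertexSets_node.2 (.inr ⟨i, he⟩))
      · rcases h.covers_node_iff.1 hvw with ⟨i, hi⟩ | ⟨i, rfl, hv, rfl⟩
        · exact ((ih i (h.child i)).1 (h2 i).1).2 v w hi
        · exact (h2 i).2 hv
    · rintro ⟨h1, h2⟩
      refine ⟨fun ha => Subtype.ext (h1 _ (mem_vertexSets_node.2 (.inl rfl)) ?_ ?_), fun i =>
        ⟨(ih i (h.child i)).2 ⟨fun v hv hn hmin => ?_, fun v w hvw => ?_⟩, fun hv => ?_⟩⟩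
      · rw [mem_supp, count, if_pos rfl]
        have ha' : a.pearls ≠ 0 := ha
        omega
      · intro e he hn
        rcases mem_vertexSets_node.1 he with rfl | ⟨i, hi⟩
        · exact subset_rfl
        · exact absurd (((h.child i).subset_of_mem hi).1 hn) (h.none_notMem_child ha i)
      · refine h1 v (mem_vertexSets_node.2 (.inr ⟨i, hv⟩)) hn fun e he hne => ?_
        rcases mem_vertexSets_node.1 he with rfl | ⟨j, hj⟩
        · exact ((h.child i).subset_of_mem hv).1.trans (supp_child_subset _ _ _)
        · obtain rfl := h.index_eq (((h.child i).subset_of_mem hv).1 hn)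
            (((h.child j).subset_of_mem hj).1 hne)
          exact hmin e hj hne
      · exact h2 v w (h.covers_node_iff.2 (.inl ⟨i, hvw⟩))
      · exact h2 _ _ (h.covers_node_iff.2 (.inr ⟨i, rfl, hv, rfl⟩))

lemma deco_graft {n m : ℕ} (θ : Finset (Option (Fin k)) → unitInterval) (i : Fin n)
    (ch : Fin n → Tr (Lbl O M) k) (ch' : Fin m → Tr (Lbl O M) k) :
    (fun p => (graft i ch ch' p).deco θ) =
      graft i (fun j => (ch j).deco θ) fun j => (ch' j).deco θ :=
  funext fun p => map_graft (deco θ) i ch ch' p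

lemma comp_update {A B : Type*} {n : ℕ} (F : A → B) (ch : Fin n → A) (i : Fin n) (c : A) :
    (fun j => F (Function.update ch i c j)) = Function.update (fun j => F (ch j)) i (F c) :=
  funext fun j => Function.apply_update (fun _ => F) ch i c j

/-- Contracting an edge between vertices with the same number is one of the relations of the
Boardman–Vogt resolution. -/
lemma Step.ibRel {v : Finset (Option (Fin k))} {D D' : Tr (Lbl O M) k} (hs : Step v D D')
    (h : D.Ok) {θ : Finset (Option (Fin k)) → unitInterval}
    (hθ : ∀ w, Covers D.vertexSets v w → θ v = θ w) : IbRel (D.deco θ) (D'.deco θ) := by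
  induction hs with
  | @root n m a ch i b ch' hi hv =>
    subst hv
    have ht := hθ _ (h.covers_node_iff.2 (.inr ⟨i, rfl, by
      rw [hi]; exact mem_vertexSets_node.2 (.inl rfl), rfl⟩))
    rw [deco, deco, deco_graft, supp_congr (h.count_graft hi)]
    refine .contract a _ (fun j => (ch j).deco θ) i b (fun j => (ch' j).deco θ) ?_
    rw [← ht, hi, deco]
  | above a ch i c hc ih =>
    have hspec := (Step.above a ch i c hc).spec h
    rw [deco, deco, comp_update (deco θ), supp_congr hspec.2.1]
    exact .above _ _ i _ (ih (h.child i) fun w hw => hθ w (h.covers_node_iff.2 (.inl ⟨i, hw⟩)))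

/-! ### Removing bivalent vertices and permuting inputs -/

/-- The relations of the Boardman–Vogt resolution which do not contract edges. -/
inductive Elem : Tr (TLbl O M) k → Tr (TLbl O M) k → Prop
  | unit (t : unitInterval) (ch : Fin 1 → Tr (TLbl O M) k) :
      Elem (node 1 (Lbl.op O.one, t) ch) (ch 0)
  | perm {m n : ℕ} (e : Fin m ≃ Fin n) (a : Lbl O M n) (t : unitInterval)
      (ch : Fin n → Tr (TLbl O M) k) :
      Elem (node m (a.act e, t) fun i => ch (e i)) (node n (a, t) ch)
  | above {n : ℕ} (a : TLbl O M n) (ch : Fin n → Tr (TLbl O M) k) (i : Fin n)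
      (c : Tr (TLbl O M) k) (h : Elem (ch i) c) :
      Elem (node n a ch) (node n a (Function.update ch i c))

lemma Elem.ibRel {D E : Tr (TLbl O M) k} (h : Elem D E) : IbRel D E := by
  induction h with
  | unit t ch => exact .unit t ch
  | perm e a t ch => exact .perm e a t ch
  | above a ch i c h ih => exact .above a ch i c ih

lemma Elem.count_eq {D E : Tr (TLbl O M) k} (h : Elem D E) (x : Option (Fin k)) :
    E.forget.count x = D.forget.count x := by
  induction h with
  | unit t ch => simp [count, Lbl.pearls]
  | perm e a t ch =>
    simp only [forget_node, count, Lbl.pearls_act]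
    rw [e.sum_comp fun i => count x (ch i).forget]
  | above a ch i c h ih =>
    simp only [forget_node, count]
    congr 1
    refine Finset.sum_congr rfl fun j _ => ?_
    by_cases hj : j = i
    · subst hj; simpa using ih
    · simp [hj]

lemma Elem.hasPearl_iff {D E : Tr (TLbl O M) k} (h : Elem D E) : E.HasPearl ↔ D.HasPearl := by
  rw [HasPearl, HasPearl, supp_congr h.count_eq]

lemma Elem.good {D E : Tr (TLbl O M) k} (h : Elem D E) {r : ℕ} (hD : D.forget.Good r) :
    E.forget.Good r := by
  induction h with
  | unit t ch => exact hD.2 0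
  | perm e a t ch =>
    exact ⟨(Lbl.good_act e a).1 hD.1, fun i => by simpa using hD.2 (e.symm i)⟩
  | above a ch i c h ih =>
    refine ⟨hD.1, fun j => ?_⟩
    change Good r (forget (Function.update ch i c j))
    by_cases hj : j = i
    · subst hj; rw [Function.update_self]; exact ih (hD.2 j)
    · rw [Function.update_of_ne hj]; exact hD.2 j

/-- Admissibility also involves the edge below the modified subtree, so the induction must control
its root number. Removing a unit vertex replaces this number by that of the next vertex up: it does
not increase if the pearl is above, and does not decrease otherwise. Transitivity then gives the
inequality on the new edge. -/
lemma Elem.adm_aux {D E : Tr (TLbl O M) k} (h : Elem D E) (hD : D.Adm) :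
    E.Adm ∧ ∀ (m : ℕ) (b : TLbl O M m) (ch' : Fin m → Tr (TLbl O M) k), E = node m b ch' →
      ∃ (n : ℕ) (a : TLbl O M n) (ch : Fin n → Tr (TLbl O M) k), D = node n a ch ∧
        (D.HasPearl → b.2 ≤ a.2) ∧ (¬ D.HasPearl → a.2 ≤ b.2) := by
  induction h with
  | unit t ch =>
    refine ⟨(hD.2 0).1, fun m b ch' hb => ⟨_, _, _, rfl, ?_⟩⟩
    rw [← (Elem.unit t ch).hasPearl_iff]
    exact (hD.2 0).2 m b ch' hb
  | perm e a t ch =>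
    refine ⟨⟨fun ha => hD.1 (by rwa [Lbl.pearls_act]), fun i => ?_⟩, fun m b ch' hb => ?_⟩
    · have := hD.2 (e.symm i)
      simpa only [Equiv.apply_symm_apply] using this
    · obtain ⟨rfl, hb, -⟩ := node.inj hb
      rw [← eq_of_heq hb]
      exact ⟨_, _, _, rfl, fun _ => le_rfl, fun _ => le_rfl⟩
  | @above n a ch i c h ih =>
    obtain ⟨h1, h2⟩ := ih (hD.2 i).1
    refine ⟨⟨hD.1, fun j => ?_⟩, fun m b ch' hb => ?_⟩
    · by_cases hj : j = i
      · subst hj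
        rw [Function.update_self]
        refine ⟨h1, fun m b ch' hb => ?_⟩
        obtain ⟨l, d, ch'', hd, h3, h4⟩ := h2 m b ch' hb
        obtain ⟨h5, h6⟩ := (hD.2 j).2 l d ch'' hd
        rw [h.hasPearl_iff]
        exact ⟨fun hp => (h3 hp).trans (h5 hp), fun hp => (h6 hp).trans (h4 hp)⟩
      · rw [Function.update_of_ne hj]
        exact hD.2 j
    · obtain ⟨rfl, hb, -⟩ := node.inj hb
      rw [← eq_of_heq hb]
      exact ⟨_, _, _, rfl, fun _ => le_rfl, fun _ => le_rfl⟩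

open Relation

lemma reflTransGen_update {n : ℕ} (a : TLbl O M n) (ch : Fin n → Tr (TLbl O M) k) (i : Fin n)
    {c : Tr (TLbl O M) k} (h : ReflTransGen Elem (ch i) c) :
    ReflTransGen Elem (node n a ch) (node n a (Function.update ch i c)) := by
  induction h with
  | refl => rw [Function.update_eq_self]
  | @tail b c _ h ih =>
    refine ih.tail ?_
    have := Elem.above a (Function.update ch i b) i c (by rwa [Function.update_self])
    rwa [Function.update_idem] at this

lemma reflTransGen_node {n : ℕ} (a : TLbl O M n) {ch ch' : Fin n → Tr (TLbl O M) k}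
    (h : ∀ i, ReflTransGen Elem (ch i) (ch' i)) :
    ReflTransGen Elem (node n a ch) (node n a ch') := by
  classical
  -- The children are replaced one at a time.
  have key : ∀ s : Finset (Fin n),
      ReflTransGen Elem (node n a ch) (node n a (s.piecewise ch' ch)) := by
    intro s
    induction s using Finset.induction with
    | empty => rw [Finset.piecewise_empty]
    | insert i s hi ih =>
      rw [Finset.piecewise_insert]
      refine ih.trans (reflTransGen_update a _ i ?_)
      rw [Finset.piecewise_eq_of_notMem _ _ _ hi]
      exact h i
  simpa using key Finset.univ

lemma Iso.reflTransGen {D E : Tr (Lbl O M) k} (h : Iso D E)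
    (θ : Finset (Option (Fin k)) → unitInterval) :
    ReflTransGen Elem (D.deco θ) (E.deco θ) := by
  induction h with
  | leaf i => exact .refl
  | node e a ch ch' h ih =>
    rw [deco, deco, (Iso.node e a ch ch' h).supp_eq]
    exact (reflTransGen_node _ ih).tail (.perm e a _ fun i => (ch' i).deco θ)

end Tr

/-- The resolution is a quotient of the admissible pearled trees only, so the intermediate trees of
the chain have to be shown admissible and pearled as well. -/
lemma Ib.mk_eq_of_reflTransGen {D E : IbTree O M k}
    (h : Relation.ReflTransGen Tr.Elem D.tr E.tr) : Ib.mk D = Ib.mk E := by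
  have key : ∀ E' : Tr (TLbl O M) k, Relation.ReflTransGen Tr.Elem D.tr E' →
      ∃ (h1 : E'.forget.Pearled 1) (h2 : E'.Adm), Ib.mk D = Ib.mk ⟨E', h1, h2⟩ := by
    intro E' h'
    induction h' with
    | refl => exact ⟨D.pearled, D.adm, rfl⟩
    | tail _ h ih =>
      obtain ⟨h1, h2, h3⟩ := ih
      exact ⟨⟨h.good h1.1, fun x => (h.count_eq x).trans (h1.2 x)⟩, (h.adm_aux h2).1,
        h3.trans (Quot.sound h.ibRel)⟩
  exact (key _ h).choose_spec.choose_spec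

/-! ### Reduction of trees -/

lemma Lbl.one_comp {n : ℕ} (i : Fin 1) (b : Lbl O M n) (h : 1 + n - 1 = n) :
    (Lbl.op O.one : Lbl O M 1).comp i b = b.act (finCongr h) := by
  obtain rfl : i = 0 := Subsingleton.elim _ _
  rcases b with b | x | x
  · exact congrArg Lbl.op (O.one_comp b h)
  · exact congrArg Lbl.pearl (M.one_left x h)
  · rfl

lemma Lbl.comp_one {n : ℕ} (i : Fin n) (a : Lbl O M n) (h : n + 1 - 1 = n) :
    a.comp i (Lbl.op O.one : Lbl O M 1) = a.act (finCongr h) := by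
  rcases a with a | x | x
  · exact congrArg Lbl.op (O.comp_one i a h)
  · exact congrArg Lbl.pearl (M.right_one i x h)
  · rfl

/-- Here it enters that `O(1)` is a point: a bivalent vertex other than the pearl carries the unit,
so relation (a) removes it. -/
lemma Lbl.eq_one (hO : O.DoublyReduced) {a : Lbl O M 1} {r : ℕ} (hr : a.Good r)
    (ha : a.pearls = 0) : a = Lbl.op O.one := by
  rcases a with a | x | x
  · have := hO.2.2
    exact congrArg Lbl.op (Subsingleton.elim _ _)
  · simp [Lbl.pearls] at ha
  · exact hr.elim

namespace Tr

/-- Removes all the bivalent vertices other than the pearl. -/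
def red : Tr (TLbl O M) k → Tr (TLbl O M) k
  | leaf i => leaf i
  | node n a ch => if h : n = 1 ∧ a.1.pearls = 0 then red (ch ⟨0, by omega⟩) else
      node n a fun i => red (ch i)

lemma red_bivalent {a : TLbl O M 1} (h : a.1.pearls = 0) (ch : Fin 1 → Tr (TLbl O M) k) :
    (node 1 a ch).red = (ch 0).red := by
  rw [red, dif_pos ⟨rfl, h⟩]
  rfl

lemma red_node {n : ℕ} {a : TLbl O M n} (h : ¬ (n = 1 ∧ a.1.pearls = 0))
    (ch : Fin n → Tr (TLbl O M) k) : (node n a ch).red = node n a fun i => (ch i).red := by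
  rw [red, dif_neg h]

lemma count_red (D : Tr (TLbl O M) k) (x : Option (Fin k)) :
    D.red.forget.count x = D.forget.count x := by
  induction D with
  | leaf i => rfl
  | node n a ch ih =>
    by_cases h : n = 1 ∧ a.1.pearls = 0
    · obtain ⟨rfl, h⟩ := h
      rw [red_bivalent h, ih]
      simp [count, h]
    · rw [red_node h]
      simp only [forget_node, count, ih]

lemma hasPearl_red (D : Tr (TLbl O M) k) : D.red.HasPearl ↔ D.HasPearl := by
  rw [HasPearl, HasPearl, supp_congr (count_red D)]

lemma good_red {D : Tr (TLbl O M) k} (h : D.forget.Good 1) : D.red.forget.Good 2 := by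
  induction D with
  | leaf i => trivial
  | node n a ch ih =>
    by_cases h1 : n = 1 ∧ a.1.pearls = 0
    · obtain ⟨rfl, h1⟩ := h1
      rw [red_bivalent h1]
      exact ih 0 (h.2 0)
    · rw [red_node h1]
      suffices hs : a.1.Good 2 from ⟨hs, fun i => ih i (h.2 i)⟩
      have h2 : a.1.Good 1 := h.1
      rcases ha : a.1 with b | x | x
      · rw [ha] at h1 h2
        have h3 : 1 ≤ n := h2
        have h4 : n ≠ 1 := fun e => h1 ⟨e, rfl⟩
        change 2 ≤ n
        omega
      · trivial
      · rw [ha] at h2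
        exact h2.elim

lemma ok_red {D : Tr (TLbl O M) k} (h : D.forget.Good 1) (h' : ∀ x, D.forget.count x ≤ 1) :
    D.red.forget.Ok :=
  ⟨good_red h, fun x => (count_red D x).trans_le (h' x)⟩

lemma reflTransGen_red (hO : O.DoublyReduced) {D : Tr (TLbl O M) k} (h : D.forget.Good 1) :
    Relation.ReflTransGen Elem D D.red := by
  induction D with
  | leaf i => exact .refl
  | node n a ch ih =>
    by_cases h1 : n = 1 ∧ a.1.pearls = 0
    · obtain ⟨rfl, h1⟩ := h1
      rw [red_bivalent h1]
      have ha : a = (Lbl.op O.one, a.2) := Prod.ext (Lbl.eq_one hO h.1 h1) rfl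
      rw [ha]
      exact .head (.unit a.2 ch) (ih 0 (h.2 0))
    · rw [red_node h1]
      exact reflTransGen_node a fun i => ih i (h.2 i)

/-! ### The relations of the resolution after reduction -/

/-- Isomorphisms of trees with numbers. -/
def Same (D E : Tr (TLbl O M) k) : Prop :=
  Iso D.forget E.forget ∧ ∀ v, D.num v = E.num v

/-- The second tree is obtained from the first one by contracting an edge between two vertices
with the same number. -/
def Contr (D E : Tr (TLbl O M) k) : Prop :=
  ∃ v w F, Step v D.forget F ∧ Iso F E.forget ∧ Covers D.forget.vertexSets v w ∧
    D.num v = D.num w ∧ ∀ u, u ≠ v → E.num u = D.num u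

lemma Same.refl (D : Tr (TLbl O M) k) : Same D D := ⟨.refl _, fun _ => rfl⟩

lemma Same.symm {D E : Tr (TLbl O M) k} (h : Same D E) : Same E D :=
  ⟨h.1.symm, fun v => (h.2 v).symm⟩

lemma forget_update {n : ℕ} (ch : Fin n → Tr (TLbl O M) k) (i : Fin n) (c : Tr (TLbl O M) k) :
    (fun j => (Function.update ch i c j).forget) =
      Function.update (fun j => (ch j).forget) i c.forget :=
  comp_update forget ch i c

lemma num_node_update {n : ℕ} {a : TLbl O M n} {ch : Fin n → Tr (TLbl O M) k} {i : Fin n}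
    {c : Tr (TLbl O M) k} {v : Finset (Option (Fin k))}
    (hs : ∀ x, c.forget.count x = (ch i).forget.count x) (hn : c.num v = (ch i).num v) :
    (node n a (Function.update ch i c)).num v = (node n a ch).num v := by
  have h1 : ∀ j, (Function.update ch i c j).num v = (ch j).num v := fun j => by
    by_cases hj : j = i
    · subst hj; rwa [Function.update_self]
    · rw [Function.update_of_ne hj]
  have h2 : ∀ j x, (Function.update ch i c j).forget.count x = (ch j).forget.count x :=
    fun j x => by
      by_cases hj : j = i
      · subst hj; rw [Function.update_self, hs]
      · rw [Function.update_of_ne hj]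
  have h3 : (node n a (Function.update ch i c)).forget.supp = (node n a ch).forget.supp :=
    supp_congr fun x => by simp only [forget_node, count, h2]
  simp only [num, h3, h1]

lemma Same.above {n : ℕ} (a : TLbl O M n) (ch : Fin n → Tr (TLbl O M) k) (i : Fin n)
    {c : Tr (TLbl O M) k} (h : Same (ch i) c) :
    Same (node n a ch) (node n a (Function.update ch i c)) := by
  refine ⟨?_, fun v => (num_node_update (fun x => (h.1.count_eq x).symm) (h.2 v).symm).symm⟩
  have := iso_update a.1 (fun j => (ch j).forget) i h.1
  rw [Function.update_eq_self] at this
  rw [forget_node, forget_node, forget_update]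
  exact this

lemma Contr.above {n : ℕ} {a : TLbl O M n} {ch : Fin n → Tr (TLbl O M) k} {i : Fin n}
    {c : Tr (TLbl O M) k} (h : Contr (ch i) c) (hok : (node n a ch).forget.Ok) :
    Contr (node n a ch) (node n a (Function.update ch i c)) := by
  obtain ⟨v, w, F, hs, hF, hc, hn, hu⟩ := h
  refine ⟨v, w, _, .above a.1 _ i F hs, ?_, hok.covers_node_iff.2 (.inl ⟨i, hc⟩), ?_,
    fun u huv => num_node_update (fun x => ?_) (hu u huv)⟩
  · rw [forget_node, forget_update]
    exact iso_update a.1 _ i hF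
  · rw [hok.num_child hc.1, hok.num_child hc.2.1, hn]
  · rw [← hF.count_eq, (hs.spec (hok.child i)).2.1]

lemma same_perm {m n : ℕ} (e : Fin m ≃ Fin n) (a : Lbl O M n) (t : unitInterval)
    (ch : Fin n → Tr (TLbl O M) k) :
    Same (node m (a.act e, t) fun i => ch (e i)) (node n (a, t) ch) := by
  have h : Iso (node m (a.act e, t) fun i => ch (e i)).forget (node n (a, t) ch).forget :=
    .node e a _ _ fun i => .refl _
  refine ⟨h, fun v => ?_⟩
  simp only [num, h.supp_eq]
  congr 1
  refine le_antisymm (Finset.sup_le fun i _ => ?_) (Finset.sup_le fun i _ => ?_)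
  · exact Finset.le_sup (f := fun i => num v (ch i)) (Finset.mem_univ (e i))
  · have := Finset.le_sup (f := fun i => num v (ch (e i))) (Finset.mem_univ (e.symm i))
    simpa using this

lemma same_red_perm {m n : ℕ} (e : Fin m ≃ Fin n) (a : Lbl O M n) (t : unitInterval)
    (ch : Fin n → Tr (TLbl O M) k) :
    Same (node m (a.act e, t) fun i => ch (e i)).red (node n (a, t) ch).red := by
  obtain rfl : m = n := by simpa using Fintype.card_congr e
  by_cases h : m = 1 ∧ a.pearls = 0
  · obtain ⟨rfl, h⟩ := h
    rw [red_bivalent (a := (a, t)) h,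
      red_bivalent (a := (a.act e, t)) ((Lbl.pearls_act e a).trans h),
      Subsingleton.elim (e 0) (0 : Fin 1)]
    exact .refl _
  · rw [red_node (a := (a, t)) h, red_node (a := (a.act e, t)) fun h' =>
      h ⟨h'.1, (Lbl.pearls_act e a).symm.trans h'.2⟩]
    exact same_perm e a t fun i => (ch i).red

lemma graft_one_left {X : Type*} {m : ℕ} (i : Fin 1) (f : Fin 1 → X) (g : Fin m → X)
    (h : 1 + m - 1 = m) : graft i f g = fun p => g (finCongr h p) := by
  funext p
  refine slot_cases i (fun j => absurd (Subsingleton.elim _ _) j.2) (fun l => ?_) p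
  rw [graft_inr]
  congr 1
  apply Fin.ext
  simp

lemma graft_one_right {X : Type*} {n : ℕ} (i : Fin n) (f : Fin n → X) (g : Fin 1 → X)
    (h : n + 1 - 1 = n) :
    graft i f g = fun p => Function.update f i (g 0) (finCongr h p) := by
  funext p
  refine slot_cases i (fun j => ?_) (fun l => ?_) p
  · have : finCongr h (slot i (.inl j)) = j.1 := by
      apply Fin.ext
      simp only [finCongr_apply, Fin.val_cast, slot_inl_val]
      split_ifs <;> omega
    rw [graft_inl, this, Function.update_of_ne j.2]
  · have : finCongr h (slot i (.inr l)) = i := by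
      apply Fin.ext
      simp only [finCongr_apply, Fin.val_cast, slot_inr_val]
      omega
    rw [graft_inr, this, Function.update_self, Subsingleton.elim l 0]

/-- Contraction erases one vertex set and keeps the support of the root. For any other set `u`, the
supremum over the children of the contracted vertex is merely absorbed into the supremum over the
children of the root. -/
lemma contr_root {n m : ℕ} (a : Lbl O M n) (t : unitInterval) (ch : Fin n → Tr (TLbl O M) k)
    (i : Fin n) (b : Lbl O M m) (ch' : Fin m → Tr (TLbl O M) k) (h : ch i = node m (b, t) ch')
    (hok : (node n (a, t) ch).forget.Ok) :
    Contr (node n (a, t) ch) (node (n + m - 1) (a.comp i b, t) (graft i ch ch')) := by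
  have hi : (ch i).forget = node m b fun j => (ch' j).forget := by rw [h]; rfl
  have hmem : (ch i).forget.supp ∈ (ch i).forget.vertexSets := by
    rw [hi]; exact mem_vertexSets_node.2 (.inl rfl)
  have hE : (node (n + m - 1) (a.comp i b, t) (graft i ch ch')).forget =
      node (n + m - 1) (a.comp i b) (graft i (fun j => (ch j).forget) fun j => (ch' j).forget) :=
    congrArg (node (A := Lbl O M) (n + m - 1) (a.comp i b))
      (funext fun p => map_graft forget i ch ch' p)
  have hsupp : (node (n + m - 1) (a.comp i b, t) (graft i ch ch')).forget.supp =
      (node n (a, t) ch).forget.supp := by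
    rw [hE]
    exact supp_congr (Ok.count_graft (a := a) (ch := fun j => (ch j).forget) hok hi)
  refine ⟨_, (node n (a, t) ch).forget.supp, _, .root a (fun j => (ch j).forget) i b
    (fun j => (ch' j).forget) hi rfl, ?_, ?_, ?_, fun u hu => ?_⟩
  · rw [hE]; exact .refl _
  · exact hok.covers_node_iff.2 (.inr ⟨i, rfl, hmem, rfl⟩)
  · rw [num_root, hok.num_child hmem]
    conv_lhs => rw [h, num_root]
  · simp only [num, hsupp]
    congr 1
    have hui : (ch i).num u = Finset.univ.sup fun j => (ch' j).num u := by
      have h2 : ¬ (node m (b, t) ch').forget.supp = u := by rw [← h]; exact hu.symm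
      rw [h, num, if_neg h2]
    refine le_antisymm (Finset.sup_le fun p _ => ?_) (Finset.sup_le fun j _ => ?_)
    · refine slot_cases i (fun j => ?_) (fun l => ?_) p
      · rw [graft_inl]
        exact Finset.le_sup (f := fun j => (ch j).num u) (Finset.mem_univ _)
      · rw [graft_inr]
        refine le_trans ?_ (Finset.le_sup (f := fun j => (ch j).num u) (Finset.mem_univ i))
        rw [hui]
        exact Finset.le_sup (f := fun j => (ch' j).num u) (Finset.mem_univ l)
    · by_cases hj : j = i
      · subst hj
        rw [hui]
        refine Finset.sup_le fun l _ => ?_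
        have := Finset.le_sup (f := fun p => (graft j ch ch' p).num u)
          (Finset.mem_univ (slot j (.inr l)))
        simpa only [graft_inr] using this
      · have := Finset.le_sup (f := fun p => (graft i ch ch' p).num u)
          (Finset.mem_univ (slot i (.inl ⟨j, hj⟩)))
        simpa only [graft_inl] using this

/-- The relations of the Boardman–Vogt resolution, after reduction. -/
lemma IbRel.red (hO : O.DoublyReduced) {D E : Tr (TLbl O M) k} (h : IbRel D E)
    (hD : D.forget.Good 1) (hc : ∀ x, D.forget.count x ≤ 1) :
    Same D.red E.red ∨ Contr D.red E.red := by
  induction h with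
  | unit t ch =>
    left
    rw [red_bivalent rfl]
    exact .refl _
  | perm e a t ch => exact .inl (same_red_perm e a t ch)
  | @contract n m a t ch i b ch' h =>
    -- A bivalent lower vertex carries the unit. Contracting the edge amounts to removing this
    -- vertex, up to the relabelling `finCongr` of the inputs.
    by_cases ha : n = 1 ∧ a.pearls = 0
    · left
      obtain ⟨rfl, ha⟩ := ha
      obtain rfl : i = 0 := Subsingleton.elim _ _
      have ha1 : a = Lbl.op O.one := Lbl.eq_one hO hD.1 ha
      have hm : 1 + m - 1 = m := by omega
      rw [red_bivalent ha, h, ha1, Lbl.one_comp 0 b hm, graft_one_left 0 ch ch' hm]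
      exact (same_red_perm (finCongr hm) b t ch').symm
    -- The same for a bivalent upper vertex.
    by_cases hb : m = 1 ∧ b.pearls = 0
    · left
      obtain ⟨rfl, hb⟩ := hb
      have hbg : b.Good 1 := by
        have h2 := hD.2 i
        simp only at h2
        change Good 1 (forget (ch i)) at h2
        rw [h] at h2
        exact h2.1
      have hb1 : b = Lbl.op O.one := Lbl.eq_one hO hbg hb
      have hn : n + 1 - 1 = n := by omega
      rw [hb1, Lbl.comp_one i a hn, graft_one_right i ch ch' hn]
      have h2 := (same_red_perm (finCongr hn) a t (Function.update ch i (ch' 0))).symm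
      have h3 : (node n (a, t) (Function.update ch i (ch' 0))).red = (node n (a, t) ch).red := by
        rw [red_node ha, red_node ha, comp_update Tr.red]
        congr 1
        have h4 : (ch' 0).red = (ch i).red := by rw [h, red_bivalent hb]
        rw [h4, Function.update_eq_self]
      rwa [h3] at h2
    · right
      have hok := ok_red hD hc
      rw [red_node ha] at hok
      -- The composite vertex is not removed by the reduction: either it is the pearl, or both
      -- arities are at least `2` and `n + m - 1` is at least `3`.
      have hE : ¬ (n + m - 1 = 1 ∧ (a.comp i b).pearls = 0) := by
        rintro ⟨h1, h2⟩
        have h3 : a.Good 2 := hok.1.1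
        have h4 : b.Good 2 := by
          have hi : Good 2 (ch i).red.forget := (hok.child i).1
          rw [h, red_node (a := (b, t)) hb] at hi
          exact hi.1
        rcases a with a | a | a <;> rcases b with b | b | b
        · have h5 : 2 ≤ n := h3
          have h6 : 2 ≤ m := h4
          omega
        · simp [Lbl.comp, Lbl.pearls] at h2
        · exact h4.elim
        · simp [Lbl.comp, Lbl.pearls] at h2
        · have := hok.pearls_le (i := i) (b := .inr (.inl b))
            (ch' := fun j => (ch' j).red.forget) (by
              change (ch i).red.forget = _
              rw [h, red_node (a := (_, t)) hb, forget_node])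
          simp [Lbl.pearls] at this
        · exact h4.elim
        all_goals exact h3.elim
      rw [red_node ha, red_node hE]
      have h2 := contr_root a t (fun j => (ch j).red) i b (fun j => (ch' j).red)
        (by rw [h, red_node (a := (b, t)) hb]) hok
      rwa [← funext fun p => map_graft Tr.red i ch ch' p] at h2
  | @above n a ch i c h ih =>
    have hc' : ∀ x, (ch i).forget.count x ≤ 1 := fun x => by
      refine le_trans ?_ (hc x)
      exact le_trans (Finset.single_le_sum (f := fun i => count x (ch i).forget)
        (fun _ _ => Nat.zero_le _) (Finset.mem_univ i)) (Nat.le_add_left _ _)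
    have ih' := ih (hD.2 i) hc'
    by_cases ha : n = 1 ∧ a.1.pearls = 0
    · obtain ⟨rfl, ha⟩ := ha
      rw [red_bivalent ha, red_bivalent ha]
      obtain rfl : i = 0 := Subsingleton.elim _ _
      rwa [Function.update_self]
    · have hok := ok_red hD hc
      rw [red_node ha] at hok
      rw [red_node ha, red_node ha, comp_update Tr.red]
      exact ih'.imp (fun h' => h'.above a (fun j => (ch j).red) i) fun h' => h'.above hok

/-! ### Geometrical inputs -/

/-- Removing a bivalent vertex matters only if its number is `1`. If the pearl is above it, only its
single child is counted. -/
lemma geomInputs_red {D : Tr (TLbl O M) k} (h : D.Adm) : D.red.geomInputs = D.geomInputs := by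
  induction D with
  | leaf i => rfl
  | node n a ch ih =>
    have ih' := fun i => ih i (h.2 i).1
    by_cases ha : n = 1 ∧ a.1.pearls = 0
    · obtain ⟨rfl, ha⟩ := ha
      rw [red_bivalent ha, ih' 0]
      have hp : HasPearl (node 1 a ch) ↔ HasPearl (ch 0) := by
        rw [← hasPearl_red, red_bivalent ha, hasPearl_red]
      rw [geomInputs]
      by_cases h1 : a.2 = 1
      · by_cases hp' : HasPearl (ch 0)
        · simp [h1, hp, hp']
        · simp only [h1, hp, hp', if_true, if_false]
          -- Away from the pearl the numbers do not decrease, so a vertex directly above one with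
          -- number `1` has number `1` as well, and both give a single input; a leaf also counts as
          -- one.
          have h2 := (h.2 0).2
          cases hc : ch 0 with
          | leaf j => rfl
          | node m b ch' =>
            rw [hc] at h2 hp'
            have h3 := (h2 m b ch' rfl).2 hp'
            rw [h1] at h3
            rw [geomInputs, if_pos (le_antisymm unitInterval.le_one' h3), if_neg hp']
      · simp [h1]
    · have hp := hasPearl_red (node n a ch)
      rw [red_node ha] at hp
      rw [red_node ha, geomInputs, geomInputs]
      classical
      refine if_congr Iff.rfl (if_congr hp (Finset.sum_congr rfl fun i _ => ?_) rfl)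
        (Finset.sum_congr rfl fun i _ => ih' i)
      exact if_congr (hasPearl_red _) (ih' i) rfl

/-- The number of leaves. -/
def leaves (D : Tr (Lbl O M) k) : ℕ := ∑ i, D.count (some i)

lemma leaves_leaf (i : Fin k) : (leaf i : Tr (Lbl O M) k).leaves = 1 := by
  simp [leaves, count]

lemma leaves_node {n : ℕ} (a : Lbl O M n) (ch : Fin n → Tr (Lbl O M) k) :
    (node n a ch).leaves = ∑ i, (ch i).leaves := by
  simp only [leaves, count, reduceCtorEq, if_false, zero_add]
  exact Finset.sum_comm

lemma Pearled.leaves {r : ℕ} {D : Tr (Lbl O M) k} (h : D.Pearled r) : D.leaves = k := by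
  simp [Tr.leaves, h.2]

lemma Ok.leaves_pos {D : Tr (Lbl O M) k} (h : D.Ok) (hp : none ∉ D.supp) : 0 < D.leaves := by
  obtain ⟨x, hx⟩ := h.supp_nonempty
  cases x with
  | none => exact absurd hx hp
  | some i =>
    have := Finset.single_le_sum (f := fun i => D.count (some i)) (fun _ _ => Nat.zero_le _)
      (Finset.mem_univ i)
    rw [mem_supp] at hx
    rw [leaves]
    omega

lemma geomInputs_deco_eq {θ : Finset (Option (Fin k)) → unitInterval} {D : Tr (Lbl O M) k}
    (h : ∀ v ∈ D.vertexSets, θ v ≠ 1) : (D.deco θ).geomInputs = D.leaves := by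
  induction D with
  | leaf i => rw [leaves_leaf]; rfl
  | node n a ch ih =>
    rw [deco, geomInputs, if_neg (h _ (mem_vertexSets_node.2 (.inl rfl))), leaves_node]
    exact Finset.sum_congr rfl fun i _ =>
      ih i fun v hv => h v (mem_vertexSets_node.2 (.inr ⟨i, hv⟩))

/-- A vertex with number `1` is not the pearl, so it has at least two inputs. If the pearl is not
above it, at least two leaves are replaced by a single input. If the pearl is above it, the subtrees
at its other inputs are discarded, and each has a leaf. -/
lemma Ok.geomInputs_deco_lt {θ : Finset (Option (Fin k)) → unitInterval} {D : Tr (Lbl O M) k}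
    (h : D.Ok) (ha : (D.deco θ).Adm) : (D.deco θ).geomInputs ≤ D.leaves ∧
      ((∃ v ∈ D.vertexSets, θ v = 1) → (D.deco θ).geomInputs < D.leaves) := by
  induction D with
  | leaf i =>
    refine ⟨by rw [leaves_leaf]; rfl, ?_⟩
    rintro ⟨v, hv, -⟩
    simp [vertexSets] at hv
  | node n a ch ih =>
    have ih' := fun i => ih i (h.child i) (ha.2 i).1
    have hp : ∀ D : Tr (Lbl O M) k, (D.deco θ).HasPearl ↔ none ∈ D.supp := fun D => by
      rw [HasPearl, forget_deco]
    have hp0 := hp (node n a ch)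
    rw [deco] at hp0
    rw [deco, geomInputs, leaves_node]
    simp only [hp0, hp]
    by_cases h1 : θ (supp (node n a ch)) = 1
    · simp only [h1, if_true]
      have ha0 : a.pearls = 0 := by
        by_contra hne
        have h2 : θ (supp (node n a ch)) = 0 := ha.1 hne
        rw [h1] at h2
        exact one_ne_zero h2
      have hn : 2 ≤ n := by
        have := h.1.1
        rcases a with a | a | a
        · exact this
        · simp [Lbl.pearls] at ha0
        · exact this.elim
      suffices hs : (if none ∈ (node n a ch).supp then
          ∑ i, if none ∈ (ch i).supp then ((ch i).deco θ).geomInputs else 0 else 1) <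
          ∑ i, (ch i).leaves from ⟨hs.le, fun _ => hs⟩
      split_ifs with hpn
      · obtain ⟨j, hj⟩ : ∃ j, none ∉ (ch j).supp := by
          by_contra hcon
          push Not at hcon
          have := h.index_eq (hcon ⟨0, by omega⟩) (hcon ⟨1, by omega⟩)
          simp at this
        refine Finset.sum_lt_sum (fun i _ => ?_) ⟨j, Finset.mem_univ j, ?_⟩
        · split_ifs
          exacts [(ih' i).1, Nat.zero_le _]
        · rw [if_neg hj]
          exact (h.child j).leaves_pos hj
      · have hpos : ∀ i, 1 ≤ (ch i).leaves := fun i =>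
          (h.child i).leaves_pos fun hm => hpn (supp_child_subset a ch i hm)
        have := Finset.sum_le_sum fun i (_ : i ∈ (Finset.univ : Finset (Fin n))) => hpos i
        simp only [Finset.sum_const, Finset.card_univ, Fintype.card_fin, smul_eq_mul,
          mul_one] at this
        omega
    · simp only [h1, if_false]
      refine ⟨Finset.sum_le_sum fun i _ => (ih' i).1, ?_⟩
      rintro ⟨v, hv, hv1⟩
      rcases mem_vertexSets_node.1 hv with rfl | ⟨j, hj⟩
      · exact absurd hv1 h1
      · exact Finset.sum_lt_sum (fun i _ => (ih' i).1)
          ⟨j, Finset.mem_univ j, (ih' j).2 ⟨v, hj, hv1⟩⟩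

end Tr

/-! ### Continuous families of trees with numbers -/

namespace LTree

variable {K L : Type u} [TopologicalSpace K] [TopologicalSpace L]

/-- Continuous families of labelled planar trees with numbers. -/
inductive TFam {K : Type u} [TopologicalSpace K] : (K → Tr (TLbl O M) k) → Prop
  | leaf (i : Fin k) : TFam fun _ => .leaf i
  | node {n : ℕ} (a : K → Lbl O M n) (ha : LblFam a) (t : K → unitInterval) (ht : Continuous t)
      (ch : Fin n → K → Tr (TLbl O M) k) (h : ∀ i, TFam (ch i)) :
      TFam fun x => .node n (a x, t x) fun i => ch i x

lemma TFam.forget {f : K → Tr (TLbl O M) k} (h : TFam f) : Fam fun x => (f x).forget := by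
  induction h with
  | leaf i => exact .leaf i
  | node a ha t ht ch h ih => exact .node a ha _ ih

lemma TFam.comp_right {f : K → Tr (TLbl O M) k} (h : TFam f) {φ : L → K} (hφ : Continuous φ) :
    TFam fun x => f (φ x) := by
  induction h with
  | leaf i => exact .leaf i
  | node a ha t ht ch h ih => exact .node _ (ha.comp_right hφ) _ (ht.comp hφ) _ ih

/-- The arities and the place of the pearl do not vary in a family, so the same vertices are removed
at all parameters. Evaluating at a point `x₀` requires a nonempty parameter space. -/
lemma TFam.red {f : K → Tr (TLbl O M) k} (h : TFam f) : TFam fun x => (f x).red := by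
  induction h with
  | leaf i => exact .leaf i
  | @node n a ha t ht ch h ih =>
    rcases isEmpty_or_nonempty K with hK | ⟨⟨x₀⟩⟩
    · have : (fun x => (Tr.node n (a x, t x) fun i => ch i x).red) =
          fun x => Tr.node n (a x, t x) fun i => (ch i x).red := funext fun x => hK.elim x
      rw [this]
      exact .node a ha t ht _ ih
    · by_cases hb : n = 1 ∧ (a x₀).pearls = 0
      · obtain ⟨rfl, hb⟩ := hb
        have : (fun x => (Tr.node 1 (a x, t x) fun i => ch i x).red) = fun x => (ch 0 x).red :=
          funext fun x => Tr.red_bivalent (a := (a x, t x)) ((ha.pearls_eq x x₀).trans hb) _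
        rw [this]
        exact ih 0
      · have : (fun x => (Tr.node n (a x, t x) fun i => ch i x).red) =
            fun x => Tr.node n (a x, t x) fun i => (ch i x).red := funext fun x =>
          Tr.red_node (a := (a x, t x)) (fun h' => hb ⟨h'.1, (ha.pearls_eq x₀ x).trans h'.2⟩) _
        rw [this]
        exact .node a ha t ht _ ih

lemma TFam.continuous_num {f : K → Tr (TLbl O M) k} (h : TFam f)
    (v : Finset (Option (Fin k))) : Continuous fun x => (f x).num v := by
  induction h with
  | leaf i => exact continuous_const
  | node a ha t ht ch h ih =>
    rcases isEmpty_or_nonempty K with hK | ⟨⟨x₀⟩⟩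
    · exact continuous_of_const fun x => hK.elim x
    · have hs : ∀ x, (Tr.node _ (a x, t x) fun i => ch i x).forget.supp =
          (Tr.node _ (a x₀, t x₀) fun i => ch i x₀).forget.supp := fun x =>
        Tr.supp_congr fun s => (TFam.node a ha t ht ch h).forget.count_eq s x x₀
      simp only [Tr.num, hs]
      split_ifs
      · exact ht
      · exact Continuous.finset_sup_apply fun i _ => ih i

lemma Fam.deco {f : K → Tr (Lbl O M) k} (h : Fam f)
    {θ : K → Finset (Option (Fin k)) → unitInterval} (hθ : ∀ v ∈ {v : Finset (Option (Fin k)) |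
      ∃ x, v ∈ (f x).vertexSets}, Continuous fun x => θ x v) :
    TFam fun x => (f x).deco (θ x) := by
  induction h with
  | leaf i => exact .leaf i
  | @node n a ha ch h ih =>
    refine .node a ha (fun x => θ x (Tr.node n (a x) fun i => ch i x).supp) ?_ _ fun i => ih i ?_
    · rcases isEmpty_or_nonempty K with hK | ⟨⟨x₀⟩⟩
      · exact continuous_of_const fun x => hK.elim x
      · have hs : ∀ x, (Tr.node n (a x) fun i => ch i x).supp =
            (Tr.node n (a x₀) fun i => ch i x₀).supp := fun x =>
          Tr.supp_congr fun s => (Fam.node a ha ch h).count_eq s x x₀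
        simp only [hs]
        exact hθ _ ⟨x₀, Tr.mem_vertexSets_node.2 (.inl rfl)⟩
    · rintro v ⟨x, hx⟩
      exact hθ v ⟨x, Tr.mem_vertexSets_node.2 (.inr ⟨i, hx⟩)⟩

lemma TFam.exists_assemble {f : K → Tr (TLbl O M) k} (h : TFam f) :
    ∃ (T : Tr (fun _ => Unit) k) (g : K → Tr.Lab (TLbl O M) T), Continuous g ∧
      ∀ x, f x = Tr.assemble T (g x) := by
  induction h with
  | leaf i => exact ⟨.leaf i, fun _ => (⟨⟩ : PUnit), continuous_const, fun _ => rfl⟩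
  | node a ha t ht ch h ih =>
    choose T g hg h using ih
    refine ⟨.node _ () T, fun x => ((a x, t x), fun i => g i x),
      (ha.continuous.prodMk ht).prodMk (continuous_pi hg), fun x => ?_⟩
    simp only [Tr.assemble, h]

lemma TFam.continuous {f : K → Tr (TLbl O M) k} (h : TFam f) : Continuous f := by
  obtain ⟨T, g, hg, h⟩ := h.exists_assemble
  rw [funext h]
  exact (continuous_coinduced_rng (f := fun p : Σ T : Tr (fun _ => Unit) k, Tr.Lab (TLbl O M) T =>
    Tr.assemble p.1 p.2)).comp (continuous_sigmaMk.comp hg)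

lemma TFam.continuous_ibTree [CompactSpace K] [T2Space K] {f : K → IbTree O M k}
    (h : TFam fun x => (f x).tr) : Continuous f :=
  @continuous_to_compactlyGenerated K _ _ _ (IbTree O M k)
    (TopologicalSpace.induced IbTree.tr inferInstance) f
    (continuous_induced_rng.2 h.continuous)

/-- The space of labels of a vertex is a disjoint union of the operadic labels, the labels of pearls
and a junk point, so the kind of each of the finitely many vertices is constant on a clopen
neighbourhood. -/
lemma TFam.of_continuous_lab (T : Tr (fun _ => Unit) k) (g : K → Tr.Lab (TLbl O M) T)
    (hg : Continuous g) {r : ℕ} (hr : ∀ x, (Tr.assemble T (g x)).forget.Good r) (x₀ : K) :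
    ∃ U : Set K, IsClopen U ∧ x₀ ∈ U ∧ TFam fun x : U => Tr.assemble T (g x) := by
  induction T with
  | leaf i => exact ⟨Set.univ, isClopen_univ, trivial, .leaf i⟩
  | node n a ch ih =>
    have h1 : Continuous fun x =>
        (show TLbl O M n × (∀ i, Tr.Lab (TLbl O M) (ch i)) from g x).1 := continuous_fst.comp hg
    have h2 : ∀ i, Continuous fun x =>
        (show TLbl O M n × (∀ i, Tr.Lab (TLbl O M) (ch i)) from g x).2 i := fun i =>
      (continuous_apply i).comp (continuous_snd.comp hg)
    choose U hU hx hF using fun i => ih i _ (h2 i) fun x => (hr x).2 i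
    obtain ⟨V, hV, hxV, hFV⟩ := LblFam.of_continuous (continuous_fst.comp h1)
      (fun x => (hr x).1) x₀
    refine ⟨V ∩ ⋂ i, U i, hV.inter (isClopen_iInter_of_finite hU),
      ⟨hxV, Set.mem_iInter.2 hx⟩, ?_⟩
    exact .node _ (hFV.comp_right (φ := Set.inclusion Set.inter_subset_left)
      (continuous_inclusion _)) _ ((continuous_snd.comp h1).comp continuous_subtype_val) _
        fun i => (hF i).comp_right
        (φ := Set.inclusion (Set.inter_subset_right.trans (Set.iInter_subset _ i)))
        (continuous_inclusion _)

lemma TFam.of_continuous {f : K → Tr (TLbl O M) k} (hf : Continuous f) {r : ℕ}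
    (hr : ∀ x, (f x).forget.Good r) (x₀ : K) :
    ∃ U : Set K, IsClopen U ∧ x₀ ∈ U ∧ TFam fun x : U => f x := by
  have h := Tr.continuous_disassemble.comp hf
  set T := (f x₀).disassemble.1 with hT
  have hc : IsClopen (Set.range (Sigma.mk T : Tr.Lab (TLbl O M) T → _)) := isClopen_range_sigmaMk
  have hc' := hc.preimage h
  choose g hg using fun x : (Tr.disassemble ∘ f) ⁻¹' Set.range (Sigma.mk T) => x.2
  have hgf : ∀ x, Tr.assemble T (g x) = f x := fun x => by
    have := Tr.assemble_disassemble (f x)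
    rw [← show _ = (f x).disassemble from hg x] at this
    exact this
  have hgc : Continuous g := by
    refine (Topology.IsEmbedding.sigmaMk (σ := Tr.Lab (TLbl O M) (k := k))
      (i := T)).continuous_iff.2 ?_
    exact (h.comp continuous_subtype_val).congr fun x => (hg x).symm
  obtain ⟨U, hU, hx, hF⟩ := TFam.of_continuous_lab T g hgc (r := r)
    (fun x => by rw [hgf]; exact hr x) ⟨x₀, ⟨(f x₀).disassemble.2, rfl⟩⟩
  refine ⟨Subtype.val '' U, ?_, ⟨_, hx, rfl⟩, ?_⟩
  · exact ⟨hc'.1.isClosedEmbedding_subtypeVal.isClosedMap _ hU.1,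
      hc'.2.isOpenEmbedding_subtypeVal.isOpenMap _ hU.2⟩
  · have hφ : ∀ x : (Subtype.val '' U : Set K), ∃ y : U, y.1.1 = x.1 := by
      rintro ⟨_, y, hy, rfl⟩; exact ⟨⟨y, hy⟩, rfl⟩
    choose φ hφ' using hφ
    have hφc : Continuous φ := by
      refine continuous_induced_rng.2 (continuous_induced_rng.2 ?_)
      exact continuous_subtype_val.congr fun x => (hφ' x).symm
    have := hF.comp_right hφc
    simp only [hgf, hφ'] at this
    exact this

/-- A map on the space of trees with numbers is continuous if it is so on continuous families. -/
lemma continuous_of_tfam {Y : Type*} [TopologicalSpace Y] {F : IbTree O M k → Y}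
    (h : ∀ (K : Type u) [TopologicalSpace K] [CompactSpace K] [T2Space K]
      (f : K → IbTree O M k), TFam (fun x => (f x).tr) → ∀ _ : K, Continuous (F ∘ f)) :
    Continuous F := by
  let _ : TopologicalSpace (IbTree O M k) :=
    TopologicalSpace.induced IbTree.tr inferInstance
  refine continuous_from_compactlyGenerated _ fun S g => ?_
  rw [continuous_iff_continuousAt]
  intro x₀
  obtain ⟨U, hU, hx, hF⟩ := TFam.of_continuous (continuous_induced_dom.comp g.2)
    (fun x => (g x).pearled.1) x₀
  have : CompactSpace U := isCompact_iff_compactSpace.1 hU.1.isCompact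
  have h1 : Continuous fun x : U => F (g x) := h U (fun x => g x) hF ⟨x₀, hx⟩
  have h2 : ContinuousOn (F ∘ g) U := continuousOn_iff_continuous_domRestrict.2 h1
  exact h2.continuousAt (hU.2.mem_nhds hx)

lemma LblFam.map_toPoint {n : ℕ} {a : K → Lbl O M n} (h : LblFam a) (x y : K) :
    (a x).map (IbimoduleHom.toPoint.{u, 0} M) n = (a y).map (IbimoduleHom.toPoint.{u, 0} M) n := by
  rcases h with ⟨a, -, rfl⟩ | ⟨a, -, rfl⟩ <;> rfl

lemma Fam.map_toPoint {f : K → Tr (Lbl O M) k} (h : Fam f) (x y : K) :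
    (f x).map (Lbl.map (IbimoduleHom.toPoint.{u, 0} M)) =
      (f y).map (Lbl.map (IbimoduleHom.toPoint.{u, 0} M)) := by
  induction h with
  | leaf i => rfl
  | node a ha ch h ih => simp only [Tr.map, ih, LblFam.map_toPoint ha x y]

lemma Fam.tree_eq {f : K → PlanarTree O M k 2} (h : Fam fun x => (f x).1) (x y : K) :
    (mk (f x)).tree = (mk (f y)).tree := by
  refine congrArg mk ?_
  have := h.map_toPoint x y
  simp only [PlanarTree.map, this]

end LTree

/-! ### Barycentric and cubical coordinates on the under-posets of a pearled tree -/

namespace LTree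

lemma laminar (z : LTree O M k) : Laminar z.vertexSets := by
  induction z using ind with
  | h D => exact D.2.laminar

lemma vertexSets_contractAll (F : Finset (Finset (Option (Fin k)))) (hF : Finset.univ ∉ F)
    (z : LTree O M k) : (contractAll F z).vertexSets = z.vertexSets \ F := by
  induction F using Finset.induction with
  | empty => rw [contractAll_empty, Finset.sdiff_empty]
  | insert v F hv ih =>
    rw [Finset.mem_insert, not_or] at hF
    rw [contractAll_insert _ _ hv, vertexSets_contract (Ne.symm hF.1), ih hF.2,
      Finset.sdiff_insert]

end LTree

namespace Psi

open LTree

lemma le_contract (v : Finset (Option (Fin k))) (s : Psi k) : s ≤ contract v s :=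
  Relation.ReflTransGen.single ⟨v, rfl⟩

lemma le_contractAll (F : Finset (Finset (Option (Fin k)))) (s : Psi k) :
    s ≤ contractAll F s := by
  induction F using Finset.induction with
  | empty => exact le_refl s
  | insert v F hv ih =>
    rw [contractAll_insert _ _ hv]
    exact ih.trans (le_contract v _)

/-- Above a common tree `c`, each tree is the contraction of `c` along the edges it lacks. If `q`
has fewer edges than `p`, the contraction to `q` can be carried out through `p`. -/
lemma le_iff {c p q : Psi k} (hp : c ≤ p) (hq : c ≤ q) :
    p ≤ q ↔ vertexSets q ⊆ vertexSets p := by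
  refine ⟨fun h => (le_vertexSets h).1, fun h => ?_⟩
  have h1 := (le_vertexSets hp).1
  have e : contractAll (vertexSets c \ vertexSets q) c =
      contractAll (vertexSets p \ vertexSets q) (contractAll (vertexSets c \ vertexSets p) c) := by
    rw [← contractAll_disjUnion _ _ (Finset.disjoint_left.2 fun x hx hx' =>
      (Finset.mem_sdiff.1 hx').2 (Finset.mem_sdiff.1 hx).1)]
    congr 1
    ext x
    simp only [Finset.mem_sdiff, Finset.mem_disjUnion]
    have h3 : x ∈ vertexSets p → x ∈ vertexSets c := fun h => h1 h
    have h4 : x ∈ vertexSets q → x ∈ vertexSets p := fun h' => h h'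
    tauto
  rw [← (le_vertexSets hp).2, ← (le_vertexSets hq).2] at e
  rw [e]
  exact le_contractAll _ _

instance (c : Psi k) : Finite (Set.Ici c) := by
  refine Finite.of_injective (fun p : Set.Ici c => vertexSets p.1) fun p q h => Subtype.ext ?_
  exact le_antisymm ((le_iff p.2 q.2).2 (Eq.ge h)) ((le_iff q.2 p.2).2 (Eq.le h))

/-- The inner edges of the trees obtained by contracting inner edges of `c`. -/
def edges (c : Psi k) (p : Set.Ici c) : Finset (Finset (Option (Fin k))) :=
  (vertexSets p.1).erase Finset.univ

lemma edges_le_iff (c : Psi k) (p q : Set.Ici c) : p ≤ q ↔ edges c q ⊆ edges c p := by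
  rw [← Subtype.coe_le_coe, le_iff p.2 q.2, edges, edges]
  refine ⟨Finset.erase_subset_erase _, fun h => ?_⟩
  rw [← Finset.insert_erase (laminar q.1).univ_mem, ← Finset.insert_erase (laminar p.1).univ_mem]
  exact Finset.insert_subset_insert _ h

/-- Contracting the edges outside `F` leaves exactly `F`. With `edges_le_iff`, this identifies the
under-poset with the full lattice of subsets, ordered by reverse inclusion. -/
lemma exists_edges_eq (c : Psi k) (F : Finset (Finset (Option (Fin k))))
    (hF : F ⊆ edges c ⟨c, le_refl c⟩) : ∃ p, edges c p = F := by
  refine ⟨⟨_, le_contractAll (edges c ⟨c, le_refl c⟩ \ F) c⟩, ?_⟩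
  rw [edges, vertexSets_contractAll _ (by simp [edges])]
  ext e
  simp only [edges, Finset.mem_erase, Finset.mem_sdiff]
  have h := fun h : e ∈ F => Finset.mem_erase.1 (hF h)
  tauto

/-- The cubical coordinates of a point. -/
noncomputable def coord (c : Psi k) (x : Realization (Set.Ici c)) :
    Finset (Option (Fin k)) → ℝ :=
  Realization.weight (edges c) x

lemma coord_mem (c : Psi k) (x : Realization (Set.Ici c)) :
    coord c x ∈ edgeCube (vertexSets c) := by
  refine ⟨fun e => ⟨Realization.weight_nonneg _ _ _, Realization.weight_le_one _ _ _⟩,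
    fun e he => ?_⟩
  obtain ⟨p, -, hp⟩ := Realization.exists_of_weight_ne_zero he
  obtain ⟨h1, h2⟩ := Finset.mem_erase.1 hp
  exact ⟨(le_vertexSets p.2).1 h2, h1⟩

/-- The inner edges of a tree do not depend on the base `c`, so neither do the coordinates. The
edges of `c` absent from `c'` automatically get `0`, and no renormalization is needed in the gluing.
-/
lemma coord_map {c c' : Psi k} (h : c ≤ c') (x : Realization (Set.Ici c')) :
    coord c (x.map (iciIncl h)) = coord c' x :=
  funext fun e => Realization.weight_map _ _ x e

lemma coord_injective (c : Psi k) : Function.Injective (coord c) :=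
  Realization.weight_injective (edges_le_iff c)

lemma exists_coord_eq (c : Psi k) {s : Finset (Option (Fin k)) → ℝ}
    (hs : s ∈ edgeCube (vertexSets c)) : ∃ x, coord c x = s :=
  Realization.exists_weight_eq (edges_le_iff c) (exists_edges_eq c) hs.1
    fun e he => Finset.mem_erase.2 ⟨(hs.2 e he).2, (hs.2 e he).1⟩

lemma continuous_coord (c : Psi k) : Continuous (coord c) :=
  continuous_pi fun e => Realization.continuous_weight _ e

instance (c : Psi k) : Nonempty (Realization (Set.Ici c)) := by
  obtain ⟨x, -⟩ := exists_coord_eq c (s := 0)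
    ⟨fun e => ⟨le_rfl, zero_le_one⟩, fun e he => absurd rfl he⟩
  exact ⟨x⟩

end Psi

/-! ### The numbers of the vertices as coordinates on the under-posets -/

/-- The numbers of the vertices of a tree with given lengths of the inner edges. -/
noncomputable def timeI (s : Finset (Option (Fin k)) → ℝ) (v : Finset (Option (Fin k))) :
    unitInterval :=
  Set.projIcc 0 1 zero_le_one (time none s v)

/-- The truncation to `[0,1]` has no effect on lengths from the cube, since `time` is bounded by the
longest edge. -/
lemma coe_timeI {V : Finset (Finset (Option (Fin k)))} {s : Finset (Option (Fin k)) → ℝ}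
    (hs : s ∈ edgeCube V) {v : Finset (Option (Fin k))} (hv : v.Nonempty) :
    (timeI s v : ℝ) = time none s v := by
  have h0 := time_nonneg none (fun e => (hs.1 e).1) v
  have h1 : time none s v ≤ 1 := (time_le_maxEdge none (fun e => (hs.1 e).1) hv).trans
    (Finset.sup'_le _ _ fun e _ => (hs.1 e).2)
  rw [timeI, Set.projIcc_of_mem zero_le_one ⟨h0, h1⟩]

lemma IsAdm.congr {α : Type*} {o : α} {V : Finset (Finset α)} {θ θ' : Finset α → ℝ}
    (h : IsAdm o V θ) (hθ : ∀ v ∈ V, θ v = θ' v) : IsAdm o V θ' := by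
  refine ⟨fun v hv ho hm => (hθ v hv).symm.trans (h.1 v hv ho hm), fun v w hvw => ?_⟩
  rw [← hθ v hvw.1, ← hθ w hvw.2.1]
  exact h.2 v w hvw

lemma isAdm_timeI {V : Finset (Finset (Option (Fin k)))} (hV : Laminar V)
    {s : Finset (Option (Fin k)) → ℝ} (hs : s ∈ edgeCube V) :
    IsAdm none V fun v => (timeI s v : ℝ) :=
  (isAdm_time none hV hs).congr fun v hv => (coe_timeI hs (hV.nonempty v hv)).symm

lemma isAdm_zero (V : Finset (Finset (Option (Fin k)))) :
    IsAdm none V fun v => ((0 : Finset (Option (Fin k)) → unitInterval) v : ℝ) :=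
  ⟨fun _ _ _ _ => rfl, fun _ _ _ => ⟨fun _ => le_rfl, fun _ => le_rfl⟩⟩

namespace Psi

open LTree

lemma eq_of_timeI_eq {c : Psi k} {x y : Realization (Set.Ici c)}
    (h : ∀ v ∈ vertexSets c, timeI (coord c x) v = timeI (coord c y) v) : x = y := by
  refine coord_injective c (time_injOn none (laminar c) (coord_mem c x) (coord_mem c y)
    fun v hv => ?_)
  have hne := (laminar c).nonempty v hv
  rw [← coe_timeI (coord_mem c x) hne, ← coe_timeI (coord_mem c y) hne, h v hv]

lemma exists_timeI_eq {c : Psi k} {θ : Finset (Option (Fin k)) → unitInterval}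
    (h : IsAdm none (vertexSets c) fun v => (θ v : ℝ)) :
    ∃ x, ∀ v ∈ vertexSets c, timeI (coord c x) v = θ v := by
  obtain ⟨s, hs, hsθ⟩ := exists_time_eq none (laminar c) h fun v _ => ⟨(θ v).2.1, (θ v).2.2⟩
  obtain ⟨x, rfl⟩ := exists_coord_eq c hs
  exact ⟨x, fun v hv => Subtype.ext
    ((coe_timeI hs ((laminar c).nonempty v hv)).trans (hsθ v hv))⟩

/-- The point of the realization with given numbers. -/
noncomputable def pos (c : Psi k) (θ : Finset (Option (Fin k)) → unitInterval) :
    Realization (Set.Ici c) :=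
  Classical.epsilon fun x => ∀ v ∈ vertexSets c, timeI (coord c x) v = θ v

lemma timeI_pos {c : Psi k} {θ : Finset (Option (Fin k)) → unitInterval}
    (h : IsAdm none (vertexSets c) fun v => (θ v : ℝ)) {v : Finset (Option (Fin k))}
    (hv : v ∈ vertexSets c) : timeI (coord c (pos c θ)) v = θ v :=
  Classical.epsilon_spec (exists_timeI_eq h) v hv

lemma pos_eq {c : Psi k} {θ : Finset (Option (Fin k)) → unitInterval}
    {x : Realization (Set.Ici c)} (h : ∀ v ∈ vertexSets c, timeI (coord c x) v = θ v) :
    pos c θ = x := by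
  have := Classical.epsilon_spec (p := fun x : Realization (Set.Ici c) =>
    ∀ v ∈ vertexSets c, timeI (coord c x) v = θ v) ⟨x, h⟩
  exact eq_of_timeI_eq fun v hv => (this v hv).trans (h v hv).symm

lemma continuous_timeI_coord {c : Psi k} {v : Finset (Option (Fin k))} (hv : v.Nonempty) :
    Continuous fun x => timeI (coord c x) v :=
  continuous_projIcc.comp ((continuousOn_time none (laminar c) hv).comp_continuous
    (continuous_coord c) (coord_mem c))

/-- The numbers define a continuous injection from a compact space to a Hausdorff space, hence a
closed embedding; continuity can be tested on them, and no formula for the inverse of `time` is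
required. -/
lemma continuous_of_timeI {c : Psi k} {K : Type*} [TopologicalSpace K]
    {y : K → Realization (Set.Ici c)}
    (h : ∀ v ∈ vertexSets c, Continuous fun x => timeI (coord c (y x)) v) : Continuous y := by
  let ν : Realization (Set.Ici c) → vertexSets c → unitInterval := fun x v => timeI (coord c x) v
  have hν : Topology.IsClosedEmbedding ν :=
    (continuous_pi fun v => continuous_timeI_coord
      ((laminar c).nonempty v.1 v.2) : Continuous ν).isClosedEmbedding
      fun x y h => eq_of_timeI_eq fun v hv => congrFun h ⟨v, hv⟩
  exact hν.isEmbedding.continuous_iff.2 (continuous_pi fun v => h v.1 v.2)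

/-- Some number is `1` exactly when some edge has coordinate `1`, that is, survives in every tree of
the supporting chain. The sets of edges along a chain are nested, so this happens exactly when none
of them is empty. -/
lemma exists_timeI_eq_one_iff {c : Psi k} {x : Realization (Set.Ici c)} :
    (∃ v ∈ vertexSets c, timeI (coord c x) v = 1) ↔
      ∀ p, x.1 p ≠ 0 → vertexSets p.1 ≠ {Finset.univ} := by
  have h1 : (∃ v ∈ vertexSets c, timeI (coord c x) v = 1) ↔ ∃ e, coord c x e = 1 := by
    rw [← exists_mem_time_eq_one_iff none (laminar c) (coord_mem c x)]
    refine exists_congr fun v => and_congr_right fun hv => ?_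
    rw [← coe_timeI (coord_mem c x) ((laminar c).nonempty v hv)]
    exact ⟨fun h => congrArg Subtype.val h, fun h => Subtype.ext h⟩
  rw [h1]
  constructor
  · rintro ⟨e, he⟩ p hp hpV
    have := Realization.mem_of_weight_eq_one he hp
    rw [edges, hpV] at this
    simp at this
  · intro h
    have hne : (edges c ⟨c, le_refl c⟩).Nonempty := by
      obtain ⟨p, hp⟩ := x.support_nonempty
      have hp' := h p (Finsupp.mem_support_iff.1 hp)
      rw [Finset.nonempty_iff_ne_empty]
      intro h0
      have h2 := (edges_le_iff c ⟨c, le_refl c⟩ p).1 p.2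
      rw [h0, Finset.subset_empty, edges, Finset.erase_eq_empty_iff] at h2
      rcases h2 with h2 | h2
      · have := (laminar p.1).univ_mem
        rw [h2] at this
        simp at this
      · exact hp' h2
    -- The largest tree of the chain: its edges are edges of every other tree of the chain.
    obtain ⟨q, hq, hmax⟩ := Finset.exists_min_image x.1.support
      (fun p => (edges c p).card) x.support_nonempty
    have hq' : (edges c q).Nonempty := by
      rw [Finset.nonempty_iff_ne_empty]
      intro h2
      rw [edges, Finset.erase_eq_empty_iff] at h2
      rcases h2 with h2 | h2
      · have := (laminar q.1).univ_mem
        rw [h2] at this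
        simp at this
      · exact h q (Finsupp.mem_support_iff.1 hq) h2
    obtain ⟨e, he⟩ := hq'
    refine ⟨e, Realization.weight_eq_one fun p hp => ?_⟩
    have hp' := Finsupp.mem_support_iff.2 hp
    rcases x.2.2.2.total (Finset.mem_coe.2 hp') (Finset.mem_coe.2 hq) with h2 | h2
    · exact (edges_le_iff c p q).1 h2 he
    · rw [Finset.eq_of_subset_of_card_le ((edges_le_iff c q p).1 h2) (hmax p hp')]
      exact he

/-- There is only one pearled tree whose only vertex is the pearl. -/
lemma eq_of_vertexSets_eq_singleton {s t : Psi k} (hs : vertexSets s = {Finset.univ})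
    (ht : vertexSets t = {Finset.univ}) : s = t := by
  -- Such a tree is a pearl with leaves attached in some order. A child that is a vertex would
  -- contribute a second set, properly smaller than the whole.
  have key : ∀ D : PlanarTree pointOperad.{0} pointIbimodule.{0} k 2,
      (mk D).vertexSets = {Finset.univ} → ∃ (n : ℕ) (σ : Fin n ≃ Fin k),
        D.1 = .node n (Lbl.pearl PUnit.unit) fun i => .leaf (σ i) := by
    intro D hD
    rw [vertexSets_mk] at hD
    have hp := D.2
    revert hD hp
    rcases D.1 with i | ⟨n, a, ch⟩
    · intro hD; simp [Tr.vertexSets] at hD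
    intro hD hp
    have hch : ∀ i, ∃ j, ch i = .leaf j := by
      intro i
      rcases hc : ch i with j | ⟨m, b, ch'⟩
      · exact ⟨j, rfl⟩
      · exfalso
        have h1 : (ch i).supp ∈ (ch i).vertexSets := by
          rw [hc]; exact Tr.mem_vertexSets_node.2 (.inl rfl)
        have h2 := Tr.mem_vertexSets_node (a := a) |>.2 (.inr ⟨i, h1⟩)
        rw [hD, Finset.mem_singleton] at h2
        have h3 := hp.ok.supp_ssubset i
        rw [h2, hp.supp] at h3
        exact h3.2 subset_rfl
    choose σ hσ using hch
    have ha : a = Lbl.pearl PUnit.unit := by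
      have h1 := hp.2 none
      simp only [Tr.count, if_true, hσ, reduceCtorEq, if_false, Finset.sum_const_zero,
        add_zero] at h1
      rcases a with a | a | a
      · simp [Lbl.pearls] at h1
      · rfl
      · simp [Lbl.pearls] at h1
    have hbij : Function.Bijective σ := by
      have hcard : ∀ i, (Finset.univ.filter fun j => σ j = i).card = 1 := by
        intro i
        have h1 := hp.2 (some i)
        simp only [Tr.count, reduceCtorEq, if_false, hσ, Option.some.injEq, zero_add] at h1
        exact (Finset.card_filter _ _).trans
          ((Finset.sum_congr rfl fun j _ => if_congr eq_comm rfl rfl).trans h1)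
      constructor
      · intro i j hij
        exact Finset.card_le_one.1 (hcard (σ j)).le i (by simp [hij]) j (by simp)
      · intro i
        obtain ⟨j, hj⟩ := Finset.card_pos.1 ((hcard i).symm ▸ Nat.one_pos)
        exact ⟨j, by simpa using hj⟩
    refine ⟨n, Equiv.ofBijective σ hbij, ?_⟩
    rw [ha]
    congr 1
    exact funext hσ
  induction s using LTree.ind with
  | h D =>
  induction t using LTree.ind with
  | h E =>
  obtain ⟨n, σ, hD⟩ := key D hs
  obtain ⟨m, τ, hE⟩ := key E ht
  rw [mk_eq_iff, hD, hE]
  refine Tr.Iso.node (O := pointOperad.{0}) (M := pointIbimodule.{0}) (σ.trans τ.symm)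
    (Lbl.pearl PUnit.unit) (fun i => .leaf (σ i)) (fun i => .leaf (τ i)) fun i => ?_
  rw [Equiv.trans_apply, Equiv.apply_symm_apply]
  exact .leaf _

/-- Contracting all inner edges of any tree leaves only the set of the root, and
`eq_of_vertexSets_eq_singleton` says that the result is always the same tree, the pearled corolla.
-/
lemma isTop_iff {c : Psi k} : IsTop c ↔ vertexSets c = {Finset.univ} := by
  have hcontr : ∀ t : Psi k,
      vertexSets (contractAll ((vertexSets t).erase Finset.univ) t) = {Finset.univ} := fun t => by
    rw [vertexSets_contractAll _ (by simp)]
    ext e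
    simp only [Finset.mem_sdiff, Finset.mem_erase, Finset.mem_singleton]
    have := (laminar t).univ_mem
    constructor
    · intro h
      by_contra hne
      exact h.2 ⟨hne, h.1⟩
    · rintro rfl
      exact ⟨this, by simp⟩
  constructor
  · intro h
    rw [le_antisymm (le_contractAll _ c) (h _)]
    exact hcontr c
  · intro h t
    rw [eq_of_vertexSets_eq_singleton h (hcontr t)]
    exact le_contractAll _ t

end Psi

/-! ### Trees with numbers and the homotopy colimit -/

namespace Tr

lemma Good.mono {r s : ℕ} (hrs : r ≤ s) {D : Tr (Lbl O M) k} (h : D.Good s) : D.Good r := by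
  induction D with
  | leaf i => trivial
  | node n a ch ih =>
    refine ⟨?_, fun i => ih i (h.2 i)⟩
    have h1 := h.1
    rcases a with a | a | a
    · exact hrs.trans h1
    · trivial
    · exact h1

lemma Pearled.mono {r s : ℕ} (hrs : r ≤ s) {D : Tr (Lbl O M) k} (h : D.Pearled s) :
    D.Pearled r := ⟨h.1.mono hrs, h.2⟩

lemma red_eq_self {D : Tr (TLbl O M) k} (h : D.forget.Good 2) : D.red = D := by
  induction D with
  | leaf i => rfl
  | node n a ch ih =>
    rw [red_node]
    · exact congrArg (node n a) (funext fun i => ih i (h.2 i))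
    · rintro ⟨rfl, ha⟩
      obtain ⟨a, t⟩ := a
      have h1 : a.Good 2 := h.1
      rcases a with a | a | a
      · exact absurd (show 2 ≤ 1 from h1) (by norm_num)
      · exact absurd (show 1 = 0 from ha) one_ne_zero
      · exact h1

lemma reflTransGen_adm {D E : Tr (TLbl O M) k} (h : Relation.ReflTransGen Elem D E)
    (hD : D.Adm) : E.Adm := by
  induction h with
  | refl => exact hD
  | tail _ h ih => exact (h.adm_aux ih).1

lemma tmap_deco {O' : TopOperad.{v}} {M' : Ibimodule O'} {φ : OperadHom O O'}
    (f : IbimoduleHom φ M M') (θ : Finset (Option (Fin k)) → unitInterval)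
    (D : Tr (Lbl O M) k) : (D.deco θ).tmap f = (D.map (Lbl.map f)).deco θ := by
  induction D with
  | leaf i => rfl
  | node n a ch ih =>
    have h1 : supp (node n (a.map f n) fun i => (ch i).map (Lbl.map f)) = supp (node n a ch) :=
      supp_map f (node n a ch)
    change node n (a.map f n, θ (supp (node n a ch))) (fun i => ((ch i).deco θ).tmap f) =
      node n (a.map f n, θ (supp (node n (a.map f n) fun i => (ch i).map (Lbl.map f))))
        fun i => ((ch i).map (Lbl.map f)).deco θ
    rw [h1, funext ih]

end Tr

/-! ### From trees with numbers to points of the resolution -/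

open Classical in
/-- The tree `D` with the numbers `θ` if these are admissible. -/
noncomputable def PlanarTree.decorate (θ : Finset (Option (Fin k)) → unitInterval)
    (D : PlanarTree O M k 2) : IbTree O M k :=
  if h : (D.tr.deco θ).Adm then
    ⟨D.tr.deco θ, by rw [Tr.forget_deco]; exact D.pearled.mono one_le_two, h⟩
  else
    ⟨D.tr.deco 0, by rw [Tr.forget_deco]; exact D.pearled.mono one_le_two,
      D.pearled.ok.adm_deco_iff.2 (isAdm_zero _)⟩

lemma PlanarTree.decorate_eq {θ : Finset (Option (Fin k)) → unitInterval}
    {D : PlanarTree O M k 2} {E : IbTree O M k} (h : E.tr = D.tr.deco θ) : D.decorate θ = E := by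
  obtain ⟨E, h1, h2⟩ := E
  obtain rfl : E = _ := h
  exact dif_pos h2

lemma PlanarTree.tr_decorate {θ : Finset (Option (Fin k)) → unitInterval}
    {D : PlanarTree O M k 2} (h : IsAdm none D.tr.vertexSets fun v => (θ v : ℝ)) :
    (D.decorate θ).tr = D.tr.deco θ := by
  rw [decorate, dif_pos (D.pearled.ok.adm_deco_iff.2 h)]

/-- The point of the resolution given by a non-planar tree with numbers. -/
noncomputable def LTree.place (θ : Finset (Option (Fin k)) → unitInterval) (z : LTree O M k) :
    Ib O M k :=
  Quotient.lift (fun D : PlanarTree O M k 2 => Ib.mk (D.decorate θ)) (fun D E h => by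
    have h' : D.tr.Iso E.tr := h
    have hiff : (D.tr.deco θ).Adm ↔ (E.tr.deco θ).Adm := by
      rw [D.pearled.ok.adm_deco_iff, E.pearled.ok.adm_deco_iff, h'.vertexSets_eq]
    refine Ib.mk_eq_of_reflTransGen ?_
    simp only [PlanarTree.decorate]
    by_cases hD : (D.tr.deco θ).Adm
    · rw [dif_pos hD, dif_pos (hiff.1 hD)]
      exact h'.reflTransGen θ
    · rw [dif_neg hD, dif_neg (fun h => hD (hiff.2 h))]
      exact h'.reflTransGen 0) z

namespace LTree

lemma place_mk (θ : Finset (Option (Fin k)) → unitInterval) (D : PlanarTree O M k 2) :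
    (mk D).place θ = Ib.mk (D.decorate θ) := rfl

/-- An edge of length `0` joins vertices with equal numbers, so its contraction is one of the
relations of the resolution. The numbers of the other vertices stay the same, because `time` is
computed from `s` without reference to the tree. -/
lemma place_contract {v : Finset (Option (Fin k))} {z : LTree O M k}
    {s : Finset (Option (Fin k)) → ℝ} (hs : s ∈ edgeCube z.vertexSets) (h0 : s v = 0) :
    (contract v z).place (timeI s) = z.place (timeI s) := by
  by_cases h : v ∈ z.vertexSets ∧ v ≠ Finset.univ
  · induction z using ind with
    | h D =>
      obtain ⟨D', hD'⟩ := exists_step h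
      have hV : D'.tr.vertexSets = D.tr.vertexSets.erase v := (hD'.spec D.2.ok).2.2.2.2
      have hs' : s ∈ edgeCube D'.tr.vertexSets :=
        ⟨hs.1, fun e he => ⟨by
          rw [hV]
          exact Finset.mem_erase.2 ⟨fun h => he (h ▸ h0), (hs.2 e he).1⟩, (hs.2 e he).2⟩⟩
      rw [contract_mk hD', place_mk, place_mk]
      refine (Quot.sound ?_).symm
      rw [PlanarTree.tr_decorate (isAdm_timeI D.2.laminar hs),
        PlanarTree.tr_decorate (isAdm_timeI D'.2.laminar hs')]
      exact hD'.ibRel D.2.ok fun w hw =>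
        congrArg (Set.projIcc 0 1 zero_le_one) (time_eq_of_covers none D.2.laminar hs hw h0)
  · rw [contract_of_not h]

lemma place_contractAll {F : Finset (Finset (Option (Fin k)))} {z : LTree O M k}
    {s : Finset (Option (Fin k)) → ℝ} (hs : s ∈ edgeCube z.vertexSets) (h0 : ∀ v ∈ F, s v = 0) :
    (contractAll F z).place (timeI s) = z.place (timeI s) := by
  -- The induction also carries that `s` remains supported on the edges of the contracted tree.
  suffices h : s ∈ edgeCube (contractAll F z).vertexSets ∧
      (contractAll F z).place (timeI s) = z.place (timeI s) from h.2
  induction F using Finset.induction with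
  | empty => exact ⟨hs, rfl⟩
  | insert v F hv ih =>
    obtain ⟨h1, h2⟩ := ih fun w hw => h0 w (Finset.mem_insert_of_mem hw)
    have hv0 := h0 v (Finset.mem_insert_self v F)
    rw [contractAll_insert _ _ hv, place_contract h1 hv0]
    refine ⟨?_, h2⟩
    rcases vertexSets_subset_of_contract v (contractAll F z) with h3 | ⟨-, h3⟩
    · rwa [h3]
    · rw [h3]
      exact ⟨h1.1, fun e he =>
        ⟨Finset.mem_erase.2 ⟨fun h => he (h ▸ hv0), (h1.2 e he).1⟩, (h1.2 e he).2⟩⟩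

lemma continuous_place {K : Type u} [TopologicalSpace K] [CompactSpace K] [T2Space K]
    {f : K → PlanarTree O M k 2} (hf : Fam fun x => (f x).tr)
    {θ : K → Finset (Option (Fin k)) → unitInterval}
    (ha : ∀ x, IsAdm none (f x).tr.vertexSets fun v => (θ x v : ℝ))
    (hθ : ∀ v, (∃ x, v ∈ (f x).tr.vertexSets) → Continuous fun x => θ x v) :
    Continuous fun x => (mk (f x)).place (θ x) := by
  have h : TFam fun x => ((f x).decorate (θ x)).tr := by
    simp only [PlanarTree.tr_decorate (ha _)]
    exact hf.deco fun v hv => hθ v hv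
  exact continuous_quot_mk.comp h.continuous_ibTree

lemma Fam.const {K : Type u} [TopologicalSpace K] {D : Tr (Lbl O M) k} {r : ℕ} (h : D.Good r) :
    Fam fun _ : K => D := by
  induction D with
  | leaf i => exact .leaf i
  | node n a ch ih =>
    refine .node (fun _ => a) ?_ _ fun i => ih i (h.2 i)
    have h1 := h.1
    rcases a with a | a | a
    · exact .inl ⟨fun _ => a, continuous_const, rfl⟩
    · exact .inr ⟨fun _ => a, continuous_const, rfl⟩
    · exact h1.elim

/-- The numbers of the vertices of `z`, if `z` has the same vertices as `c`. -/
noncomputable def numbers (c : Psi k) (x : Realization (Set.Ici c))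
    (V : Finset (Finset (Option (Fin k)))) : Finset (Option (Fin k)) → unitInterval :=
  if V = vertexSets c then timeI (Psi.coord c x) else 0

lemma continuous_place_numbers {K : Type u} [TopologicalSpace K] [CompactSpace K] [T2Space K]
    {f : K → PlanarTree O M k 2} (hf : Fam fun x => (f x).tr) (x₀ : K) (c : Psi k) :
    Continuous fun p : K × Realization (Set.Ici c) =>
      (mk (f p.1)).place (numbers c p.2 (f p.1).tr.vertexSets) := by
  have hV : ∀ x, (f x).tr.vertexSets = (f x₀).tr.vertexSets := fun x => hf.vertexSets_eq x x₀
  refine continuous_place (f := fun p : K × Realization (Set.Ici c) => f p.1)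
    (hf.comp_right continuous_fst) (fun p => ?_) fun v hv => ?_
  · rw [numbers]
    split_ifs with h
    · refine isAdm_timeI (f p.1).2.laminar ?_
      rw [h]
      exact Psi.coord_mem c p.2
    · exact isAdm_zero _
  · obtain ⟨p, hp⟩ := hv
    have hne := (f p.1).2.laminar.nonempty v hp
    simp only [hV, numbers]
    split_ifs with h
    · exact (Psi.continuous_timeI_coord hne).comp continuous_snd
    · exact continuous_const

/-- The points of the resolution with underlying labelled tree `z`. -/
noncomputable def placeMap (c : Psi k) (z : LTree O M k) : C(Realization (Set.Ici c), Ib O M k) where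
  toFun x := z.place (numbers c x z.vertexSets)
  continuous_toFun := by
    induction z using ind with
    | h D =>
      have hD : Fam fun _ : PUnit.{u + 1} => D.tr := Fam.const D.2.1
      have h := continuous_place_numbers (f := fun _ : PUnit.{u + 1} => D) hD ⟨⟩ c
      have h' : Continuous fun x : Realization (Set.Ici c) => (PUnit.unit.{u + 1}, x) :=
        continuous_const.prodMk continuous_id
      exact (h.comp h').congr fun x => rfl

/-- Passing to the function space avoids the question whether the product of the realization with
the quotient map to non-planar trees is again a quotient map. The source of `placeMap` being a plain
quotient, continuity is checked on families of planar trees and curried. -/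
lemma continuous_placeMap (c : Psi k) :
    Continuous (placeMap c : LTree O M k → C(Realization (Set.Ici c), Ib O M k)) := by
  refine (isQuotientMap_quot_mk.continuous_iff).2 ?_
  refine continuous_of_fam fun K _ _ _ f hf x₀ => ?_
  exact ContinuousMap.continuous_of_continuous_uncurry _ (continuous_place_numbers hf x₀ c)

/-! ### From trees with numbers to points of the homotopy colimit -/

/-- The point of the homotopy colimit given by a non-planar tree with numbers. -/
noncomputable def collect (z : LTree O M k) (θ : Finset (Option (Fin k)) → unitInterval) :
    hocolim (rho O M k) :=
  hocolim.mk (rho O M k) z.tree (Psi.pos z.tree θ) (⟨z, rfl⟩ : Labelling O M z.tree)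

lemma collect_eq {c : Psi k} {x : Realization (Set.Ici c)} (a : Labelling O M c)
    {θ : Finset (Option (Fin k)) → unitInterval}
    (h : ∀ v ∈ vertexSets c, timeI (Psi.coord c x) v = θ v) :
    collect a.1 θ = hocolim.mk (rho O M k) c x a := by
  obtain ⟨z, rfl⟩ := a
  rw [collect, Psi.pos_eq h]

/-- The point with numbers `θ'` over the contracted tree, regarded over `z`, has the numbers `θ`. It
therefore represents `collect z θ`, and the gluing relation transports it to the contracted tree. -/
lemma collect_contract {z : LTree O M k} {v w : Finset (Option (Fin k))}
    (hvw : Covers z.vertexSets v w) {θ θ' : Finset (Option (Fin k)) → unitInterval}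
    (hθ : θ v = θ w) (h : ∀ u, u ≠ v → θ' u = θ u)
    (ha : IsAdm none (contract v z).vertexSets fun v => (θ' v : ℝ)) :
    collect z θ = collect (contract v z) θ' := by
  have hv : v ≠ Finset.univ := fun h => hvw.2.2.1.2 (h ▸ Finset.subset_univ _)
  have htree : (contract v z).tree = contract v z.tree := map_contract _ v z
  have hle : z.tree ≤ (contract v z).tree := htree ▸ Psi.le_contract v z.tree
  have hV : vertexSets (contract v z).tree = (vertexSets z.tree).erase v := by
    rw [vertexSets_tree, vertexSets_tree, vertexSets_contract hv]
  rw [← vertexSets_tree] at ha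
  rw [← vertexSets_tree] at hvw
  have hmap : (rho O M k).map (homOfLE hle) (⟨z, rfl⟩ : Labelling O M z.tree) =
      (⟨contract v z, rfl⟩ : Labelling O M (contract v z).tree) := by
    refine Subtype.ext ?_
    change contractAll (vertexSets z.tree \ vertexSets (contract v z).tree) z = contract v z
    have : vertexSets z.tree \ vertexSets (contract v z).tree = insert v ∅ := by
      rw [hV]
      ext e
      simp only [Finset.mem_sdiff, Finset.mem_erase, Finset.mem_insert, Finset.notMem_empty,
        or_false]
      constructor
      · intro h
        by_contra hne
        exact h.2 ⟨hne, h.1⟩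
      · rintro rfl
        exact ⟨hvw.1, fun h => h.1 rfl⟩
    rw [this, contractAll_insert _ _ (Finset.notMem_empty v), contractAll_empty]
  have hg := hocolim.glue (F := rho O M k) hle (Psi.pos (contract v z).tree θ')
    (⟨z, rfl⟩ : Labelling O M z.tree)
  rw [hmap] at hg
  refine Eq.trans ?_ hg
  refine collect_eq (⟨z, rfl⟩ : Labelling O M z.tree) fun u hu => ?_
  rw [Psi.coord_map]
  set x := Psi.pos (contract v z).tree θ' with hx
  have hu' : ∀ u ∈ vertexSets z.tree, u ≠ v →
      timeI (Psi.coord (contract v z).tree x) u = θ u := fun u hu huv => by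
    rw [hx, Psi.timeI_pos ha (by rw [hV]; exact Finset.mem_erase.2 ⟨huv, hu⟩), h u huv]
  by_cases huv : u = v
  -- The contracted edge has coordinate `0`, so its upper vertex receives the number of the vertex
  -- below it, and these agree under `θ` by assumption.
  · subst huv
    have hs := Psi.coord_mem (contract u z).tree x
    have h0 : Psi.coord (contract u z).tree x u = 0 := by
      by_contra h0
      have := (hs.2 u h0).1
      rw [hV] at this
      exact (Finset.mem_erase.1 this).1 rfl
    have hs' := edgeCube_mono (hV ▸ Finset.erase_subset _ _ :
      vertexSets (contract u z).tree ⊆ vertexSets z.tree) hs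
    rw [hθ, ← hu' w hvw.2.1 fun h => hvw.2.2.1.ne h.symm]
    exact congrArg (Set.projIcc 0 1 zero_le_one)
      (time_eq_of_covers none (laminar z.tree) hs' hvw h0)
  · exact hu' u hu huv

end LTree

/-! ### The homeomorphism -/

open LTree

/-- The map from the homotopy colimit to the Boardman–Vogt resolution. -/
noncomputable def hocolimToIb (O : TopOperad.{u}) (M : Ibimodule O) (k : ℕ) :
    hocolim (rho O M k) → Ib O M k :=
  Quot.lift (fun y => (show Labelling O M y.1 from y.2.2).1.place
      (timeI (Psi.coord y.1 y.2.1))) (by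
    rintro _ _ ⟨h, x, a⟩
    rename_i c c'
    obtain ⟨z, hz⟩ : Labelling O M c := a
    have hV : z.vertexSets = vertexSets c := by rw [← hz, vertexSets_tree]
    have hsub : vertexSets c' ⊆ vertexSets c := (Psi.le_vertexSets h).1
    have hs := Psi.coord_mem c' x
    change z.place (timeI (Psi.coord c (x.map (iciIncl h)))) =
      (contractAll (vertexSets c \ vertexSets c') z).place (timeI (Psi.coord c' x))
    rw [Psi.coord_map]
    -- The coordinates of a point over `c'` are supported on the edges of `c'`, so they vanish on
    -- all the edges contracted from `c` to `c'`.
    refine (place_contractAll (edgeCube_mono (hV ▸ hsub) hs) fun v hv => ?_).symm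
    by_contra h0
    exact (Finset.mem_sdiff.1 hv).2 (hs.2 v h0).1)

/-- On each piece the map is an evaluation of `placeMap`, and evaluation is jointly continuous
because the realization is compact Hausdorff. -/
lemma continuous_hocolimToIb : Continuous (hocolimToIb O M k) := by
  refine hocolim.continuous_of fun c => ?_
  have h1 : Continuous fun p : KProd (Realization (Set.Ici c)) (Labelling O M c) => p.2.1 :=
    continuous_subtype_val.comp KProd.continuous_snd
  have h2 : Continuous fun p : KProd (Realization (Set.Ici c)) (Labelling O M c) =>
      placeMap c p.2.1 p.1 :=
    ((continuous_placeMap c).comp h1).eval KProd.continuous_fst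
  refine h2.congr fun p => ?_
  have hV : p.2.1.vertexSets = vertexSets c := by
    rw [← vertexSets_tree, p.2.2]
  change p.2.1.place (numbers c p.1 p.2.1.vertexSets) = p.2.1.place (timeI (Psi.coord c p.1))
  rw [hV, numbers, if_pos rfl]

/-! ### The inverse map -/

/-- Removal of the vertices with one input. -/
def IbTree.reduce (hO : O.DoublyReduced) (D : IbTree O M k) : IbTree O M k where
  tr := D.tr.red
  pearled := ⟨(Tr.good_red D.pearled.1).mono one_le_two,
    fun x => (Tr.count_red D.tr x).trans (D.pearled.2 x)⟩
  adm := Tr.reflTransGen_adm (Tr.reflTransGen_red hO D.pearled.1) D.adm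

lemma IbTree.mk_reduce (hO : O.DoublyReduced) (D : IbTree O M k) :
    Ib.mk (D.reduce hO) = Ib.mk D :=
  (Ib.mk_eq_of_reflTransGen (Tr.reflTransGen_red hO D.pearled.1)).symm

/-- The labelled tree underlying a tree with numbers, after removal of the vertices with one
input. -/
def IbTree.planar (D : IbTree O M k) : PlanarTree O M k 2 where
  tr := D.tr.red.forget
  pearled := ⟨Tr.good_red D.pearled.1, fun x => (Tr.count_red D.tr x).trans (D.pearled.2 x)⟩

/-- The number of the vertex `v`, after removal of the vertices with one input. -/
def IbTree.num (D : IbTree O M k) (v : Finset (Option (Fin k))) : unitInterval := D.tr.red.num v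

lemma IbTree.deco_num (D : IbTree O M k) : D.planar.tr.deco D.num = D.tr.red :=
  Tr.deco_num D.planar.2.ok

lemma IbTree.isAdm_num (hO : O.DoublyReduced) (D : IbTree O M k) :
    IsAdm none D.planar.tr.vertexSets fun v => (D.num v : ℝ) := by
  rw [← D.planar.2.ok.adm_deco_iff, D.deco_num]
  exact (D.reduce hO).adm

lemma isAdm_num_tree (hO : O.DoublyReduced) (D : IbTree O M k) :
    IsAdm none (LTree.vertexSets (LTree.mk D.planar).tree) fun v => (D.num v : ℝ) := by
  rw [vertexSets_tree]
  exact D.isAdm_num hO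

lemma collect_eq_of_ibRel (hO : O.DoublyReduced) {D E : IbTree O M k} (h : D.tr.IbRel E.tr) :
    collect (mk D.planar) D.num = collect (mk E.planar) E.num := by
  rcases h.red hO D.pearled.1 fun x => (D.pearled.2 x).le with h | ⟨v, w, F, hs, hF, hvw, hn, hE⟩
  · have h1 : mk D.planar = mk E.planar := mk_eq_iff.2 h.1
    have h2 : D.num = E.num := funext h.2
    rw [h1, h2]
  · have h1 : contract v (mk D.planar) = mk E.planar := by
      rw [contract_mk (D' := ⟨F, hs.pearled D.planar.2⟩) hs, mk_eq_iff]
      exact hF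
    rw [← h1]
    refine collect_contract (z := mk D.planar) hvw hn hE ?_
    rw [h1]
    exact E.isAdm_num hO

/-- The map from the Boardman–Vogt resolution to the homotopy colimit. -/
noncomputable def ibToHocolim (hO : O.DoublyReduced) : Ib O M k → hocolim (rho O M k) :=
  Quot.lift (fun D => collect (mk D.planar) D.num) fun _ _ h => collect_eq_of_ibRel hO h

/-- On a family of fixed shape the reduced underlying tree `c` is constant, the labels vary
continuously, and the point of the realization over `c` does so because its numbers do. -/
lemma continuous_ibToHocolim (hO : O.DoublyReduced) :
    Continuous (ibToHocolim hO : Ib O M k → hocolim (rho O M k)) := by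
  refine (isQuotientMap_quot_mk.continuous_iff).2 ?_
  refine continuous_of_tfam fun K _ _ _ f hf x₀ => ?_
  have hF : Fam fun x => (f x).planar.tr := hf.red.forget
  set c := (mk (f x₀).planar).tree with hc
  have htree : ∀ x, (mk (f x).planar).tree = c := fun x => Fam.tree_eq hF x x₀
  have ha : ∀ x, IsAdm none (vertexSets c) fun v => ((f x).num v : ℝ) := fun x => by
    rw [← htree x]
    exact isAdm_num_tree hO (f x)
  have h1 : Continuous fun x => Psi.pos c (f x).num := Psi.continuous_of_timeI fun v hv => by
    simp only [Psi.timeI_pos (ha _) hv]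
    exact hf.red.continuous_num v
  have h2 : Continuous fun x => (⟨mk (f x).planar, htree x⟩ : Labelling O M c) :=
    (continuous_mk.comp hF.continuous_planarTree).subtype_mk _
  refine ((hocolim.continuous_mk (F := rho O M k) c).comp (continuous_kprod_mk h1 h2)).congr
    fun x => ?_
  exact (collect_eq (⟨mk (f x).planar, htree x⟩ : Labelling O M c)
    fun v hv => Psi.timeI_pos (ha x) hv).symm

lemma hocolimToIb_ibToHocolim (hO : O.DoublyReduced) (x : Ib O M k) :
    hocolimToIb O M k (ibToHocolim hO x) = x := by
  obtain ⟨D, rfl⟩ := Quot.exists_rep x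
  change (mk D.planar).place _ = Ib.mk D
  rw [place_mk, ← D.mk_reduce hO]
  refine congrArg Ib.mk (PlanarTree.decorate_eq (D.deco_num.symm.trans (Tr.deco_congr fun v hv =>
    (Psi.timeI_pos (isAdm_num_tree hO D) ?_).symm)))
  rw [vertexSets_tree]
  exact hv

lemma isAdm_timeI_coord {c : Psi k} (x : Realization (Set.Ici c)) :
    IsAdm none (vertexSets c) fun v => (timeI (Psi.coord c x) v : ℝ) :=
  isAdm_timeI (laminar c) (Psi.coord_mem c x)

lemma PlanarTree.red_decorate {D : PlanarTree O M k 2}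
    {θ : Finset (Option (Fin k)) → unitInterval}
    (h : IsAdm none D.tr.vertexSets fun v => (θ v : ℝ)) :
    (D.decorate θ).tr.red = D.tr.deco θ := by
  rw [PlanarTree.tr_decorate h, Tr.red_eq_self]
  rw [Tr.forget_deco]
  exact D.2.1

/-- The tree produced has no bivalent vertices apart from possibly the pearl, so the reduction
leaves it unchanged. Its labels and numbers are read off again, and numbers determine the point of
the realization. -/
lemma ibToHocolim_hocolimToIb (hO : O.DoublyReduced) (y : hocolim (rho O M k)) :
    ibToHocolim hO (hocolimToIb O M k y) = y := by
  induction y using hocolim.ind with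
  | h c x a =>
  obtain ⟨z, rfl⟩ : Labelling O M c := a
  induction z using LTree.ind with
  | h D =>
  have ha : IsAdm none D.tr.vertexSets fun v => (timeI (Psi.coord (mk D).tree x) v : ℝ) := by
    have := isAdm_timeI_coord x
    rwa [vertexSets_tree] at this
  set E := D.decorate (timeI (Psi.coord (mk D).tree x)) with hE
  have hred : E.tr.red = D.tr.deco _ := PlanarTree.red_decorate ha
  have h1 : E.planar = D := by
    have : E.planar.tr = D.tr := by
      change E.tr.red.forget = D.tr
      rw [hred, Tr.forget_deco]
    obtain ⟨D, hD⟩ := D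
    generalize E.planar = E' at this
    obtain ⟨E', hE'⟩ := E'
    obtain rfl : E' = D := this
    rfl
  refine Eq.trans (b := collect (mk E.planar) E.num) rfl ?_
  rw [h1]
  refine collect_eq (⟨mk D, rfl⟩ : Labelling O M (mk D).tree) fun v hv => ?_
  rw [vertexSets_tree] at hv
  change _ = E.tr.red.num v
  rw [hred, Tr.num_deco D.2.ok hv]

/-- The homotopy colimit is homeomorphic to the Boardman–Vogt resolution. -/
noncomputable def hocolimHomeomorphIb (hO : O.DoublyReduced) (M : Ibimodule O) (k : ℕ) :
    hocolim (rho O M k) ≃ₜ Ib O M k where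
  toFun := hocolimToIb O M k
  invFun := ibToHocolim hO
  left_inv := ibToHocolim_hocolimToIb hO
  right_inv := hocolimToIb_ibToHocolim hO
  continuous_toFun := continuous_hocolimToIb
  continuous_invFun := continuous_ibToHocolim hO

/-! ### Naturality -/

lemma ibMap_place {O' : TopOperad.{v}} {M' : Ibimodule O'} {φ : OperadHom O O'}
    (f : IbimoduleHom φ M M') {z : LTree O M k} {θ : Finset (Option (Fin k)) → unitInterval}
    (h : IsAdm none z.vertexSets fun v => (θ v : ℝ)) :
    ibMap f k (z.place θ) = (z.map f).place θ := by
  induction z using LTree.ind with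
  | h D =>
    refine congrArg Ib.mk (PlanarTree.decorate_eq ?_).symm
    change (D.decorate θ).tr.tmap f = _
    rw [PlanarTree.tr_decorate h, Tr.tmap_deco]
    rfl

lemma ibMap_hocolimToIb {O' : TopOperad.{u}} {M' : Ibimodule O'} {φ : OperadHom O O'}
    (f : IbimoduleHom φ M M') (y : hocolim (rho O M k)) :
    ibMap f k (hocolimToIb O M k y) = hocolimToIb O' M' k (hocolim.map (rhoMap f k) y) := by
  induction y using hocolim.ind with
  | h c x a =>
  obtain ⟨z, rfl⟩ : Labelling O M c := a
  refine ibMap_place f ?_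
  have := isAdm_timeI_coord x
  rwa [vertexSets_tree] at this

/-! ### The boundary and the under-posets -/

lemma isEmbedding_hocolimIncl (S : Set (Psi k)) :
    Topology.IsEmbedding (hocolimIncl (rho O M k) S) :=
  (Topology.IsClosedEmbedding.of_continuous_injective_isClosedMap (continuous_hocolimIncl S)
    (hocolimIncl_injective S) (isClosedMap_hocolimIncl S)).isEmbedding

/-- Membership is moved to the homotopy colimit by the inverse map, where it is a condition on the
support of the point of the realization. This holds for every representative `D`. -/
lemma mem_range_iff (hO : O.DoublyReduced) (S : Set (Psi k)) (D : IbTree O M k) :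
    Ib.mk D ∈ Set.range (fun x => hocolimToIb O M k (hocolimIncl (rho O M k) S x)) ↔
      ∀ q, (Psi.pos (mk D.planar).tree D.num).1 q ≠ 0 → q.1 ∈ S := by
  rw [← mem_range_hocolimIncl (F := rho O M k) S
    (a := (⟨mk D.planar, rfl⟩ : Labelling O M (mk D.planar).tree))]
  change _ ↔ ibToHocolim hO (Ib.mk D) ∈ _
  constructor
  · rintro ⟨y, hy⟩
    rw [← hy]
    exact ⟨y, (ibToHocolim_hocolimToIb hO _).symm⟩
  · rintro ⟨y, hy⟩
    refine ⟨y, ?_⟩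
    change hocolimToIb O M k (hocolimIncl (rho O M k) S y) = _
    rw [hy, hocolimToIb_ibToHocolim]

/-- Avoiding the corolla means that some number is `1` after reduction. The reduced tree has `k`
leaves: its prime component has fewer inputs if a number is `1`, and exactly `k` otherwise. The
equivalence for each representative shows that the filtration condition does not depend on its
choice. -/
lemma mem_range_boundary_iff (hO : O.DoublyReduced) (D : IbTree O M k) :
    Ib.mk D ∈ Set.range (fun x => hocolimToIb O M k
        (hocolimIncl (rho O M k) {T | ¬ IsTop T} x)) ↔ (D.tr.geomInputs : ℤ) ≤ k - 1 := by
  rw [mem_range_iff hO]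
  have h1 : (∀ q, (Psi.pos (mk D.planar).tree D.num).1 q ≠ 0 → q.1 ∈ {T : Psi k | ¬ IsTop T}) ↔
      ∃ v ∈ D.planar.tr.vertexSets, D.num v = 1 := by
    have h2 := Psi.exists_timeI_eq_one_iff (x := Psi.pos (mk D.planar).tree D.num)
    simp only [Set.mem_ofPred_eq, Psi.isTop_iff]
    refine h2.symm.trans (exists_congr fun v => ?_)
    rw [vertexSets_tree]
    refine and_congr_right fun hv => ?_
    rw [Psi.timeI_pos (isAdm_num_tree hO D) (by rw [vertexSets_tree]; exact hv)]
  have hk : D.planar.tr.leaves = k := D.planar.2.leaves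
  have hadm : (D.planar.tr.deco D.num).Adm := by
    rw [D.deco_num]
    exact (D.reduce hO).adm
  rw [h1, ← Tr.geomInputs_red D.adm, ← D.deco_num]
  constructor
  · intro h
    have := (D.planar.2.ok.geomInputs_deco_lt hadm).2 h
    omega
  · intro h
    by_contra! hne
    have := Tr.geomInputs_deco_eq hne
    omega

lemma range_boundary (hO : O.DoublyReduced) :
    Set.range (fun x => hocolimToIb O M k (hocolimIncl (rho O M k) {T | ¬ IsTop T} x)) =
      Ib.boundary O M k := by
  ext x
  constructor
  · obtain ⟨D, rfl⟩ := Quot.exists_rep x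
    intro h
    exact ⟨D, rfl, (mem_range_boundary_iff hO D).1 h⟩
  · rintro ⟨D, rfl, h⟩
    exact (mem_range_boundary_iff hO D).2 h

/-- A point over `c ≥ T` is labelled by `c` itself, as the tree placed has no bivalent vertices
except possibly the pearl. Conversely a point labelled by `T' ≥ T` lies over `T'`, and every tree in
its support is above `T'`, hence above `T`. -/
lemma range_Ici (hO : O.DoublyReduced) (T : Psi k) :
    Set.range (fun x => hocolimToIb O M k (hocolimIncl (rho O M k) (Set.Ici T) x)) =
      {x | ∃ T' : Psi k, T ≤ T' ∧ Ib.LabelledBy x T'} := by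
  ext x
  constructor
  · rintro ⟨y, rfl⟩
    induction y using hocolim.ind with
    | h c x a =>
    obtain ⟨z, hz⟩ : Labelling O M c.1 := a
    refine ⟨c.1, c.2, ?_⟩
    induction z using LTree.ind with
    | h D =>
    set θ := timeI (Psi.coord c.1 (x.map (subIcl (Set.Ici T) c))) with hθ
    have ha : IsAdm none D.tr.vertexSets fun v => (θ v : ℝ) := by
      have h := isAdm_timeI_coord (x.map (subIcl (Set.Ici T) c))
      have hV : vertexSets c.1 = D.tr.vertexSets := by rw [← hz, vertexSets_tree]; rfl
      exact hV ▸ h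
    have htr : (D.decorate θ).tr.forget = D.tr := by
      rw [PlanarTree.tr_decorate ha, Tr.forget_deco]
    refine ⟨D.decorate θ, by rw [htr]; exact D.2, rfl, ?_⟩
    simp only [htr]
    exact hz
  · rintro ⟨T', hT', D, hD, rfl, rfl⟩
    rw [mem_range_iff hO]
    intro q _
    have h1 : D.planar.tr = D.tr.forget := congrArg Tr.forget (Tr.red_eq_self hD.1)
    have h2 : D.planar = ⟨D.tr.forget, hD⟩ := by
      generalize D.planar = E at h1
      obtain ⟨E, hE⟩ := E
      obtain rfl : E = _ := h1
      rfl
    have h3 : (mk D.planar).tree ≤ q.1 := q.2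
    have h4 := congrArg (fun E => (mk E).tree) h2
    exact (hT'.trans h4.ge).trans h3

end BoardmanVogt

theorem theorem4p9 (k : ℕ) :
    ∃ δ : ∀ (O : TopOperad.{u}) (_ : O.DoublyReduced) (M : Ibimodule O),
        hocolim (rho O M k) ≃ₜ Ib O M k,
      (∀ (O O' : TopOperad.{u}) (hO : O.DoublyReduced) (hO' : O'.DoublyReduced)
          (φ : OperadHom O O') (M : Ibimodule O) (M' : Ibimodule O')
          (f : IbimoduleHom φ M M') (x : hocolim (rho O M k)),
        ibMap f k (δ O hO M x) = δ O' hO' M' (hocolim.map (rhoMap f k) x)) ∧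
      ∀ (O : TopOperad.{u}) (hO : O.DoublyReduced) (M : Ibimodule O),
        (Topology.IsEmbedding
            (fun x => δ O hO M (hocolimIncl (rho O M k) {T | ¬ IsTop T} x)) ∧
          Set.range (fun x => δ O hO M (hocolimIncl (rho O M k) {T | ¬ IsTop T} x)) =
            Ib.boundary O M k) ∧
        ∀ T : Psi k,
          Topology.IsEmbedding
            (fun x => δ O hO M (hocolimIncl (rho O M k) (Set.Ici T) x)) ∧
          Set.range (fun x => δ O hO M (hocolimIncl (rho O M k) (Set.Ici T) x)) =
            {x | ∃ T' : Psi k, T ≤ T' ∧ Ib.LabelledBy x T'} := by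
  refine ⟨fun O hO M => hocolimHomeomorphIb hO M k,
    fun O O' hO hO' φ M M' f x => ibMap_hocolimToIb f x, fun O hO M => ⟨⟨?_, ?_⟩, fun T => ⟨?_, ?_⟩⟩⟩
  · exact (hocolimHomeomorphIb hO M k).isEmbedding.comp (isEmbedding_hocolimIncl _)
  · exact range_boundary hO
  · exact (hocolimHomeomorphIb hO M k).isEmbedding.comp (isEmbedding_hocolimIncl _)
  · exact range_Ici hO T
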